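/- **Proposition (Ponzano–Regge amplitude on the 3-ball).** Let $\Delta$ be a finite oriented cellular decomposition of the closed 3-ball (faces are polygons, 3-cells are polyhedra bounded by spheres, the dual complex is again cellular; cells may meet themselves or each other several times). Let $\Gamma=(\partial\Delta)^*$ be the boundary graph: its nodes are the boundary faces, its links $l$ (oriented from $s(l)$ to $t(l)$) are the boundary edges. Assume that $\Gamma$ is connected. Let $T$ be a maximal tree of the complex opened along its boundary, i.e. a set of bulk edges which is a spanning tree of the graph of bulk edges when all boundary vertices are identified to one vertex; thus $T$ contains one edge for each bulk vertex. Let $dg$ be the normalised Haar measure of $\mathrm{SU}(2)$. For group elements $g_f$ on all faces $f$ (transports along the oriented dual edges), let $G_e(g)=\overrightarrow{\prod}_{f\ni e}g_f^{\pm1}$ be the holonomy around a bulk edge $e$, and let $G_l(g)$ be the transport through the bulk around the boundary edge dual to $l$, which enters through the boundary face $s(l)$, crosses in turn the bulk faces at the edge and leaves through the boundary face $t(l)$. The gauge-fixed Ponzano–Regge amplitude of a boundary state $\psi\in L^2(\mathrm{SU}(2)^{L})$, where $L$ is the number of links of $\Gamma$, is $$ \langle Z_\Delta|\psi\rangle=\int\prod_{l\in\Gamma}dh_l\prod_{f\in\Delta}dg_f\;\psi(\{h_l\})\prod_{l\in\Gamma}\delta\big(h_l^{-1}G_l(g)\big)\prod_{e\in\Delta\setminus\partial\Delta,\;e\notin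 T}\delta\big(G_e(g)\big), $$ where the $\delta$-distributions are understood as limits: each is replaced by a sequence of nonnegative continuous functions of integral $1$ with supports shrinking to $\mathbb I$, and the amplitude is the common limit of the resulting integrals, required to exist for all choices of such sequences (independent for different edges). Let $\psi\in L^2(\mathrm{SU}(2)^{L})$ be gauge invariant, $\psi(\{k_{t(l)}h_lk_{s(l)}^{-1}\})=\psi(\{h_l\})$ for all $k$, and continuous at the trivial connection $\{h_l=\mathbb I\}$. Then, for all choices of $T$, of orientations and of base points, the amplitude exists and $$ \langle Z_\Delta|\psi\rangle=\psi(\{h_l=\mathbb I\}_{l\in\Gamma}). $$ -/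

import Mathlib

open MeasureTheory Filter Topology

/-! ### The group `SU(2)` and its normalised Haar measure -/

/-- The group `SU(2)`, with the topology induced from the complex `2 × 2` matrices. -/
abbrev SU2 : Type := Matrix.specialUnitaryGroup (Fin 2) ℂ

namespace SU2

instance instContinuousInv : ContinuousInv SU2 where
  continuous_inv := by
    refine Continuous.subtype_mk (f := fun A : SU2 => star (A : Matrix (Fin 2) (Fin 2) ℂ)) ?_ _
    exact continuous_subtype_val.matrix_conjTranspose

instance instIsTopologicalGroup : IsTopologicalGroup SU2 where

instance instCompactSpace : CompactSpace SU2 := by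
  have hball : IsCompact (Set.pi Set.univ fun _ : Fin 2 =>
      Set.pi Set.univ fun _ : Fin 2 => Metric.closedBall (0 : ℂ) 1) :=
    isCompact_univ_pi fun _ => isCompact_univ_pi fun _ => isCompact_closedBall 0 1
  have hclosed : IsClosed {A : Matrix (Fin 2) (Fin 2) ℂ | star A * A = 1 ∧ A.det = 1} := by
    refine IsClosed.inter ?_ ?_
    · exact isClosed_eq (continuous_id.matrix_conjTranspose.matrix_mul continuous_id)
        continuous_const
    · exact isClosed_eq continuous_id.matrix_det continuous_const
  have hset : ((Matrix.specialUnitaryGroup (Fin 2) ℂ : Set (Matrix (Fin 2) (Fin 2) ℂ))) =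
      {A : Matrix (Fin 2) (Fin 2) ℂ | star A * A = 1 ∧ A.det = 1} := by
    ext A
    simp only [SetLike.mem_coe, Matrix.mem_specialUnitaryGroup_iff, Matrix.mem_unitaryGroup_iff',
      Set.mem_ofPred_eq]
  refine isCompact_iff_compactSpace.mp ?_
  refine IsCompact.of_isClosed_subset hball (hset ▸ hclosed) ?_
  intro A hA i _ j _
  exact mem_closedBall_zero_iff.mpr
    (entry_norm_bound_of_unitary (Matrix.specialUnitaryGroup_le_unitaryGroup hA) i j)

noncomputable instance instMeasurableSpace : MeasurableSpace SU2 := borel SU2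

instance instBorelSpace : BorelSpace SU2 := ⟨rfl⟩

/-- The Haar measure `dg` of `SU(2)`, of total mass one. -/
noncomputable def haar : Measure SU2 := Measure.haarMeasure ⊤

/-- A sequence of regularised `δ`-functions at the identity of `SU(2)`: nonnegative continuous
functions of integral one whose supports shrink to the identity. -/
structure IsDeltaSequence (φ : ℕ → SU2 → ℝ) : Prop where
  continuous : ∀ n, Continuous (φ n)
  nonneg : ∀ n g, 0 ≤ φ n g
  integral_eq_one : ∀ n, ∫ g, φ n g ∂haar = 1
  support_subset : ∀ U ∈ 𝓝 (1 : SU2), ∀ᶠ n in atTop, Function.support (φ n) ⊆ U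

end SU2

/-! ### Oriented three-dimensional cellular complexes

A complex is encoded by its flags (a vertex, inside an edge, inside a face, inside a 3-cell, with
multiplicity when a cell meets itself), that is by the tetrahedra of its barycentric subdivision;
`α i` exchanges the two flags that differ exactly in their `i`-dimensional cell.  Cells may be
glued to themselves: edges may be loops, faces may be monogons, two faces may share several edges.
-/

/-- The permutations of flags underlying a finite oriented cellular complex of dimension three,
possibly with boundary.  A flag fixed by `α 3` lies on a boundary face. -/
structure FlagComplex (D : Type*) where
  α : Fin 4 → D → D
  invol : ∀ i d, α i (α i d) = d
  comm02 : ∀ d, α 0 (α 2 d) = α 2 (α 0 d)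
  comm03 : ∀ d, α 0 (α 3 d) = α 3 (α 0 d)
  comm13 : ∀ d, α 1 (α 3 d) = α 3 (α 1 d)
  /-- the orientation: adjacent flags have opposite signs -/
  sign : D → ℤˣ
  sign_α : ∀ i d, i ≠ 3 → sign (α i d) = -sign d
  sign_α3 : ∀ d, α 3 d ≠ d → sign (α 3 d) = -sign d

namespace FlagComplex

variable {D : Type*}

/-- The orbits of the flags under the `α j` with `j ∈ S`. -/
def Orbit (M : FlagComplex D) (S : Set (Fin 4)) : Type _ :=
  Quot fun d d' : D => ∃ j ∈ S, d' = M.α j d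

/-- The orbit of a flag. -/
def orbit (M : FlagComplex D) (S : Set (Fin 4)) (d : D) : M.Orbit S := Quot.mk _ d

/-- The `i`-cells: two flags have the same `i`-cell when they are joined by moves that change
only cells of other dimensions. -/
abbrev Cell (M : FlagComplex D) (i : Fin 4) : Type _ := M.Orbit {i}ᶜ

/-- The `i`-cell of a flag. -/
abbrev cell (M : FlagComplex D) (i : Fin 4) (d : D) : M.Cell i := M.orbit {i}ᶜ d

instance instFiniteOrbit [Finite D] (M : FlagComplex D) (S : Set (Fin 4)) :
    Finite (M.Orbit S) :=
  inferInstanceAs (Finite (Quot fun d d' : D => ∃ j ∈ S, d' = M.α j d))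

/-- The cell `c` lies on the boundary. -/
def IsBdry (M : FlagComplex D) (i : Fin 4) (c : M.Cell i) : Prop :=
  ∃ d, M.cell i d = c ∧ M.α 3 d = d

/-- The number of `S`-orbits contained in the cell `c`. -/
noncomputable def numOrbitsIn (M : FlagComplex D) (S : Set (Fin 4)) {i : Fin 4} (c : M.Cell i) :
    ℤ :=
  ({o : M.Orbit S | ∃ d, M.orbit S d = o ∧ M.cell i d = c}.ncard : ℤ)

/-- The complex is a cellular decomposition of a 3-manifold, with dual a cellular decomposition
as well. Euler characteristics of connected oriented surfaces express that a surface is a sphere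
(value `2`) or, for a surface with nonempty boundary, a disk (value `1`). -/
structure IsCellular (M : FlagComplex D) : Prop where
  /-- the two ends of an edge are distinct (the edge is not folded about its midpoint) -/
  ends_ne : ∀ d, M.orbit {2, 3} (M.α 0 d) ≠ M.orbit {2, 3} d
  /-- the two sides of a bulk face are distinct (the face is not folded onto itself) -/
  sides_ne : ∀ d, M.α 3 d ≠ d → M.orbit {0, 1} (M.α 3 d) ≠ M.orbit {0, 1} d
  /-- each 3-cell is a ball bounded by a sphere: vertices − edges + faces of the polyhedron -/
  cell_sphere : ∀ c : M.Cell 3,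
    M.numOrbitsIn {1, 2} c - M.numOrbitsIn {0, 2} c + M.numOrbitsIn {0, 1} c = 2
  /-- the bubble around a bulk vertex is a sphere; its vertices, edges and faces are cut out by
  the edges, the faces and the 3-cells of the complex at the vertex -/
  bulk_bubble : ∀ v : M.Cell 0, ¬ M.IsBdry 0 v →
    M.numOrbitsIn {2, 3} v - M.numOrbitsIn {1, 3} v + M.numOrbitsIn {1, 2} v = 2
  /-- the link of a boundary vertex is a disk -/
  bdry_bubble : ∀ v : M.Cell 0, M.IsBdry 0 v →
    M.numOrbitsIn {2, 3} v - M.numOrbitsIn {1, 3} v + M.numOrbitsIn {1, 2} v = 1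

/-- The underlying space: one tetrahedron for each flag, whose `i`-th vertex is the barycentre of
the `i`-cell of the flag; the tetrahedra of `d` and `α i d` are glued along the faces opposite to
their `i`-th vertices. -/
abbrev Realization (M : FlagComplex D) : Type _ :=
  Quot fun p q : (_ : D) × stdSimplex ℝ (Fin 4) =>
    ∃ i, p.2.1 i = 0 ∧ q = ⟨M.α i p.1, p.2⟩

/-- The complex is a cellular decomposition of the closed 3-ball. -/
structure IsBallDecomposition (M : FlagComplex D) : Prop extends M.IsCellular where
  homeo_ball : Nonempty (M.Realization ≃ₜ Metric.closedBall (0 : EuclideanSpace ℝ (Fin 3)) 1)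

/-! ### Bulk and boundary cells, the boundary graph, maximal trees -/

/-- The boundary edges, dual to the links of the boundary graph. -/
abbrev BdryEdge (M : FlagComplex D) : Type _ := {e : M.Cell 1 // M.IsBdry 1 e}

/-- The bulk edges. -/
abbrev BulkEdge (M : FlagComplex D) : Type _ := {e : M.Cell 1 // ¬ M.IsBdry 1 e}

/-- The boundary faces, dual to the nodes of the boundary graph. -/
abbrev BdryFace (M : FlagComplex D) : Type _ := {f : M.Cell 2 // M.IsBdry 2 f}

/-- The step from one face around an edge to the next one: cross the face of the flag (if it is
not a boundary face) into the 3-cell on its other side, and turn inside that 3-cell to its other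
face at the same edge. -/
def turn (M : FlagComplex D) (d : D) : D := M.α 2 (M.α 3 d)

/-- For a flag on a boundary face: the number of 3-cells met on the way around its edge through
the bulk before the other boundary face at that edge is reached. -/
noncomputable def steps (M : FlagComplex D) (d : D) : ℕ :=
  sInf {k | 0 < k ∧ M.α 3 (M.turn^[k] d) = M.turn^[k] d}

theorem exists_steps [Finite D] (M : FlagComplex D) (d : D) (hd : M.α 3 d = d) :
    {k | 0 < k ∧ M.α 3 (M.turn^[k] d) = M.turn^[k] d}.Nonempty := by
  have hinj : Function.Injective M.turn := by
    intro a b hab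
    have h2 := congrArg (M.α 2) hab
    simp only [turn, M.invol] at h2
    have h3 := congrArg (M.α 3) h2
    simpa only [M.invol] using h3
  obtain ⟨n, hn, hp⟩ := (Function.Injective.mem_periodicPts hinj d)
  exact ⟨n, hn, by rw [hp.eq, hd]⟩

theorem steps_spec [Finite D] (M : FlagComplex D) (d : D) (hd : M.α 3 d = d) :
    0 < M.steps d ∧ M.α 3 (M.turn^[M.steps d] d) = M.turn^[M.steps d] d :=
  Nat.sInf_mem (M.exists_steps d hd)

/-- Two vertices are the ends of an edge of `T`. -/
def TreeAdj (M : FlagComplex D) (T : Set M.BulkEdge) (v w : M.Cell 0) : Prop :=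
  ∃ e ∈ T, ∃ d, M.cell 1 d = e.1 ∧ M.cell 0 d = v ∧ M.cell 0 (M.α 0 d) = w

/-- `T` is a maximal tree of the complex opened along its boundary, that is a spanning tree of the
graph formed by the bulk edges, where all boundary vertices count as a single vertex: `T` joins
every bulk vertex to the boundary and has as many edges as there are bulk vertices. -/
structure IsMaximalTree (M : FlagComplex D) (T : Set M.BulkEdge) : Prop where
  connects : ∀ v, ∃ w, M.IsBdry 0 w ∧ Relation.ReflTransGen (M.TreeAdj T) v w
  card_eq : T.ncard = Nat.card {v : M.Cell 0 // ¬ M.IsBdry 0 v}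

/-- Auxiliary choices which give a meaning to the group variables and the ordered products: an
orientation of the dual edges, and a starting flag on every edge, which fixes the root and
the sense of the loop dual to a bulk edge, and the orientation of the link dual to a
boundary edge. -/
structure Framing (M : FlagComplex D) where
  /-- whether the dual edge leaves the 3-cell of the flag through the face of the flag -/
  out : D → Bool
  out_α0 : ∀ d, out (M.α 0 d) = out d
  out_α1 : ∀ d, out (M.α 1 d) = out d
  out_α3 : ∀ d, M.α 3 d ≠ d → out (M.α 3 d) = !out d
  base : M.Cell 1 → D
  cell_base : ∀ e, M.cell 1 (base e) = e
  base_bdry : ∀ e, M.IsBdry 1 e → M.α 3 (base e) = base e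

namespace Framing

variable {M : FlagComplex D}

/-- The source node of the link dual to a boundary edge. -/
def source (o : M.Framing) (l : M.BdryEdge) : M.BdryFace :=
  ⟨M.cell 2 (o.base l.1), _, rfl, o.base_bdry l.1 l.2⟩

/-- The target node of the link dual to a boundary edge. -/
noncomputable def target [Finite D] (o : M.Framing) (l : M.BdryEdge) : M.BdryFace :=
  ⟨M.cell 2 (M.turn^[M.steps (o.base l.1)] (o.base l.1)), _, rfl,
    (M.steps_spec _ (o.base_bdry l.1 l.2)).2⟩

/-- The boundary graph, with nodes the boundary faces and links the boundary edges, is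
connected. -/
def ConnectedBoundaryGraph [Finite D] (o : M.Framing) : Prop :=
  ∀ n n' : M.BdryFace, Relation.EqvGen (fun a b => ∃ l, o.source l = a ∧ o.target l = b) n n'

/-- Invariance of a boundary wave-function under gauge transformations
`h_l ↦ k_{t(l)} h_l k_{s(l)}⁻¹`. -/
def GaugeInvariant [Finite D] (o : M.Framing) (ψ : (M.BdryEdge → SU2) → ℂ) : Prop :=
  ∀ (k : M.BdryFace → SU2) (h : M.BdryEdge → SU2),
    ψ (fun l => k (o.target l) * h l * (k (o.source l))⁻¹) = ψ h

/-! ### Holonomies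

Parallel transports compose to the left: the transport along a path that runs first along `γ` and
then along `γ'` is `g_γ' * g_γ`. -/

/-- The transport out of the 3-cell of the flag `d` through the face of `d`, into the 3-cell on
the other side, or to the boundary node dual to the face when that is a boundary face. -/
def cross (o : M.Framing) (g : M.Cell 2 → SU2) (d : D) : SU2 :=
  if o.out d then g (M.cell 2 d) else (g (M.cell 2 d))⁻¹

/-- The ordered product of the transports through `m` successive faces around an edge, beginning
with the face of `d`. -/
def path (o : M.Framing) (g : M.Cell 2 → SU2) (d : D) : ℕ → SU2
  | 0 => 1
  | m + 1 => o.cross g (M.turn^[m] d) * o.path g d m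

/-- The holonomy around a bulk edge: the ordered product over all the faces at the edge. -/
noncomputable def bulkHolonomy (o : M.Framing) (g : M.Cell 2 → SU2) (e : M.BulkEdge) : SU2 :=
  o.path g (o.base e.1) (Function.minimalPeriod M.turn (o.base e.1))

/-- The transport through the bulk around a boundary edge, from the source node to the target node
of the dual link: enter through the source face, cross the bulk faces at the edge one after the
other, and leave through the target face. -/
noncomputable def bdryTransport (o : M.Framing) (g : M.Cell 2 → SU2) (l : M.BdryEdge) : SU2 :=
  o.path g (M.turn (o.base l.1)) (M.steps (o.base l.1)) * (o.cross g (o.base l.1))⁻¹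

/-! ### The Ponzano–Regge amplitude -/

section Amplitude

variable [Finite D]

noncomputable local instance instFintypeOfFinite {ι : Type*} [Finite ι] : Fintype ι :=
  Fintype.ofFinite ι

/-- The product Haar measure `∏ dh_l` on the discrete connections on the boundary graph. -/
noncomputable def bdryMeasure (M : FlagComplex D) : Measure (M.BdryEdge → SU2) :=
  Measure.pi fun _ => SU2.haar

/-- The product Haar measure `∏ dg_f` over all faces. -/
noncomputable def faceMeasure (M : FlagComplex D) : Measure (M.Cell 2 → SU2) :=
  Measure.pi fun _ => SU2.haar

/-- The Ponzano–Regge integrand, gauge-fixed along `T`, with the `δ`-distribution at the edge `e`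
replaced by the function `δ e`. -/
noncomputable def integrand (o : M.Framing) (T : Set M.BulkEdge) (ψ : (M.BdryEdge → SU2) → ℂ)
    (δ : M.Cell 1 → SU2 → ℝ) (p : (M.BdryEdge → SU2) × (M.Cell 2 → SU2)) : ℂ :=
  ψ p.1 *
    ((∏ l : M.BdryEdge, δ l.1 ((p.1 l)⁻¹ * o.bdryTransport p.2 l) : ℝ) : ℂ) *
    ((∏ e : {e : M.BulkEdge // e ∉ T}, δ e.1.1 (o.bulkHolonomy p.2 e.1) : ℝ) : ℂ)

/-- The Ponzano–Regge amplitude of the boundary state `ψ`, gauge-fixed along `T`, exists and is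
equal to `z`: whatever regularisations of the `δ`-distributions are chosen, independently for the
different edges, the regularised integrals converge to `z`. -/
def HasAmplitude (o : M.Framing) (T : Set M.BulkEdge) (ψ : (M.BdryEdge → SU2) → ℂ) (z : ℂ) :
    Prop :=
  ∀ δ : ℕ → M.Cell 1 → SU2 → ℝ, (∀ e, SU2.IsDeltaSequence fun n => δ n e) →
    (∀ n, Integrable (o.integrand T ψ (δ n)) ((bdryMeasure M).prod (faceMeasure M))) ∧
    Tendsto (fun n => ∫ p, o.integrand T ψ (δ n) p ∂((bdryMeasure M).prod (faceMeasure M)))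
      atTop (𝓝 z)

end Amplitude

end Framing

end FlagComplex

/-! ### Ranks, and the tree-cotree decomposition of a surface map -/

/-! The regularised amplitude integrates `ψ` against a nonnegative density on the pairs `(h, g)`.
The limit is `ψ(1)` for two reasons: where the density does not vanish, `ψ h` is close to `ψ 1`, and
the total mass of the density tends to one.

The first reason is topological. Let a connection, with values in any group, be flat at the bulk
edges off `T`. The bubble around a bulk vertex is a sphere, on which flatness at all punctures but
one forces flatness at the last (the Bianchi identity). Working through the tree from its leaves
towards the boundary gives flatness at every edge (`hasSection_of_isMaximalTree`). Local sections
then exist around every cell, and they glue because a ball is simply connected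
(`IsBallDecomposition.exists_section`). The induced connection on the boundary graph is therefore
pure gauge, and gauge invariance identifies the value of `ψ` with that at the trivial connection.
Compactness replaces "holonomies equal to one" by "holonomies near one" (`exists_nhds_dist_lt`).

For the mass, the integral over each `h_l` is one by invariance of the Haar measure
(`integral_density`). Gauge fixing along a spanning tree of the dual graph turns the remaining
holonomies, up to conjugation, into words in the faces off that tree (`exists_gauge`). An Euler
characteristic count, which uses that the boundary is connected, shows that there are at most as
many words as unknowns (`card_edges_le`). By the topological part, the system "all words equal one"
has only the trivial solution in every group (`eq_one_of_lift_word`). Applied to the groups `ℤ/p`,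
this says that the matrix of exponent sums is invertible modulo every prime, so that the system is
square with determinant `±1`. This matrix also describes the derivative of the word map at the
identity of a power of `SU(2)`, which therefore almost preserves the Haar measure there. Applied to
`SU(2)`, the same statement says that, by compactness, nothing far from the identity is mapped near
it. Hence the mass tends to one (`exists_nhds_abs_integral_prod_word_sub_one_le`).

Spheres and disks enter through their Euler characteristic only. A tree of edges and a tree of faces
that avoids it are disjoint; if they exhaust the inner edges, a connection can be integrated along
the second and corrected at the leaves of the first (`SurfaceMap.exists_section`). -/

/-- If every node can be joined to a set `B` of roots, then the nodes carry a rank such that each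
node outside `B` is related to a node of smaller rank. -/
theorem exists_rank {V : Type*} (r : V → V → Prop) (B : Set V)
    (h : ∀ w, ∃ b ∈ B, Relation.ReflTransGen r w b) :
    ∃ ρ : V → ℕ, ∀ w, w ∉ B → ∃ w', r w w' ∧ ρ w' < ρ w := by
  classical
  -- `S n` holds the nodes with a chain of exactly `n` relations into `B`; the rank is the least
  -- such `n`.
  let S : ℕ → Set V := fun n => Nat.rec (motive := fun _ => Set V) B (fun _ s => {w | ∃ w' ∈ s, r w w'}) n
  have hS : ∀ w, ∃ n, w ∈ S n := by
    intro w
    obtain ⟨b, hb, hr⟩ := h w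
    induction hr using Relation.ReflTransGen.head_induction_on with
    | refl => exact ⟨0, hb⟩
    | head hac _ ih =>
      obtain ⟨n, hn⟩ := ih
      exact ⟨n + 1, _, hn, hac⟩
  have hdec : ∀ w, DecidablePred fun n => w ∈ S n := fun _ => Classical.decPred _
  refine ⟨fun w => Nat.find (hS w), fun w hw => ?_⟩
  have h1 := Nat.find_spec (hS w)
  match hn : Nat.find (hS w), h1 with
  | 0, h1 => exact absurd h1 hw
  | n + 1, h1 =>
    obtain ⟨w', hw', hr⟩ := h1
    refine ⟨w', hr, ?_⟩
    have := Nat.find_min' (hS w') hw'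
    simp only [hn]
    omega

/-- Recursion along a rank. -/
theorem exists_eq_mul_of_rank {V G : Type*} [Group G] (ρ : V → ℕ) (B : Set V) (par : V → V)
    (hlt : ∀ w, w ∉ B → ρ (par w) < ρ w) (u : V → G) :
    ∃ κ : V → G, (∀ w ∈ B, κ w = 1) ∧ ∀ w, w ∉ B → κ w = u w * κ (par w) := by
  classical
  let κ : V → G := (measure ρ).wf.fix fun w rec =>
    if h : w ∈ B then 1 else u w * rec (par w) (hlt w h)
  have hκ : ∀ w, κ w = if w ∈ B then 1 else u w * κ (par w) := by
    intro w
    simp only [κ]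
    rw [WellFounded.fix_eq]
    simp
  exact ⟨κ, fun w hw => by rw [hκ, if_pos hw], fun w hw => by rw [hκ, if_neg hw]⟩

/-- A cellular decomposition of a connected oriented surface by flags: `a` moves along an edge,
`b` turns inside a face at a vertex, `c` crosses an edge.  The flags fixed by `c` lie on the
boundary.  The maps `v`, `e`, `f` give the vertex, the edge and the face of a flag. -/
structure SurfaceMap (D V E F : Type*) where
  a : D → D
  b : D → D
  c : D → D
  v : D → V
  e : D → E
  f : D → F
  sign : D → ℤˣ
  a_invol : ∀ d, a (a d) = d
  b_invol : ∀ d, b (b d) = d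
  c_invol : ∀ d, c (c d) = d
  comm : ∀ d, a (c d) = c (a d)
  sign_b : ∀ d, sign (b d) = -sign d
  sign_c : ∀ d, c d ≠ d → sign (c d) = -sign d
  v_b : ∀ d, v (b d) = v d
  v_c : ∀ d, v (c d) = v d
  v_surj : Function.Surjective v
  e_c : ∀ d, e (c d) = e d
  e_eq : ∀ d d', e d = e d' → d' = d ∨ d' = a d ∨ d' = c d ∨ d' = a (c d)
  f_a : ∀ d, f (a d) = f d
  f_b : ∀ d, f (b d) = f d
  f_surj : Function.Surjective f
  connected : ∀ X : D → Prop, (∀ d, X d → X (a d)) → (∀ d, X d → X (b d)) →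
    (∀ d, X d → X (c d)) → ∀ d d', X d → X d'

namespace SurfaceMap

variable {D V E F : Type*} (S : SurfaceMap D V E F)

/-- A tree of edges which joins each vertex outside `B` to `B`: the flag `p w` starts the edge from
`w` to its parent, which has smaller rank. -/
structure IsTree (B : Set V) (p : V → D) (ρ : V → ℕ) : Prop where
  v_p : ∀ w, w ∉ B → S.v (p w) = w
  c_p : ∀ w, w ∉ B → S.c (p w) ≠ p w
  rank_lt : ∀ w, w ∉ B → ρ (S.v (S.a (p w))) < ρ w

/-- A tree of faces joining each face to the root `f₀` without crossing the tree `p`. -/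
structure IsCotree (B : Set V) (p : V → D) (f₀ : F) (q : F → D) (ρ : F → ℕ) : Prop where
  f_q : ∀ x, x ≠ f₀ → S.f (q x) = x
  e_q : ∀ x, x ≠ f₀ → ∀ w, w ∉ B → S.e (p w) ≠ S.e (q x)
  rank_lt : ∀ x, x ≠ f₀ → ρ (S.f (S.c (q x))) < ρ x

/-- Connectedness carries a chain into `B` from flag to flag. Boundary edges are never needed: by
`hB` their ends already lie in `B`, so the chain can stop there. -/
theorem exists_isTree (B : Set V) (hB : ∀ d, S.c d = d → S.v d ∈ B) (hne : ∃ d, S.v d ∈ B) :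
    ∃ p ρ, S.IsTree B p ρ := by
  classical
  obtain ⟨d₀, hd₀⟩ := hne
  let r : V → V → Prop := fun w w' => ∃ d, S.c d ≠ d ∧ S.v d = w ∧ S.v (S.a d) = w'
  have h : ∀ w, ∃ b ∈ B, Relation.ReflTransGen r w b := by
    intro w
    obtain ⟨d, rfl⟩ := S.v_surj w
    refine S.connected (fun d => ∃ b ∈ B, Relation.ReflTransGen r (S.v d) b) ?_ ?_ ?_ d₀ d
      ⟨_, hd₀, .refl⟩
    · rintro d ⟨b, hb, hr⟩
      by_cases hc : S.c (S.a d) = S.a d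
      · exact ⟨_, hB _ hc, .refl⟩
      · exact ⟨b, hb, hr.head ⟨S.a d, hc, rfl, by rw [S.a_invol]⟩⟩
    · intro d h
      rwa [S.v_b]
    · intro d h
      rwa [S.v_c]
  obtain ⟨ρ, hρ⟩ := exists_rank r B h
  have h2 : ∀ w, ∃ d, w ∉ B → S.v d = w ∧ S.c d ≠ d ∧ ρ (S.v (S.a d)) < ρ w := by
    intro w
    by_cases hw : w ∈ B
    · exact ⟨d₀, fun h => absurd hw h⟩
    · obtain ⟨w', ⟨d, h1, h2, h3⟩, hlt⟩ := hρ w hw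
      exact ⟨d, fun _ => ⟨h2, h1, h3 ▸ hlt⟩⟩
  choose p hp using h2
  exact ⟨p, ρ, fun w hw => (hp w hw).1, fun w hw => (hp w hw).2.1, fun w hw => (hp w hw).2.2⟩

variable {S} {B : Set V} {p : V → D} {ρ : V → ℕ}

/-- Two vertices sharing a parent edge from opposite ends would each have smaller rank than the
other; from the same end they coincide. -/
theorem IsTree.e_injOn (h : S.IsTree B p ρ) : Set.InjOn (fun w => S.e (p w)) Bᶜ := by
  intro w hw w' hw' he
  have h1 := h.rank_lt w hw
  have h2 := h.rank_lt w' hw'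
  rcases S.e_eq _ _ he with h3 | h3 | h3 | h3
  · rw [← h.v_p w hw, ← h.v_p w' hw', h3]
  · rw [h3, S.a_invol, h.v_p w hw] at h2
    rw [← h3, h.v_p w' hw'] at h1
    omega
  · rw [← h.v_p w hw, ← h.v_p w' hw', h3, S.v_c]
  · rw [h3, S.a_invol, S.v_c, h.v_p w hw] at h2
    have h4 : S.a (p w) = S.c (p w') := by rw [h3, S.comm, S.c_invol]
    rw [h4, S.v_c, h.v_p w' hw'] at h1
    omega

/-- A property of edges holds everywhere when it holds off a tree and when, at each vertex outside
the root set, it holds for an edge end as soon as it holds for all the others. -/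
theorem IsTree.peel [Finite V] (h : S.IsTree B p ρ) (Good : D → Prop)
    (ha : ∀ d, Good d → Good (S.a d)) (hc : ∀ d, Good d → Good (S.c d))
    (hT : ∀ d, (∀ w, w ∉ B → S.e (p w) ≠ S.e d) → Good d)
    (hloc : ∀ d₁, S.v d₁ ∉ B →
      (∀ d, S.v d = S.v d₁ → d ≠ d₁ → d ≠ S.c d₁ → Good d) → Good d₁) (d : D) : Good d := by
  have key : ∀ d w, w ∉ B → S.e (p w) = S.e d → Good (p w) → Good d := by
    intro d w _ he hg
    rcases S.e_eq _ _ he with h3 | h3 | h3 | h3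
    · rwa [h3]
    · rw [h3]; exact ha _ hg
    · rw [h3]; exact hc _ hg
    · rw [h3]; exact ha _ (hc _ hg)
  suffices hp : ∀ w, w ∉ B → Good (p w) by
    by_cases hd : ∀ w, w ∉ B → S.e (p w) ≠ S.e d
    · exact hT d hd
    · push Not at hd
      obtain ⟨w, hw, he⟩ := hd
      exact key d w hw he (hp w hw)
  by_contra hbad
  push Not at hbad
  -- Leaves first: take a bad tree edge whose lower vertex `w` has maximal rank. Another bad edge
  -- end at `w` would belong to the parent edge of a child of `w`, which has larger rank.
  obtain ⟨w, ⟨hw, hwb⟩, hmax⟩ := Set.exists_max_image {w | w ∉ B ∧ ¬ Good (p w)} ρ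
    (Set.toFinite _) hbad
  refine hwb (hloc (p w) (by rwa [h.v_p w hw]) fun d hvd hd1 hd2 => ?_)
  by_contra hd
  have hex : ∃ w', w' ∉ B ∧ S.e (p w') = S.e d := by
    by_contra hcon
    push Not at hcon
    exact hd (hT d hcon)
  obtain ⟨w', hw', he⟩ := hex
  have hle := hmax w' ⟨hw', fun hg => hd (key d w' hw' he hg)⟩
  have hlt := h.rank_lt w' hw'
  rw [h.v_p w hw] at hvd
  rcases S.e_eq _ _ he with h3 | h3 | h3 | h3
  · rw [h3, h.v_p w' hw'] at hvd
    exact hd1 (hvd ▸ h3)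
  · rw [h3] at hvd
    rw [hvd] at hlt
    omega
  · rw [h3, S.v_c, h.v_p w' hw'] at hvd
    exact hd2 (hvd ▸ h3)
  · rw [h3, S.comm, S.v_c] at hvd
    rw [hvd] at hlt
    omega

variable (S) in
/-- The flags at an inner vertex remain connected when one edge end is removed. -/
theorem cross_eq_of_forall_ne [Finite D] {Y : Type*} (k : D → Y) (d₁ : D)
    (hin : ∀ d, S.v d = S.v d₁ → S.c d ≠ d)
    (hb : ∀ d, S.v d = S.v d₁ → k (S.b d) = k d)
    (hc : ∀ d, S.v d = S.v d₁ → d ≠ d₁ → d ≠ S.c d₁ → k (S.c d) = k d) :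
    k (S.c d₁) = k d₁ := by
  -- Iterating `t` walks once around the vertex and back to `d₁`, crossing the edge of `d₁` only in
  -- the first step. The walk preserves signs, so it never meets `S.c d₁`, whose sign is opposite.
  let t : D → D := fun d => S.b (S.c d)
  have hinj : Function.Injective t := by
    intro x y hxy
    have h2 := congrArg S.b hxy
    simp only [t, S.b_invol] at h2
    simpa only [S.c_invol] using congrArg S.c h2
  have hpos : 0 < Function.minimalPeriod t d₁ :=
    Function.minimalPeriod_pos_of_mem_periodicPts (hinj.mem_periodicPts d₁)
  have hstep : ∀ d, S.v d = S.v d₁ → S.sign (t d) = S.sign d ∧ S.v (t d) = S.v d₁ := by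
    intro d hd
    refine ⟨?_, ?_⟩
    · simp only [t]
      rw [S.sign_b, S.sign_c d (hin d hd), neg_neg]
    · simp only [t]
      rw [S.v_b, S.v_c, hd]
  have hj : ∀ j, S.sign (t^[j] d₁) = S.sign d₁ ∧ S.v (t^[j] d₁) = S.v d₁ := by
    intro j
    induction j with
    | zero => exact ⟨rfl, rfl⟩
    | succ j ih =>
      rw [Function.iterate_succ_apply']
      exact ⟨(hstep _ ih.2).1.trans ih.1, (hstep _ ih.2).2⟩
  have hk : ∀ j, j + 1 ≤ Function.minimalPeriod t d₁ → k (t^[j + 1] d₁) = k (S.c d₁) := by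
    intro j
    induction j with
    | zero =>
      intro _
      exact hb _ (S.v_c d₁)
    | succ j ih =>
      intro hjn
      rw [Function.iterate_succ_apply', ← ih (by omega)]
      have hv := (hj (j + 1)).2
      simp only [t] at hv ⊢
      rw [hb _ (by rw [S.v_c, hv]), hc _ hv]
      · exact Function.not_isPeriodicPt_of_pos_of_lt_minimalPeriod (n := j + 1) (by omega) hjn
      · intro heq
        have h1 := (hj (j + 1)).1
        simp only [t] at h1
        rw [heq, S.sign_c d₁ (hin d₁ rfl)] at h1
        exact units_ne_neg_self (S.sign d₁) h1.symm
  obtain ⟨n, hn⟩ := Nat.exists_eq_succ_of_ne_zero hpos.ne'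
  have := hk n (by omega)
  rw [← Nat.succ_eq_add_one, ← hn, Function.iterate_minimalPeriod] at this
  exact this.symm

/-- Crossing no edge of the tree, one can reach each face. -/
theorem IsTree.exists_isCotree [Finite D] [Finite V] (h : S.IsTree B p ρ)
    (hB : ∀ d, S.c d = d → S.v d ∈ B) (d₀ : D) :
    ∃ q ρ', S.IsCotree B p (S.f d₀) q ρ' := by
  classical
  let r : F → F → Prop := fun x x' =>
    ∃ d, (∀ w, w ∉ B → S.e (p w) ≠ S.e d) ∧ S.f d = x ∧ S.f (S.c d) = x'
  let X : D → Prop := fun d => Relation.ReflTransGen r (S.f d) (S.f d₀)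
  have hcc : ∀ d, X (S.c d) ↔ X d := by
    -- Crossing a tree edge can be replaced by going around its lower vertex across all the other
    -- edges there; `peel` orders these replacements from the leaves on.
    refine h.peel (fun d => X (S.c d) ↔ X d) ?_ ?_ ?_ ?_
    · intro d hd
      simp only [X, ← S.comm, S.f_a] at hd ⊢
      exact hd
    · intro d hd
      simp only [S.c_invol]
      exact hd.symm
    · intro d hd
      constructor
      · exact fun h => h.head ⟨d, hd, rfl, rfl⟩
      · exact fun h => h.head ⟨S.c d, by simpa only [S.e_c] using hd, rfl, by rw [S.c_invol]⟩
    · intro d₁ hd₁ hg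
      have := S.cross_eq_of_forall_ne X d₁ (fun d hd hcd => hd₁ (hd ▸ hB d hcd))
        (fun d _ => by simp only [X, S.f_b]) (fun d h1 h2 h3 => propext (hg d h1 h2 h3))
      exact iff_of_eq this
  have hX : ∀ d, X d := fun d => S.connected X (fun d hd => by simpa only [X, S.f_a] using hd)
    (fun d hd => by simpa only [X, S.f_b] using hd) (fun d hd => (hcc d).2 hd) d₀ d .refl
  obtain ⟨ρ', hρ'⟩ := exists_rank r {S.f d₀} fun w => by
    obtain ⟨d, rfl⟩ := S.f_surj w
    exact ⟨_, rfl, hX d⟩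
  have h2 : ∀ x, ∃ d, x ≠ S.f d₀ → S.f d = x ∧ (∀ w, w ∉ B → S.e (p w) ≠ S.e d) ∧
      ρ' (S.f (S.c d)) < ρ' x := by
    intro x
    by_cases hx : x = S.f d₀
    · exact ⟨d₀, fun h => absurd hx h⟩
    · obtain ⟨x', ⟨d, h1, h2, h3⟩, hlt⟩ := hρ' x hx
      exact ⟨d, fun _ => ⟨h2, h1, h3 ▸ hlt⟩⟩
  choose q hq using h2
  exact ⟨q, ρ', fun x hx => (hq x hx).1, fun x hx => (hq x hx).2.1, fun x hx => (hq x hx).2.2⟩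

variable {f₀ : F} {q : F → D} {ρ' : F → ℕ}

/-- Dual to `IsTree.e_injOn`: two faces leaving through one edge from its two sides would be each
other's parents. -/
theorem IsCotree.e_injOn (h : S.IsCotree B p f₀ q ρ') :
    Set.InjOn (fun x => S.e (q x)) {f₀}ᶜ := by
  intro x hx x' hx' he
  have h1 := h.rank_lt x hx
  have h2 := h.rank_lt x' hx'
  have aux : q x' = S.c (q x) ∨ q x' = S.a (S.c (q x)) → x = x' := by
    intro h3
    have h4 : S.f (q x') = S.f (S.c (q x)) := by
      rcases h3 with h3 | h3 <;> rw [h3]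
      rw [S.f_a]
    have h5 : S.f (S.c (q x')) = S.f (q x) := by
      rcases h3 with h3 | h3 <;> rw [h3]
      · rw [S.c_invol]
      · rw [← S.comm, S.c_invol, S.f_a]
    rw [h.f_q x' hx'] at h4
    rw [h.f_q x hx] at h5
    rw [h5] at h2
    rw [← h4] at h1
    omega
  rcases S.e_eq _ _ he with h3 | h3 | h3 | h3
  · rw [← h.f_q x hx, ← h.f_q x' hx', h3]
  · rw [← h.f_q x hx, ← h.f_q x' hx', h3, S.f_a]
  · exact aux (.inl h3)
  · exact aux (.inr h3)

theorem IsCotree.c_q (h : S.IsCotree B p f₀ q ρ') (x : F) (hx : x ≠ f₀) : S.c (q x) ≠ q x := by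
  intro hc
  have := h.rank_lt x hx
  rw [hc, h.f_q x hx] at this
  exact lt_irrefl _ this

variable (S) in
/-- The inner edges. -/
def innerEdges : Set E := {x | ∃ d, S.c d ≠ d ∧ S.e d = x}

/-- The edges of a tree and of a cotree. -/
theorem ncard_tree_union_cotree [Finite V] [Finite F] [Finite E] (h : S.IsTree B p ρ)
    (h' : S.IsCotree B p f₀ q ρ') :
    ((fun w => S.e (p w)) '' Bᶜ ∪ (fun x => S.e (q x)) '' {f₀}ᶜ).ncard =
      Bᶜ.ncard + (({f₀}ᶜ : Set F)).ncard := by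
  rw [Set.ncard_union_eq, h.e_injOn.ncard_image, h'.e_injOn.ncard_image]
  rw [Set.disjoint_left]
  rintro _ ⟨w, hw, rfl⟩ ⟨x, hx, he⟩
  exact h'.e_q x hx w hw he.symm

theorem tree_union_cotree_subset (h : S.IsTree B p ρ) (h' : S.IsCotree B p f₀ q ρ') :
    (fun w => S.e (p w)) '' Bᶜ ∪ (fun x => S.e (q x)) '' {f₀}ᶜ ⊆ S.innerEdges := by
  rintro _ (⟨w, hw, rfl⟩ | ⟨x, hx, rfl⟩)
  · exact ⟨_, h.c_p w hw, rfl⟩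
  · exact ⟨_, h'.c_q x hx, rfl⟩

variable (S) in
/-- The Euler characteristic of a connected surface is at most that of a sphere. -/
theorem card_add_card_le [Finite D] [Finite V] [Finite F] [Finite E] (B : Set V)
    (hB : ∀ d, S.c d = d → S.v d ∈ B) (hne : ∃ d, S.v d ∈ B) :
    Bᶜ.ncard + Nat.card F ≤ S.innerEdges.ncard + 1 := by
  obtain ⟨p, ρ, h⟩ := S.exists_isTree B hB hne
  obtain ⟨d₀, -⟩ := hne
  obtain ⟨q, ρ', h'⟩ := h.exists_isCotree hB d₀
  -- Tree and cotree are disjoint sets of inner edges; they have one edge for each vertex outside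
  -- `B` and one for each face other than the root.
  have h1 := Set.ncard_le_ncard (tree_union_cotree_subset h h')
  rw [ncard_tree_union_cotree h h'] at h1
  have h2 := Set.ncard_add_ncard_compl ({S.f d₀} : Set F)
  rw [Set.ncard_singleton] at h2
  omega

variable (S) in
/-- On a sphere, a connection `x` which is flat at all the vertices outside `B` is trivial. -/
theorem exists_section [Finite D] [Finite V] [Finite F] [Finite E] {G : Type*} [Group G]
    (B : Set V) (hB : ∀ d, S.c d = d → S.v d ∈ B) (hne : ∃ d, S.v d ∈ B)
    (hcard : S.innerEdges.ncard + 1 ≤ Bᶜ.ncard + Nat.card F)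
    (x : D → G) (hxa : ∀ d, x (S.a d) = x d) (hxc : ∀ d, S.c d ≠ d → x (S.c d) * x d = 1)
    (hflat : ∀ d₁, S.v d₁ ∉ B → ∃ k : D → G, ∀ d, S.v d = S.v d₁ →
      k (S.b d) = k d ∧ k (S.c d) = x d * k d) :
    ∃ k : D → G, (∀ d, k (S.a d) = k d) ∧ (∀ d, k (S.b d) = k d) ∧
      ∀ d, S.c d ≠ d → k (S.c d) = x d * k d := by
  classical
  obtain ⟨p, ρ, h⟩ := S.exists_isTree B hB hne
  obtain ⟨d₀, -⟩ := hne
  obtain ⟨q, ρ', h'⟩ := h.exists_isCotree hB d₀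
  -- The count `hcard` leaves no inner edge outside the tree and the cotree.
  have huniv : (fun w => S.e (p w)) '' Bᶜ ∪ (fun x => S.e (q x)) '' {S.f d₀}ᶜ = S.innerEdges := by
    refine Set.eq_of_subset_of_ncard_le (tree_union_cotree_subset h h') ?_
    rw [ncard_tree_union_cotree h h']
    have h2 := Set.ncard_add_ncard_compl ({S.f d₀} : Set F)
    rw [Set.ncard_singleton] at h2
    omega
  -- `κ` integrates `x` along the cotree from its root, so the required relation holds across cotree
  -- edges by construction.
  have hex : ∃ κ : F → G, ∀ y, y ≠ S.f d₀ → κ y = (x (q y))⁻¹ * κ (S.f (S.c (q y))) := by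
    obtain ⟨κ, -, hκ⟩ := exists_eq_mul_of_rank ρ' {S.f d₀} (fun y => S.f (S.c (q y)))
      h'.rank_lt fun y => (x (q y))⁻¹
    exact ⟨κ, hκ⟩
  obtain ⟨κ, hκ⟩ := hex
  let k : D → G := fun d => κ (S.f d)
  have hka : ∀ d, k (S.a d) = k d := fun d => by simp only [k, S.f_a]
  have hkb : ∀ d, k (S.b d) = k d := fun d => by simp only [k, S.f_b]
  refine ⟨k, hka, hkb, ?_⟩
  have hGa : ∀ d, (S.c d ≠ d → k (S.c d) = x d * k d) →
      (S.c (S.a d) ≠ S.a d → k (S.c (S.a d)) = x (S.a d) * k (S.a d)) := by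
    intro d hd hc
    rw [← S.comm, hka, hka, hxa]
    refine hd fun hcd => hc ?_
    rw [← S.comm, hcd]
  have hGc : ∀ d, (S.c d ≠ d → k (S.c d) = x d * k d) →
      (S.c (S.c d) ≠ S.c d → k (S.c (S.c d)) = x (S.c d) * k (S.c d)) := by
    intro d hd hc
    rw [S.c_invol] at hc ⊢
    rw [hd hc.symm, ← mul_assoc, hxc d hc.symm, one_mul]
  refine h.peel _ hGa hGc ?_ ?_
  · intro d hd hcd
    have hmem : S.e d ∈ S.innerEdges := ⟨d, hcd, rfl⟩
    rw [← huniv] at hmem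
    rcases hmem with ⟨w, hw, he⟩ | ⟨y, hy, he⟩
    · exact absurd he (hd w hw)
    · have hq : S.c (q y) ≠ q y → k (S.c (q y)) = x (q y) * k (q y) := by
        intro _
        simp only [k]
        rw [h'.f_q y hy, hκ y hy, mul_inv_cancel_left]
      rcases S.e_eq _ _ he with h3 | h3 | h3 | h3
      · rw [h3] at hcd ⊢; exact hq hcd
      · rw [h3] at hcd ⊢; exact hGa _ hq hcd
      · rw [h3] at hcd ⊢; exact hGc _ hq hcd
      · rw [h3] at hcd ⊢; exact hGa _ (hGc _ hq) hcd
  · intro d₁ hd₁ hg _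
    -- At a tree edge, flatness supplies a local solution `k₀`. The quotient `k₀⁻¹ * k` does not
    -- change across the other edges at the vertex, hence not across this one.
    obtain ⟨k₀, hk₀⟩ := hflat d₁ hd₁
    have hin : ∀ d, S.v d = S.v d₁ → S.c d ≠ d := fun d hd hcd => hd₁ (hd ▸ hB d hcd)
    have := S.cross_eq_of_forall_ne (fun d => (k₀ d)⁻¹ * k d) d₁ hin
      (fun d hd => by simp only [(hk₀ d hd).1, hkb])
      (fun d hd h1 h2 => by
        simp only [(hk₀ d hd).2, hg d hd h1 h2 (hin d hd)]
        group)
    simp only [(hk₀ d₁ rfl).2] at this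
    rw [mul_inv_rev, mul_assoc] at this
    have h3 := mul_left_cancel this
    rw [← h3, mul_inv_cancel_left]

end SurfaceMap

/-! ### Orbits of flags -/

namespace FlagComplex

variable {D : Type*} (M : FlagComplex D)

theorem orbit_α {S : Set (Fin 4)} {j : Fin 4} (hj : j ∈ S) (d : D) :
    M.orbit S (M.α j d) = M.orbit S d :=
  (Quot.sound ⟨j, hj, rfl⟩).symm

theorem cell_α {i j : Fin 4} (hj : j ≠ i) (d : D) : M.cell i (M.α j d) = M.cell i d :=
  M.orbit_α (S := {i}ᶜ) hj d

-- The `α j` are involutions, so a property preserved by the moves is invariant under them and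
-- descends to the quotient.
variable {M} in
theorem orbit_ind {S : Set (Fin 4)} (X : D → Prop) (hX : ∀ j ∈ S, ∀ d, X d → X (M.α j d))
    {d d' : D} (h : M.orbit S d = M.orbit S d') (hd : X d) : X d' := by
  let f : M.Orbit S → Prop := Quot.lift X (by
    rintro a b ⟨j, hj, rfl⟩
    refine propext ⟨hX j hj a, fun h => ?_⟩
    have := hX j hj _ h
    rwa [M.invol] at this)
  have : f (M.orbit S d') := h ▸ (show f (M.orbit S d) from hd)
  exact this

variable {M} in
theorem orbit_eq_of_subset {S S' : Set (Fin 4)} (hS : S ⊆ S') {d d' : D}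
    (h : M.orbit S d = M.orbit S d') : M.orbit S' d = M.orbit S' d' :=
  orbit_ind (fun y => M.orbit S' d = M.orbit S' y)
    (fun _ hj y hy => hy.trans (M.orbit_α (hS hj) y).symm) h rfl

theorem orbit_surjective (S : Set (Fin 4)) : Function.Surjective (M.orbit S) := Quot.mk_surjective

/-- An orbit of two commuting involutions. -/
theorem orbit_pair_eq {i j : Fin 4} (hc : ∀ d, M.α i (M.α j d) = M.α j (M.α i d)) {d d' : D}
    (h : M.orbit {i, j} d = M.orbit {i, j} d') :
    d' = d ∨ d' = M.α i d ∨ d' = M.α j d ∨ d' = M.α i (M.α j d) := by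
  refine orbit_ind (fun y => y = d ∨ y = M.α i d ∨ y = M.α j d ∨ y = M.α i (M.α j d)) ?_ h (.inl rfl)
  rintro _ (rfl | rfl) y (rfl | rfl | rfl | rfl) <;> simp [M.invol, hc]

theorem orbit_α_of_comm {i : Fin 4} {S : Set (Fin 4)}
    (hc : ∀ j ∈ S, ∀ d, M.α i (M.α j d) = M.α j (M.α i d)) {d d' : D}
    (h : M.orbit S d = M.orbit S d') : M.orbit S (M.α i d) = M.orbit S (M.α i d') :=
  orbit_ind (fun y => M.orbit S (M.α i d) = M.orbit S (M.α i y))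
    (fun j hj y hy => by rw [hc j hj, M.orbit_α hj, hy]) h rfl

theorem comm0 : ∀ j ∈ ({2, 3} : Set (Fin 4)), ∀ d, M.α 0 (M.α j d) = M.α j (M.α 0 d) := by
  rintro j (rfl | rfl) d
  · exact M.comm02 d
  · exact M.comm03 d

theorem comm3 : ∀ j ∈ ({0, 1} : Set (Fin 4)), ∀ d, M.α 3 (M.α j d) = M.α j (M.α 3 d) := by
  rintro j (rfl | rfl) d
  · exact (M.comm03 d).symm
  · exact (M.comm13 d).symm

/-- An edge has two ends. -/
theorem orbit_eq_or_of_cell_one_eq {d d' : D} (h : M.cell 1 d = M.cell 1 d') :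
    M.orbit {2, 3} d' = M.orbit {2, 3} d ∨ M.orbit {2, 3} d' = M.orbit {2, 3} (M.α 0 d) := by
  refine orbit_ind (fun y => M.orbit {2, 3} y = M.orbit {2, 3} d ∨
    M.orbit {2, 3} y = M.orbit {2, 3} (M.α 0 d)) ?_ h (.inl rfl)
  intro j hj y hy
  have hj' : j = 0 ∨ j = 2 ∨ j = 3 := by
    have : j ≠ 1 := hj
    fin_cases j <;> simp_all
  rcases hj' with rfl | rfl | rfl
  · rcases hy with hy | hy
    · exact .inr (M.orbit_α_of_comm M.comm0 hy)
    · have := M.orbit_α_of_comm M.comm0 hy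
      rw [M.invol] at this
      exact .inl this
  · rwa [M.orbit_α (by simp)]
  · rwa [M.orbit_α (by simp)]

/-- A face has two sides. -/
theorem orbit_eq_or_of_cell_two_eq {d d' : D} (h : M.cell 2 d = M.cell 2 d') :
    M.orbit {0, 1} d' = M.orbit {0, 1} d ∨ M.orbit {0, 1} d' = M.orbit {0, 1} (M.α 3 d) := by
  refine orbit_ind (fun y => M.orbit {0, 1} y = M.orbit {0, 1} d ∨
    M.orbit {0, 1} y = M.orbit {0, 1} (M.α 3 d)) ?_ h (.inl rfl)
  intro j hj y hy
  have hj' : j = 0 ∨ j = 1 ∨ j = 3 := by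
    have : j ≠ 2 := hj
    fin_cases j <;> simp_all
  rcases hj' with rfl | rfl | rfl
  · rwa [M.orbit_α (by simp)]
  · rwa [M.orbit_α (by simp)]
  · rcases hy with hy | hy
    · exact .inr (M.orbit_α_of_comm M.comm3 hy)
    · have := M.orbit_α_of_comm M.comm3 hy
      rw [M.invol] at this
      exact .inl this

theorem cell_one_eq_of_orbit {d d' : D} (h : M.orbit {2, 3} d = M.orbit {2, 3} d') :
    M.cell 1 d = M.cell 1 d' :=
  orbit_eq_of_subset (by rintro j (rfl | rfl) <;> simp) h

theorem cell_zero_eq_of_orbit {d d' : D} (h : M.orbit {2, 3} d = M.orbit {2, 3} d') :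
    M.cell 0 d = M.cell 0 d' :=
  orbit_eq_of_subset (by rintro j (rfl | rfl) <;> simp) h

theorem cell_two_eq_of_orbit {d d' : D} (h : M.orbit {0, 1} d = M.orbit {0, 1} d') :
    M.cell 2 d = M.cell 2 d' :=
  orbit_eq_of_subset (by rintro j (rfl | rfl) <;> simp) h

theorem cell_three_eq_of_orbit {d d' : D} (h : M.orbit {0, 1} d = M.orbit {0, 1} d') :
    M.cell 3 d = M.cell 3 d' :=
  orbit_eq_of_subset (by rintro j (rfl | rfl) <;> simp) h

/-- The flags of a boundary face are on the boundary. -/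
theorem α_three_eq_of_isBdry {d : D} (h : M.IsBdry 2 (M.cell 2 d)) : M.α 3 d = d := by
  obtain ⟨d', h1, h2⟩ := h
  refine orbit_ind (fun y => M.α 3 y = y) ?_ h1 h2
  intro j hj y hy
  have hj' : j = 0 ∨ j = 1 ∨ j = 3 := by
    have : j ≠ 2 := hj
    fin_cases j <;> simp_all
  rcases hj' with rfl | rfl | rfl
  · rw [← M.comm03, hy]
  · rw [← M.comm13, hy]
  · rw [hy, hy]

theorem isBdry_two_iff {d : D} : M.IsBdry 2 (M.cell 2 d) ↔ M.α 3 d = d :=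
  ⟨M.α_three_eq_of_isBdry, fun h => ⟨d, rfl, h⟩⟩

/-- The flags of a boundary face are joined on one side. -/
theorem orbit_eq_of_cell_two_eq {d d' : D} (hd : M.α 3 d = d) (h : M.cell 2 d = M.cell 2 d') :
    M.orbit {0, 1} d' = M.orbit {0, 1} d := by
  rcases M.orbit_eq_or_of_cell_two_eq h with h | h
  · exact h
  · rwa [hd] at h

/-- An edge on the boundary has a boundary flag at each of its ends. -/
theorem exists_of_isBdry_one {d : D} (h : M.IsBdry 1 (M.cell 1 d)) :
    ∃ d', M.orbit {2, 3} d' = M.orbit {2, 3} d ∧ M.α 3 d' = d' := by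
  obtain ⟨d', h1, h2⟩ := h
  rcases M.orbit_eq_or_of_cell_one_eq h1 with h3 | h3
  · exact ⟨d', h3.symm, h2⟩
  · exact ⟨M.α 0 d', h3.symm, by rw [← M.comm03, h2]⟩

/-! ### Turning around an edge -/

theorem turn_injective : Function.Injective M.turn := by
  intro a b hab
  have h2 := congrArg (M.α 2) hab
  simp only [turn, M.invol] at h2
  simpa only [M.invol] using congrArg (M.α 3) h2

theorem orbit_turn (d : D) : M.orbit {2, 3} (M.turn d) = M.orbit {2, 3} d := by
  rw [turn, M.orbit_α (by simp), M.orbit_α (by simp)]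

theorem orbit_turn_iterate (d : D) (n : ℕ) :
    M.orbit {2, 3} (M.turn^[n] d) = M.orbit {2, 3} d := by
  induction n with
  | zero => rfl
  | succ n ih => rw [Function.iterate_succ_apply', orbit_turn, ih]

theorem sign_turn {d : D} (h : M.α 3 d ≠ d) : M.sign (M.turn d) = M.sign d := by
  rw [turn, M.sign_α 2 _ (by decide), M.sign_α3 d h, neg_neg]

theorem exists_turn_iterate_eq [Finite D] (d : D) : ∃ n, 0 < n ∧ M.turn^[n] d = d := by
  obtain ⟨n, hn, hp⟩ := M.turn_injective.mem_periodicPts d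
  exact ⟨n, hn, hp⟩

theorem exists_iterate_of_orbit_eq [Finite D] {d d' : D}
    (h : M.orbit {2, 3} d = M.orbit {2, 3} d') :
    ∃ k, d' = M.turn^[k] d ∨ d' = M.α 2 (M.turn^[k] d) := by
  obtain ⟨n, hn, hp⟩ := M.exists_turn_iterate_eq d
  refine orbit_ind (fun y => ∃ k, y = M.turn^[k] d ∨ y = M.α 2 (M.turn^[k] d)) ?_ h ⟨0, .inl rfl⟩
  rintro j (rfl | rfl) y ⟨k, rfl | rfl⟩
  · exact ⟨k, .inr rfl⟩
  · exact ⟨k, .inl (M.invol _ _)⟩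
  · refine ⟨k + 1, .inr ?_⟩
    rw [Function.iterate_succ_apply', turn, M.invol]
  · refine ⟨k + (n - 1), .inl ?_⟩
    have h1 : M.turn (M.turn^[k + (n - 1)] d) = M.turn^[k] d := by
      rw [← Function.iterate_succ_apply' M.turn, show (k + (n - 1)).succ = k + n by omega,
        Function.iterate_add_apply, hp]
    rw [← h1, turn, M.invol, M.invol]

theorem not_fixed_of_lt_steps {d : D} {j : ℕ} (h0 : 0 < j) (hj : j < M.steps d) :
    M.α 3 (M.turn^[j] d) ≠ M.turn^[j] d :=
  fun h => Nat.notMem_of_lt_sInf hj ⟨h0, h⟩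

theorem sign_turn_iterate {d : D} (hd : M.α 3 d = d) (j : ℕ) (hj : j < M.steps d) :
    M.sign (M.turn^[j + 1] d) = -M.sign d := by
  induction j with
  | zero => rw [Function.iterate_one, turn, hd, M.sign_α 2 _ (by decide)]
  | succ j ih =>
    rw [Function.iterate_succ_apply', M.sign_turn (M.not_fixed_of_lt_steps (by omega) hj),
      ih (by omega)]

/-- The other boundary flag at the edge end of a boundary flag. -/
noncomputable def bdryTurn (d : D) : D := M.turn^[M.steps d] d

theorem α_bdryTurn [Finite D] {d : D} (hd : M.α 3 d = d) : M.α 3 (M.bdryTurn d) = M.bdryTurn d :=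
  (M.steps_spec d hd).2

theorem orbit_bdryTurn (d : D) : M.orbit {2, 3} (M.bdryTurn d) = M.orbit {2, 3} d :=
  M.orbit_turn_iterate _ _

theorem sign_bdryTurn [Finite D] {d : D} (hd : M.α 3 d = d) :
    M.sign (M.bdryTurn d) = -M.sign d := by
  have h := (M.steps_spec d hd).1
  have := M.sign_turn_iterate hd (M.steps d - 1) (by omega)
  rwa [Nat.sub_add_cancel h] at this

/-! ### Connections -/

/-- A discrete connection with values in the group `G`: transports through the faces. -/
structure Connection (G : Type*) [Group G] where
  x : D → G
  x_α0 : ∀ d, x (M.α 0 d) = x d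
  x_α1 : ∀ d, x (M.α 1 d) = x d
  x_α3 : ∀ d, M.α 3 d ≠ d → x (M.α 3 d) * x d = 1

variable {M} {G : Type*} [Group G]

namespace Connection

variable (c : M.Connection G)

/-- The connection is trivial on the `S`-orbit of the flag `d₀`. -/
def HasSection (S : Set (Fin 4)) (d₀ : D) : Prop :=
  ∃ k : D → G, ∀ d, M.orbit S d = M.orbit S d₀ →
    (∀ j ∈ S, j ≠ 3 → k (M.α j d) = k d) ∧ (3 ∈ S → M.α 3 d ≠ d → k (M.α 3 d) = c.x d * k d)

/-- The transport through `m` successive faces around an edge. -/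
def path (c : M.Connection G) (d : D) : ℕ → G
  | 0 => 1
  | m + 1 => c.x (M.turn^[m] d) * path c d m

theorem path_succ' (d : D) (m : ℕ) : c.path d (m + 1) = c.path (M.turn d) m * c.x d := by
  induction m with
  | zero => simp [path]
  | succ m ih => rw [path, ih, path, mul_assoc, Function.iterate_succ_apply]

variable {c}

theorem HasSection.congr {S : Set (Fin 4)} {d d' : D} (h : c.HasSection S d)
    (hd : M.orbit S d = M.orbit S d') : c.HasSection S d' := by
  obtain ⟨k, hk⟩ := h
  exact ⟨k, fun y hy => hk y (hy.trans hd.symm)⟩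

theorem HasSection.α_zero {d : D} (h : c.HasSection {2, 3} d) :
    c.HasSection {2, 3} (M.α 0 d) := by
  obtain ⟨k, hk⟩ := h
  refine ⟨fun y => k (M.α 0 y), fun y hy => ?_⟩
  have h1 := M.orbit_α_of_comm M.comm0 hy
  rw [M.invol] at h1
  obtain ⟨h2, h3⟩ := hk _ h1
  refine ⟨?_, fun h3' hy3 => ?_⟩
  · intro j hj hj3
    beta_reduce
    rw [M.comm0 j hj]
    exact h2 j hj hj3
  · beta_reduce
    rw [M.comm03, h3 h3', c.x_α0]
    rw [← M.comm03]
    intro h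
    exact hy3 (by simpa only [M.invol] using congrArg (M.α 0) h)

theorem HasSection.of_cell_one_eq {d d' : D} (h : c.HasSection {2, 3} d)
    (hd : M.cell 1 d = M.cell 1 d') : c.HasSection {2, 3} d' := by
  rcases M.orbit_eq_or_of_cell_one_eq hd with h1 | h1
  · exact h.congr h1.symm
  · exact h.α_zero.congr h1.symm

/-- Since the two ends of the edge are distinct, the section at one end can be copied to the other
along `α 0`; this is consistent because transports are invariant under `α 0`. -/
theorem HasSection.cell_one (hM : M.IsCellular) {d₀ : D} (h : c.HasSection {2, 3} d₀) :
    c.HasSection {1}ᶜ d₀ := by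
  classical
  obtain ⟨k, hk⟩ := h
  have hα0 : ∀ y, M.orbit {2, 3} y = M.orbit {2, 3} d₀ →
      M.orbit {2, 3} (M.α 0 y) ≠ M.orbit {2, 3} d₀ := fun y hy h => hM.ends_ne y (h.trans hy.symm)
  refine ⟨fun y => if M.orbit {2, 3} y = M.orbit {2, 3} d₀ then k y else k (M.α 0 y),
    fun d hd => ?_⟩
  beta_reduce
  by_cases h : M.orbit {2, 3} d = M.orbit {2, 3} d₀
  · obtain ⟨h1, h2⟩ := hk d h
    refine ⟨fun j hj hj3 => ?_, fun _ h3 => ?_⟩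
    · have hj' : j = 0 ∨ j = 2 := by
        have : j ≠ 1 := hj
        fin_cases j <;> simp_all
      rcases hj' with rfl | rfl
      · rw [if_neg (hα0 d h), if_pos h, M.invol]
      · rw [M.orbit_α (S := {2, 3}) (by simp), if_pos h, if_pos h, h1 2 (by simp) (by decide)]
    · rw [M.orbit_α (S := {2, 3}) (by simp), if_pos h, if_pos h, h2 (by simp) h3]
  · have h' : M.orbit {2, 3} (M.α 0 d) = M.orbit {2, 3} d₀ := by
      rcases M.orbit_eq_or_of_cell_one_eq hd with h1 | h1
      · exact absurd h1.symm h
      · exact h1.symm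
    obtain ⟨h1, h2⟩ := hk _ h'
    refine ⟨fun j hj hj3 => ?_, fun _ h3 => ?_⟩
    · have hj' : j = 0 ∨ j = 2 := by
        have : j ≠ 1 := hj
        fin_cases j <;> simp_all
      rcases hj' with rfl | rfl
      · rw [if_pos h', if_neg h]
      · rw [M.orbit_α (S := {2, 3}) (by simp), if_neg h, if_neg h, M.comm02,
          h1 2 (by simp) (by decide)]
    · rw [M.orbit_α (S := {2, 3}) (by simp), if_neg h, if_neg h, M.comm03, h2 (by simp), c.x_α0]
      rw [← M.comm03]
      intro h
      exact h3 (by simpa only [M.invol] using congrArg (M.α 0) h)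

/-- No flatness is needed around a face: put `1` on one side and the transport across the face on
the other. A bulk face has two distinct sides, and a boundary face imposes no crossing condition. -/
theorem hasSection_cell_two (hM : M.IsCellular) (d₀ : D) : c.HasSection {2}ᶜ d₀ := by
  classical
  refine ⟨fun y => if M.orbit {0, 1} y = M.orbit {0, 1} d₀ then 1 else c.x (M.α 3 y),
    fun d hd => ?_⟩
  beta_reduce
  refine ⟨fun j hj hj3 => ?_, fun _ h3 => ?_⟩
  · have hj' : j = 0 ∨ j = 1 := by
      have : j ≠ 2 := hj
      fin_cases j <;> simp_all
    rcases hj' with rfl | rfl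
    · rw [M.orbit_α (S := {0, 1}) (by simp), ← M.comm03, c.x_α0]
    · rw [M.orbit_α (S := {0, 1}) (by simp), ← M.comm13, c.x_α1]
  · by_cases h : M.orbit {0, 1} d = M.orbit {0, 1} d₀
    · rw [if_pos h, if_neg (fun h' => hM.sides_ne d h3 (h'.trans h.symm)), M.invol, mul_one]
    · have h' : M.orbit {0, 1} (M.α 3 d) = M.orbit {0, 1} d₀ := by
        rcases M.orbit_eq_or_of_cell_two_eq hd with h1 | h1
        · exact absurd h1.symm h
        · exact h1.symm
      rw [if_neg h, if_pos h']
      exact (mul_eq_one_iff_eq_inv.2 (eq_inv_of_mul_eq_one_right (c.x_α3 d h3))).symm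

theorem hasSection_cell_three (d₀ : D) : c.HasSection {3}ᶜ d₀ :=
  ⟨fun _ => 1, fun _ _ => ⟨fun _ _ _ => rfl, fun h => absurd rfl h⟩⟩

/-- A section along the flags of one sign around an edge end extends to the others. -/
theorem hasSection_of_turn (d₀ : D) (s : ℤˣ) (K : D → G)
    (hK : ∀ d, M.orbit {2, 3} d = M.orbit {2, 3} d₀ → M.sign d = s → M.α 3 d ≠ d →
      K (M.turn d) = c.x d * K d) : c.HasSection {2, 3} d₀ := by
  classical
  have hs : ∀ u : ℤˣ, u ≠ s → -u = s := by
    intro u hu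
    rcases Int.units_eq_one_or u with rfl | rfl <;> rcases Int.units_eq_one_or s with rfl | rfl <;>
      simp_all
  have hs' : -s ≠ s := fun h => units_ne_neg_self s h.symm
  refine ⟨fun d => if M.sign d = s then K d else K (M.α 2 d), fun d hd => ?_⟩
  beta_reduce
  refine ⟨?_, fun _ h3 => ?_⟩
  · rintro j (rfl | rfl) hj
    · rw [M.sign_α 2 _ (by decide), M.invol]
      by_cases h : M.sign d = s
      · rw [if_pos h, h, if_neg hs']
      · rw [if_neg h, if_pos (hs _ h)]
    · exact absurd rfl hj
  · rw [M.sign_α3 d h3]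
    by_cases h : M.sign d = s
    · rw [if_pos h, h, if_neg hs']
      exact hK d hd h h3
    · rw [if_neg h, if_pos (hs _ h)]
      have h1 := hK (M.α 3 d) (by rw [M.orbit_α (by simp), hd]) (by rw [M.sign_α3 d h3, hs _ h])
        (by rw [M.invol]; exact h3.symm)
      rw [turn, M.invol] at h1
      rw [h1, ← mul_assoc, mul_eq_one_iff_eq_inv.2 (eq_inv_of_mul_eq_one_right (c.x_α3 d h3)),
        one_mul]

variable (c) in
/-- The inverse transport to the first flag with property `P`. -/
theorem path_hitting (P : D → Prop) (d : D) (hd : ∃ k, P (M.turn^[k] d)) (hP : ¬ P d) :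
    (c.path (M.turn d) (sInf {k | P (M.turn^[k] (M.turn d))}))⁻¹ =
      c.x d * (c.path d (sInf {k | P (M.turn^[k] d)}))⁻¹ := by
  have h1 := Nat.sInf_mem (s := {k | P (M.turn^[k] d)}) hd
  obtain ⟨n, hn⟩ : ∃ n, sInf {k | P (M.turn^[k] d)} = n + 1 := by
    refine Nat.exists_eq_succ_of_ne_zero fun h => ?_
    rw [h] at h1
    exact hP h1
  have h2 : sInf {k | P (M.turn^[k] (M.turn d))} = n := by
    rw [hn] at h1
    refine le_antisymm (Nat.sInf_le h1) ?_
    have h3 : sInf {k | P (M.turn^[k] (M.turn d))} + 1 ∈ {k | P (M.turn^[k] d)} :=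
      Nat.sInf_mem (s := {k | P (M.turn^[k] (M.turn d))}) ⟨n, h1⟩
    have := Nat.sInf_le h3
    omega
  rw [hn, h2, path_succ', mul_inv_rev, mul_inv_cancel_left]

variable [Finite D]

/-- The 3-cells at a boundary edge form a fan, not a cycle, so there is no holonomy to obstruct a
section: normalise it to `1` at the boundary flag reached by turning. -/
theorem hasSection_of_isBdry (d₀ : D) (h : M.IsBdry 1 (M.cell 1 d₀)) : c.HasSection {2, 3} d₀ := by
  obtain ⟨b, hb, hb3⟩ := M.exists_of_isBdry_one h
  have hreach : ∀ d, M.orbit {2, 3} d = M.orbit {2, 3} d₀ →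
      ∃ k, M.α 3 (M.turn^[k] d) = M.turn^[k] d := by
    intro d hd
    obtain ⟨k, hk⟩ := M.exists_iterate_of_orbit_eq (hd.trans hb.symm)
    rcases hk with hk | hk
    · exact ⟨k, by rw [← hk, hb3]⟩
    · obtain ⟨n, hn, hp⟩ := M.exists_turn_iterate_eq b
      have h2 : M.turn b = M.turn^[k] d := by rw [turn, hb3, hk, M.invol]
      refine ⟨(n - 1) + k, ?_⟩
      rw [Function.iterate_add_apply, ← h2, ← Function.iterate_succ_apply M.turn,
        show (n - 1).succ = n by omega, hp, hb3]
  exact hasSection_of_turn d₀ 1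
    (fun d => (c.path d (sInf {k | M.α 3 (M.turn^[k] d) = M.turn^[k] d}))⁻¹) fun d hd _ h3 =>
    c.path_hitting (fun y => M.α 3 y = y) d (hreach d hd) h3

/-- The value at a flag is the inverse transport from it onwards to `d₀`. Only the step that leaves
`d₀` could violate the relation, and there the defect is the holonomy around the edge. -/
theorem hasSection_of_path_eq_one (d₀ : D) (h : ¬ M.IsBdry 1 (M.cell 1 d₀))
    (hp : c.path d₀ (Function.minimalPeriod M.turn d₀) = 1) : c.HasSection {2, 3} d₀ := by
  have hbulk : ∀ d, M.orbit {2, 3} d = M.orbit {2, 3} d₀ → M.α 3 d ≠ d :=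
    fun d hd h3 => h ⟨d, M.cell_one_eq_of_orbit hd, h3⟩
  have hpos : 0 < Function.minimalPeriod M.turn d₀ :=
    Function.minimalPeriod_pos_of_mem_periodicPts (M.turn_injective.mem_periodicPts d₀)
  have hsign : ∀ k, M.sign (M.turn^[k] d₀) = M.sign d₀ := by
    intro k
    induction k with
    | zero => rfl
    | succ k ih =>
      rw [Function.iterate_succ_apply', M.sign_turn (hbulk _ (M.orbit_turn_iterate _ _)), ih]
  -- Turning in the bulk preserves signs, so a flag with the sign of `d₀` reaches `d₀` itself and
  -- not its mirror image `M.α 2 d₀`.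
  have hreach : ∀ d, M.orbit {2, 3} d = M.orbit {2, 3} d₀ → M.sign d = M.sign d₀ →
      ∃ k, M.turn^[k] d = d₀ := by
    intro d hd hs
    obtain ⟨k, hk⟩ := M.exists_iterate_of_orbit_eq hd
    rcases hk with hk | hk
    · exact ⟨k, hk.symm⟩
    · have h2 : M.turn^[k] d = M.α 2 d₀ := by rw [hk, M.invol]
      have hs' : M.sign (M.turn^[k] d) = M.sign d := by
        clear hk h2
        induction k with
        | zero => rfl
        | succ k ih =>
          rw [Function.iterate_succ_apply',
            M.sign_turn (hbulk _ ((M.orbit_turn_iterate _ _).trans hd)), ih]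
      rw [h2, M.sign_α 2 _ (by decide), hs] at hs'
      exact absurd hs'.symm (units_ne_neg_self _)
  refine hasSection_of_turn d₀ (M.sign d₀)
    (fun d => (c.path d (sInf {k | M.turn^[k] d = d₀}))⁻¹) fun d hd hs h3 => ?_
  by_cases hd0 : d = d₀
  · subst hd0
    have h1 : sInf {k | M.turn^[k] d = d} = 0 :=
      Nat.sInf_eq_zero.2 (.inl rfl)
    obtain ⟨n, hn⟩ := Nat.exists_eq_succ_of_ne_zero hpos.ne'
    have h2 : sInf {k | M.turn^[k] (M.turn d) = d} = n := by
      have hmem : n ∈ {k | M.turn^[k] (M.turn d) = d} := by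
        have := Function.iterate_minimalPeriod (f := M.turn) (x := d)
        rw [hn] at this
        exact this
      refine le_antisymm (Nat.sInf_le hmem) ?_
      have h3 : M.turn^[sInf {k | M.turn^[k] (M.turn d) = d} + 1] d = d :=
        Nat.sInf_mem (s := {k | M.turn^[k] (M.turn d) = d}) ⟨n, hmem⟩
      have h4 := Function.IsPeriodicPt.minimalPeriod_le (Nat.succ_pos _) h3
      omega
    rw [hn, Nat.succ_eq_add_one, path_succ'] at hp
    rw [h1, h2, path, inv_one, mul_one]
    exact (eq_inv_of_mul_eq_one_right hp).symm
  · exact c.path_hitting (fun y => y = d₀) d (hreach d hd hs) hd0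

end Connection

end FlagComplex

/-! ### The bubble around a vertex -/

namespace FlagComplex

variable {D : Type*} (M : FlagComplex D)

/-- The `S`-orbits contained in a cell. -/
abbrev OrbitIn (S : Set (Fin 4)) {i : Fin 4} (c : M.Cell i) : Type _ :=
  {o : M.Orbit S // ∃ d, M.orbit S d = o ∧ M.cell i d = c}

theorem numOrbitsIn_eq (S : Set (Fin 4)) {i : Fin 4} (c : M.Cell i) :
    M.numOrbitsIn S c = Nat.card (M.OrbitIn S c) := rfl

/-- The bubble around a vertex as a surface map. -/
def bubble (v : M.Cell 0) : SurfaceMap {d // M.cell 0 d = v} (M.OrbitIn {2, 3} v)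
    (M.OrbitIn {1, 3} v) (M.OrbitIn {1, 2} v) where
  a d := ⟨M.α 1 d, (M.cell_α (by decide) _).trans d.2⟩
  b d := ⟨M.α 2 d, (M.cell_α (by decide) _).trans d.2⟩
  c d := ⟨M.α 3 d, (M.cell_α (by decide) _).trans d.2⟩
  v d := ⟨M.orbit {2, 3} d, d, rfl, d.2⟩
  e d := ⟨M.orbit {1, 3} d, d, rfl, d.2⟩
  f d := ⟨M.orbit {1, 2} d, d, rfl, d.2⟩
  sign d := M.sign d
  a_invol _ := Subtype.ext (M.invol _ _)
  b_invol _ := Subtype.ext (M.invol _ _)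
  c_invol _ := Subtype.ext (M.invol _ _)
  comm _ := Subtype.ext (M.comm13 _)
  sign_b _ := M.sign_α 2 _ (by decide)
  sign_c _ h := M.sign_α3 _ fun h' => h (Subtype.ext h')
  v_b _ := Subtype.ext (M.orbit_α (by simp) _)
  v_c _ := Subtype.ext (M.orbit_α (by simp) _)
  v_surj := by
    rintro ⟨_, d, rfl, h⟩
    exact ⟨⟨d, h⟩, rfl⟩
  e_c _ := Subtype.ext (M.orbit_α (by simp) _)
  e_eq d d' h := by
    rcases M.orbit_pair_eq M.comm13 (congrArg Subtype.val h) with h | h | h | h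
    · exact .inl (Subtype.ext h)
    · exact .inr (.inl (Subtype.ext h))
    · exact .inr (.inr (.inl (Subtype.ext h)))
    · exact .inr (.inr (.inr (Subtype.ext h)))
  f_a _ := Subtype.ext (M.orbit_α (by simp) _)
  f_b _ := Subtype.ext (M.orbit_α (by simp) _)
  f_surj := by
    rintro ⟨_, d, rfl, h⟩
    exact ⟨⟨d, h⟩, rfl⟩
  connected X ha hb hc d d' hd := by
    obtain ⟨_, h2⟩ := orbit_ind (M := M) (S := {0}ᶜ) (fun y => ∃ h : M.cell 0 y = v, X ⟨y, h⟩) (by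
      rintro j hj y ⟨h, hy⟩
      have hj' : j = 1 ∨ j = 2 ∨ j = 3 := by
        have : j ≠ 0 := hj
        fin_cases j <;> simp_all
      rcases hj' with rfl | rfl | rfl
      · exact ⟨_, ha _ hy⟩
      · exact ⟨_, hb _ hy⟩
      · exact ⟨_, hc _ hy⟩) (d.2.trans d'.2.symm) ⟨d.2, hd⟩
    exact h2

variable {M} {G : Type*} [Group G] [Finite D]

namespace Connection

variable {c : M.Connection G}

/-- `SurfaceMap.exists_section` on the bubble, whose vertices are the edge ends at `v`. The set `B`
contains the edge ends at which no flatness has to be known. -/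
theorem hasSection_bubble {v : M.Cell 0} (B : Set (M.OrbitIn {2, 3} v))
    (hB : ∀ d, (M.bubble v).c d = d → (M.bubble v).v d ∈ B) (hne : ∃ d, (M.bubble v).v d ∈ B)
    (hcard : (M.bubble v).innerEdges.ncard + 1 ≤ Bᶜ.ncard + Nat.card (M.OrbitIn {1, 2} v))
    (hflat : ∀ d, ∀ h : M.cell 0 d = v, (M.bubble v).v ⟨d, h⟩ ∉ B → c.HasSection {2, 3} d)
    {d₀ : D} (hd₀ : M.cell 0 d₀ = v) : c.HasSection {0}ᶜ d₀ := by
  classical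
  obtain ⟨k, hka, hkb, hkc⟩ := (M.bubble v).exists_section B hB hne hcard (fun d => c.x d)
    (fun d => c.x_α1 d) (fun d hd => c.x_α3 d fun h => hd (Subtype.ext h)) (by
      intro d₁ hd₁
      obtain ⟨k, hk⟩ := hflat d₁ d₁.2 hd₁
      refine ⟨fun d => k d, fun d hd => ?_⟩
      obtain ⟨h1, h2⟩ := hk d (congrArg Subtype.val hd)
      refine ⟨h1 2 (by simp) (by decide), h2 (by simp) fun h3 => hd₁ ?_⟩
      rw [← hd]
      exact hB d (Subtype.ext h3))
  refine ⟨fun d => if h : M.cell 0 d = v then k ⟨d, h⟩ else 1, fun d hd => ?_⟩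
  have hdv : M.cell 0 d = v := hd.trans hd₀
  beta_reduce
  refine ⟨fun j hj hj3 => ?_, fun _ h3 => ?_⟩
  · have hj' : j = 1 ∨ j = 2 := by
      have : j ≠ 0 := hj
      fin_cases j <;> simp_all
    rw [dif_pos hdv, dif_pos ((M.cell_α hj d).trans hdv)]
    rcases hj' with rfl | rfl
    · exact hka ⟨d, hdv⟩
    · exact hkb ⟨d, hdv⟩
  · rw [dif_pos hdv, dif_pos ((M.cell_α (by decide) d).trans hdv)]
    exact hkc ⟨d, hdv⟩ fun h => h3 (congrArg Subtype.val h)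

/-- The bubble is a disk, and `B` is the set of vertices on its rim. With Euler characteristic one,
the required count follows if the rim has at least as many edges as vertices. -/
theorem hasSection_of_isBdry_zero (hM : M.IsCellular) {d₀ : D} (hb : M.IsBdry 0 (M.cell 0 d₀))
    (hflat : ∀ d, M.cell 0 d = M.cell 0 d₀ → c.HasSection {2, 3} d) : c.HasSection {0}ᶜ d₀ := by
  classical
  set v := M.cell 0 d₀ with hv
  let S := M.bubble v
  let B : Set (M.OrbitIn {2, 3} v) := {w | ∃ d, S.c d = d ∧ S.v d = w}
  refine hasSection_bubble B (fun d hd => ⟨d, hd, rfl⟩) ?_ ?_ (fun d h _ => hflat d h) hv.symm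
  · obtain ⟨d, hd, hd3⟩ := hb
    exact ⟨⟨d, hd⟩, ⟨d, hd⟩, Subtype.ext hd3, rfl⟩
  · have hE := hM.bdry_bubble v hb
    rw [numOrbitsIn_eq, numOrbitsIn_eq, numOrbitsIn_eq] at hE
    have h1 := Set.ncard_add_ncard_compl B
    have h2 := Set.ncard_add_ncard_compl S.innerEdges
    have h3 : B.ncard ≤ S.innerEdgesᶜ.ncard := by
      -- The orientation attaches a rim edge to each rim vertex: the boundary flags `d` and
      -- `M.bdryTurn d` at an edge end have opposite signs, and the positive one selects the edge.
      -- Both flags of a rim edge being positive is impossible, so the choice is injective.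
      have hpos : ∀ w, ∃ d, w ∈ B → S.c d = d ∧ S.v d = w ∧ S.sign d = 1 := by
        intro w
        by_cases hw : w ∈ B
        · obtain ⟨d, hd, rfl⟩ := hw
          rcases Int.units_eq_one_or (S.sign d) with h | h
          · exact ⟨d, fun _ => ⟨hd, rfl, h⟩⟩
          · have hd3 : M.α 3 d = d := congrArg Subtype.val hd
            have horb := M.orbit_bdryTurn (d : D)
            refine ⟨⟨M.bdryTurn d, (M.cell_zero_eq_of_orbit horb).trans d.2⟩, fun _ =>
              ⟨Subtype.ext (M.α_bdryTurn hd3), Subtype.ext horb, ?_⟩⟩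
            refine (M.sign_bdryTurn hd3).trans ?_
            rw [show M.sign (d : D) = -1 from h, neg_neg]
        · exact ⟨⟨d₀, rfl⟩, fun h => absurd h hw⟩
      choose p hp using hpos
      refine Set.ncard_le_ncard_of_injOn (fun w => S.e (p w)) ?_ ?_ (Set.toFinite _)
      · rintro w hw ⟨d, hd, he⟩
        have hpw := (hp w hw).1
        rcases S.e_eq _ _ he with h | h | h | h
        · exact hd (h ▸ hpw)
        · rw [h, ← S.comm] at hpw
          exact hd (by simpa only [S.a_invol] using congrArg S.a hpw)
        · rw [h, S.c_invol] at hpw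
          exact hd hpw.symm
        · rw [h, ← S.comm, S.c_invol] at hpw
          exact hd (by simpa only [S.a_invol] using congrArg S.a hpw.symm)
      · intro w hw w' hw' he
        obtain ⟨h4, h5, h6⟩ := hp w hw
        obtain ⟨h4', h5', h6'⟩ := hp w' hw'
        have hsa : S.sign (S.a (p w)) = -S.sign (p w) := M.sign_α 1 _ (by decide)
        rw [← h5, ← h5']
        rcases S.e_eq _ _ he with h | h | h | h
        · rw [h]
        · rw [h, hsa, h6] at h6'
          exact absurd h6' (by decide)
        · rw [h, h4]
        · rw [h, h4, hsa, h6] at h6'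
          exact absurd h6' (by decide)
    have h4 : (M.bubble v).innerEdges.ncard = S.innerEdges.ncard := rfl
    omega

/-- The Bianchi identity: the bubble is a sphere, and on a sphere a connection flat at all vertices
but one is trivial. So `B` may consist of the single edge end of `d₀`. -/
theorem hasSection_of_not_isBdry_zero (hM : M.IsCellular) {d₀ : D}
    (hb : ¬ M.IsBdry 0 (M.cell 0 d₀))
    (hflat : ∀ d, M.cell 0 d = M.cell 0 d₀ → M.orbit {2, 3} d ≠ M.orbit {2, 3} d₀ →
      c.HasSection {2, 3} d) : c.HasSection {0}ᶜ d₀ := by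
  classical
  set v := M.cell 0 d₀ with hv
  let S := M.bubble v
  let B : Set (M.OrbitIn {2, 3} v) := {S.v ⟨d₀, hv.symm⟩}
  refine hasSection_bubble B (fun d hd => absurd ⟨d, d.2, congrArg Subtype.val hd⟩ hb)
    ⟨_, rfl⟩ ?_ (fun d h hd => hflat d h fun h' => hd (Subtype.ext h')) hv.symm
  have hE := hM.bulk_bubble v hb
  rw [numOrbitsIn_eq, numOrbitsIn_eq, numOrbitsIn_eq] at hE
  have h1 := Set.ncard_add_ncard_compl B
  rw [Set.ncard_singleton] at h1
  have h2 := Set.ncard_le_card S.innerEdges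
  have h4 : (M.bubble v).innerEdges.ncard = S.innerEdges.ncard := rfl
  omega

end Connection

/-! ### The maximal tree -/

/-- The bulk vertices correspond to the edges of a maximal tree, each vertex to the edge which
leads to its parent, of smaller rank. -/
theorem IsMaximalTree.exists_parent {T : Set M.BulkEdge} (hT : M.IsMaximalTree T) :
    ∃ (p : {v : M.Cell 0 // ¬ M.IsBdry 0 v} → D) (ρ : M.Cell 0 → ℕ),
      (∀ v, M.cell 0 (p v) = v) ∧ (∀ v, ρ (M.cell 0 (M.α 0 (p v))) < ρ v) ∧
      ∀ e ∈ T, ∃ v, M.cell 1 (p v) = e := by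
  obtain ⟨ρ, hρ⟩ := exists_rank (M.TreeAdj T) {v | M.IsBdry 0 v} fun v => hT.connects v
  have h : ∀ v : {v : M.Cell 0 // ¬ M.IsBdry 0 v}, ∃ d, (∃ e ∈ T, M.cell 1 d = e.1) ∧
      M.cell 0 d = v ∧ ρ (M.cell 0 (M.α 0 d)) < ρ v := by
    intro v
    obtain ⟨w', ⟨e, he, d, h1, h2, h3⟩, hlt⟩ := hρ v v.2
    exact ⟨d, ⟨e, he, h1⟩, h2, h3 ▸ hlt⟩
  choose p hpT hp0 hρ using h
  choose e heT he using hpT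
  refine ⟨p, ρ, hp0, hρ, ?_⟩
  have hinj : Function.Injective e := by
    intro v v' hvv
    have h1 : M.cell 1 (p v) = M.cell 1 (p v') := by rw [he, he, hvv]
    have h2 := M.orbit_eq_or_of_cell_one_eq h1
    have h3 := M.orbit_eq_or_of_cell_one_eq h1.symm
    rcases h2 with h2 | h2
    · refine Subtype.ext ?_
      rw [← hp0, ← hp0 v', M.cell_zero_eq_of_orbit h2]
    · rcases h3 with h3 | h3
      · refine Subtype.ext ?_
        rw [← hp0, ← hp0 v', M.cell_zero_eq_of_orbit h3]
      · have h4 := hρ v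
        have h5 := hρ v'
        rw [← M.cell_zero_eq_of_orbit h2, hp0] at h4
        rw [← M.cell_zero_eq_of_orbit h3, hp0] at h5
        omega
  -- An injection of the bulk vertices into `T` is onto, because both sets have the same size.
  have hrange : Set.range e = T := by
    refine Set.eq_of_subset_of_ncard_le ?_ ?_ (Set.toFinite _)
    · rintro _ ⟨v, rfl⟩
      exact heT v
    · rw [hT.card_eq, ← Set.image_univ, hinj.injOn.ncard_image, Set.ncard_univ]
  intro x hx
  rw [← hrange] at hx
  obtain ⟨v, rfl⟩ := hx
  exact ⟨v, he v⟩

namespace Connection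

variable {c : M.Connection G}

/-- The Bianchi identities: a connection which is flat off a maximal tree is flat. -/
theorem hasSection_of_isMaximalTree (hM : M.IsCellular) {T : Set M.BulkEdge}
    (hT : M.IsMaximalTree T)
    (hflat : ∀ d, ∀ h : ¬ M.IsBdry 1 (M.cell 1 d), (⟨M.cell 1 d, h⟩ : M.BulkEdge) ∉ T →
      c.HasSection {2, 3} d) (d : D) : c.HasSection {2, 3} d := by
  obtain ⟨p, ρ, hp0, hρ, hpT⟩ := hT.exists_parent
  have key : ∀ d, (∀ v, M.cell 1 (p v) = M.cell 1 d → c.HasSection {2, 3} (p v)) →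
      c.HasSection {2, 3} d := by
    intro d h
    by_cases hb : M.IsBdry 1 (M.cell 1 d)
    · exact hasSection_of_isBdry d hb
    · by_cases hdT : (⟨M.cell 1 d, hb⟩ : M.BulkEdge) ∈ T
      · obtain ⟨v, hv⟩ := hpT _ hdT
        exact (h v hv).of_cell_one_eq hv
      · exact hflat d hb hdT
  suffices hp : ∀ v, c.HasSection {2, 3} (p v) from key d fun v _ => hp v
  by_contra hbad
  push Not at hbad
  -- For a bad tree edge whose lower vertex has maximal rank, all other edge ends at that vertex are
  -- good; the Bianchi identity there makes this one good too.
  obtain ⟨v, hvb, hmax⟩ := Set.exists_max_image {v | ¬ c.HasSection {2, 3} (p v)}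
    (fun v => ρ v) (Set.toFinite _) hbad
  refine hvb ?_
  have h0 : c.HasSection {0}ᶜ (p v) := by
    refine hasSection_of_not_isBdry_zero hM (by rw [hp0]; exact v.2) fun d hd hne => ?_
    refine key d fun v' hv' => ?_
    by_contra hcon
    have hle := hmax v' hcon
    have hlt := hρ v'
    rw [hp0] at hd
    rcases M.orbit_eq_or_of_cell_one_eq hv' with h | h
    · have h1 := M.cell_zero_eq_of_orbit h
      rw [hd, hp0] at h1
      have h2 : v = v' := Subtype.ext h1
      exact hne (h2 ▸ h)
    · have h1 := M.cell_zero_eq_of_orbit h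
      rw [← h1, hd] at hlt
      omega
  obtain ⟨k, hk⟩ := h0
  refine ⟨k, fun y hy => ?_⟩
  obtain ⟨h1, h2⟩ := hk y (M.cell_zero_eq_of_orbit hy)
  refine ⟨fun j hj hj3 => h1 j ?_ hj3, fun _ => h2 (by simp)⟩
  rcases hj with rfl | rfl <;> simp

theorem hasSection_cell (hM : M.IsCellular) {T : Set M.BulkEdge} (hT : M.IsMaximalTree T)
    (hflat : ∀ d, ∀ h : ¬ M.IsBdry 1 (M.cell 1 d), (⟨M.cell 1 d, h⟩ : M.BulkEdge) ∉ T →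
      c.HasSection {2, 3} d) (i : Fin 4) (d : D) : c.HasSection {i}ᶜ d := by
  have h := hasSection_of_isMaximalTree hM hT hflat
  fin_cases i
  · by_cases hb : M.IsBdry 0 (M.cell 0 d)
    · exact hasSection_of_isBdry_zero hM hb fun d _ => h d
    · exact hasSection_of_not_isBdry_zero hM hb fun d _ _ => h d
  · exact (h d).cell_one hM
  · exact hasSection_cell_two hM d
  · exact hasSection_cell_three d

end Connection

end FlagComplex

/-! ### Flat connections on a ball are trivial -/

/-- Locally constant cocycles on a retract of a simply connected space are coboundaries. -/
theorem exists_coboundary {X A ι G : Type*} [TopologicalSpace X] [TopologicalSpace A]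
    [SimplyConnectedSpace A] [LocallyPathConnectedSpace A] [Group G]
    (incl : C(X, A)) (retr : C(A, X)) (hretr : ∀ x, retr (incl x) = x)
    (U : ι → Set X) (hU : ∀ i, IsOpen (U i)) (idx : X → ι) (hidx : ∀ x, x ∈ U (idx x))
    (t : ι → ι → X → G) (t_self : ∀ i, ∀ x ∈ U i, t i i x = 1)
    (t_const : ∀ i j, ∀ x ∈ U i ∩ U j, ∀ᶠ y in 𝓝 x, t i j y = t i j x)
    (t_comp : ∀ i j k, ∀ x ∈ U i ∩ U j ∩ U k, t j k x * t i j x = t i k x) :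
    ∃ s : ι → X → G, (∀ i, ∀ x ∈ U i, ∀ᶠ y in 𝓝 x, s i y = s i x) ∧
      ∀ i j, ∀ x ∈ U i ∩ U j, s j x = t i j x * s i x := by
  let _ : TopologicalSpace G := ⊥
  have : DiscreteTopology G := ⟨rfl⟩
  -- With `G` discrete, the cocycle glues the products `U i × G` to a covering space of `X`.
  let Z : FiberBundleCore ι X G :=
    { baseSet := U
      isOpen_baseSet := hU
      indexAt := idx
      mem_baseSet_at := hidx
      coordChange := fun i j x v => t i j x * v
      coordChange_self := fun i x hx v => by rw [t_self i x hx, one_mul]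
      continuousOn_coordChange := by
        rintro i j ⟨x, v⟩ ⟨hx, -⟩
        refine ContinuousAt.continuousWithinAt ?_
        refine ContinuousAt.congr (f := fun p : X × G => t i j x * p.2) ?_ ?_
        · exact (continuous_of_discreteTopology (f := fun g : G => t i j x * g)).continuousAt.comp
            continuousAt_snd
        · have h1 : ContinuousAt (Prod.fst : X × G → X) (x, v) := continuousAt_fst
          filter_upwards [h1.eventually (t_const i j x hx)] with p hp
          rw [hp]
      coordChange_comp := fun i j k x hx v => by rw [← mul_assoc, t_comp i j k x hx] }
  rcases isEmpty_or_nonempty X with hX | ⟨⟨x₀⟩⟩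
  · exact ⟨fun _ _ => 1, fun _ x => (hX.false x).elim, fun _ _ x => (hX.false x).elim⟩
  have hcov : IsCoveringMap (Bundle.TotalSpace.proj : Z.TotalSpace → X) :=
    FiberBundle.isCoveringMap (F := G) (E := Z.Fiber)
  -- The retraction lifts because `A` is simply connected. Restricted to `X`, the lift is a global
  -- section, and its coordinates in the charts are the functions `s i`.
  obtain ⟨F, ⟨-, hF⟩, -⟩ := hcov.existsUnique_continuousMap_lifts retr (incl x₀)
    (⟨x₀, (1 : G)⟩ : Z.TotalSpace) (hretr x₀).symm
  have hproj : ∀ x, (F (incl x)).proj = x := fun x => (congrFun hF (incl x)).trans (hretr x)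
  refine ⟨fun i x => (Z.localTriv i (F (incl x))).2, fun i x hx => ?_, fun i j x hx => ?_⟩
  · have hmem : F (incl x) ∈ (Z.localTriv i).source := by
      rw [Z.mem_localTriv_source]
      change (F (incl x)).proj ∈ U i
      rwa [hproj]
    have h1 : ContinuousAt (fun y => (Z.localTriv i (F (incl y))).2) x := by
      refine ContinuousAt.snd (ContinuousAt.comp (f := fun y => F (incl y)) ?_
        (F.continuous.comp incl.continuous).continuousAt)
      exact (Z.localTriv i).continuousOn_toFun.continuousAt
        ((Z.localTriv i).open_source.mem_nhds hmem)
    exact h1.eventually (show ∀ᶠ g in 𝓝 ((Z.localTriv i (F (incl x))).2),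
      g = (Z.localTriv i (F (incl x))).2 by simp)
  · change t (idx (F (incl x)).proj) j (F (incl x)).proj * (show G from (F (incl x)).2) =
      t i j x * (t (idx (F (incl x)).proj) i (F (incl x)).proj * (show G from (F (incl x)).2))
    rw [← mul_assoc, hproj, t_comp _ i j x ⟨⟨hidx x, hx.1⟩, hx.2⟩]

/-- The radial retraction onto the closed unit ball. -/
theorem exists_retraction_closedBall (E : Type*) [NormedAddCommGroup E] [NormedSpace ℝ E] :
    ∃ r : C(E, Metric.closedBall (0 : E) 1), ∀ x : Metric.closedBall (0 : E) 1, r x = x := by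
  have hpos : ∀ x : E, 0 < max 1 ‖x‖ := fun x => lt_max_of_lt_left one_pos
  refine ⟨⟨fun x => ⟨(max 1 ‖x‖)⁻¹ • x, ?_⟩, ?_⟩, fun x => ?_⟩
  · rw [mem_closedBall_zero_iff, norm_smul, norm_inv, Real.norm_of_nonneg (hpos x).le,
      inv_mul_le_iff₀ (hpos x), mul_one]
    exact le_max_right _ _
  · exact Continuous.subtype_mk (((continuous_const.max continuous_norm).inv₀
      fun x => (hpos x).ne').smul continuous_id) _
  · refine Subtype.ext ?_
    have := mem_closedBall_zero_iff.1 x.2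
    simp [max_eq_left this]

/-! ### The geometric realization and its cover by open stars -/

namespace FlagComplex

variable {D : Type*} (M : FlagComplex D)

/-- A point of the realization, given by a flag and barycentric coordinates. -/
def toRealization (d : D) (p : stdSimplex ℝ (Fin 4)) : M.Realization := Quot.mk _ ⟨d, p⟩

theorem toRealization_α {i : Fin 4} (d : D) {p : stdSimplex ℝ (Fin 4)} (hp : p.1 i = 0) :
    M.toRealization (M.α i d) p = M.toRealization d p :=
  (Quot.sound ⟨i, hp, rfl⟩).symm

theorem continuous_toRealization (d : D) : Continuous (M.toRealization d) :=
  continuous_quot_mk.comp continuous_sigmaMk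

theorem exists_toRealization (x : M.Realization) : ∃ d p, M.toRealization d p = x := by
  obtain ⟨⟨d, p⟩, rfl⟩ := Quot.exists_rep x
  exact ⟨d, p, rfl⟩

theorem isOpen_realization_iff {s : Set M.Realization} :
    IsOpen s ↔ ∀ d, IsOpen (M.toRealization d ⁻¹' s) := by
  refine isOpen_coinduced.trans ?_
  rw [isOpen_sigma_iff]
  rfl

/-- The open star of the barycentre of the `i`-cell of the flag `d₀`. -/
def star (a : Fin 4 × D) : Set M.Realization :=
  {x | Quot.lift (fun q : (_ : D) × stdSimplex ℝ (Fin 4) =>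
    M.cell a.1 q.1 = M.cell a.1 a.2 ∧ 0 < q.2.1 a.1) (by
      rintro ⟨d, p⟩ _ ⟨j, hj, rfl⟩
      by_cases hji : j = a.1
      · subst hji
        change p.1 a.1 = 0 at hj
        simp [hj]
      · simp only [M.cell_α hji]) x}

theorem isOpen_star (a : Fin 4 × D) : IsOpen (M.star a) := by
  refine M.isOpen_realization_iff.2 fun d => ?_
  have h : M.toRealization d ⁻¹' M.star a =
      {p | M.cell a.1 d = M.cell a.1 a.2 ∧ 0 < p.1 a.1} := rfl
  rw [h]
  by_cases h : M.cell a.1 d = M.cell a.1 a.2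
  · simp only [h, true_and]
    exact isOpen_lt continuous_const ((continuous_apply _).comp continuous_subtype_val)
  · simp only [h, false_and]
    exact isOpen_empty

theorem exists_pos_stdSimplex (p : stdSimplex ℝ (Fin 4)) : ∃ i, 0 < p.1 i := by
  by_contra h
  push Not at h
  have h1 := Finset.sum_nonpos fun i (_ : i ∈ Finset.univ) => h i
  rw [p.2.2] at h1
  linarith

theorem exists_mem_star (x : M.Realization) : ∃ a, x ∈ M.star a := by
  obtain ⟨d, p, rfl⟩ := M.exists_toRealization x
  obtain ⟨i, hi⟩ := exists_pos_stdSimplex p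
  exact ⟨(i, d), rfl, hi⟩

instance : PreconnectedSpace (stdSimplex ℝ (Fin 4)) :=
  Subtype.preconnectedSpace (convex_stdSimplex ℝ (Fin 4)).isPreconnected

/-- The vertices of the standard simplex. -/
def simplexVertex (i : Fin 4) : stdSimplex ℝ (Fin 4) := ⟨Pi.single i 1, single_mem_stdSimplex ℝ i⟩

theorem simplexVertex_self (i : Fin 4) : (simplexVertex i).1 i = 1 := by simp [simplexVertex]

theorem simplexVertex_ne {i j : Fin 4} (h : j ≠ i) : (simplexVertex i).1 j = 0 := by
  simp [simplexVertex, h]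

variable {M}

/-- The flags of a ball are connected. -/
theorem IsBallDecomposition.connected (hM : M.IsBallDecomposition) (X : D → Prop)
    (hX : ∀ i d, X d → X (M.α i d)) {d d' : D} (hd : X d) : X d' := by
  obtain ⟨e⟩ := hM.homeo_ball
  have : PreconnectedSpace (Metric.closedBall (0 : EuclideanSpace ℝ (Fin 3)) 1) :=
    Subtype.preconnectedSpace (convex_closedBall 0 1).isPreconnected
  have : PreconnectedSpace M.Realization := e.symm.surjective.denseRange.preconnectedSpace e.symm.continuous
  have hiff : ∀ i d, X (M.α i d) = X d := fun i d =>
    propext ⟨fun h => by simpa only [M.invol] using hX i _ h, hX i d⟩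
  let f : M.Realization → Prop := Quot.lift (fun q => X q.1) (by
    rintro ⟨d, p⟩ _ ⟨j, -, rfl⟩
    exact (hiff j d).symm)
  have hcl : IsClopen {x | f x} := by
    refine ⟨⟨?_⟩, ?_⟩
    · refine M.isOpen_realization_iff.2 fun d => ?_
      exact isOpen_const (p := ¬ X d)
    · refine M.isOpen_realization_iff.2 fun d => ?_
      exact isOpen_const (p := X d)
  have huniv := hcl.eq_univ ⟨M.toRealization d (simplexVertex 0), hd⟩
  have : M.toRealization d' (simplexVertex 0) ∈ {x | f x} := huniv ▸ Set.mem_univ _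
  exact this

variable {G : Type*} [Group G] {c : M.Connection G}

/-- A flat connection on a ball is trivial. -/
theorem IsBallDecomposition.exists_section (hM : M.IsBallDecomposition)
    (hc : ∀ i d, c.HasSection {i}ᶜ d) :
    ∃ K : D → G, (∀ i d, i ≠ 3 → K (M.α i d) = K d) ∧
      ∀ d, M.α 3 d ≠ d → K (M.α 3 d) = c.x d * K d := by
  classical
  obtain ⟨e⟩ := hM.homeo_ball
  obtain ⟨r, hr⟩ := exists_retraction_closedBall (EuclideanSpace ℝ (Fin 3))
  have hsec : ∀ a : Fin 4 × D, ∃ k : D → G, ∀ d, M.cell a.1 d = M.cell a.1 a.2 → ∀ j, j ≠ a.1 →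
      ((j ≠ 3 → k (M.α j d) = k d) ∧ (j = 3 → M.α 3 d ≠ d → k (M.α 3 d) = c.x d * k d)) := by
    intro a
    obtain ⟨k, hk⟩ := hc a.1 a.2
    refine ⟨k, fun d hd j hj => ⟨fun h3 => (hk d hd).1 j hj h3, ?_⟩⟩
    rintro rfl
    exact (hk d hd).2 hj
  choose k hk using hsec
  choose idx hidx using M.exists_mem_star
  let cond : Fin 4 × D → Fin 4 × D → D → stdSimplex ℝ (Fin 4) → Prop := fun a b d p =>
    (M.cell a.1 d = M.cell a.1 a.2 ∧ 0 < p.1 a.1) ∧ M.cell b.1 d = M.cell b.1 b.2 ∧ 0 < p.1 b.1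
  -- A point of both stars is glued along `α j` only for `j` different from both indices, since
  -- those coordinates are positive. Both local sections then change by the same left factor, so `(k
  -- b)⁻¹ * k a` descends to the realization.
  have hcond : ∀ a b d p j, p.1 j = 0 → cond a b d p → j ≠ a.1 ∧ j ≠ b.1 := by
    rintro a b d p j hj ⟨⟨-, h1⟩, -, h2⟩
    constructor
    · rintro rfl
      exact h1.ne' hj
    · rintro rfl
      exact h2.ne' hj
  have hcond' : ∀ a b d p j, p.1 j = 0 → cond a b d p → cond a b (M.α j d) p := by
    intro a b d p j hj h
    obtain ⟨h1, h2⟩ := hcond a b d p j hj h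
    simpa only [cond, M.cell_α h1, M.cell_α h2] using h
  let t : Fin 4 × D → Fin 4 × D → M.Realization → G := fun a b => Quot.lift
    (fun q => if cond a b q.1 q.2 then (k b q.1)⁻¹ * k a q.1 else 1) (by
      rintro ⟨d, p⟩ _ ⟨j, hj, rfl⟩
      by_cases h : cond a b d p
      · have h' := hcond' a b d p j hj h
        obtain ⟨h1, h2⟩ := hcond a b d p j hj h
        simp only [h, h', if_true]
        by_cases hj3 : j = 3
        · subst hj3
          by_cases hd : M.α 3 d = d
          · rw [hd]
          · rw [(hk a d h.1.1 _ h1).2 rfl hd, (hk b d h.2.1 _ h2).2 rfl hd]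
            group
        · rw [(hk a d h.1.1 _ h1).1 hj3, (hk b d h.2.1 _ h2).1 hj3]
      · have h' : ¬ cond a b (M.α j d) p := fun h' => h (by
          simpa only [M.invol] using hcond' a b _ p j hj h')
        simp only [h, h', if_false])
  have ht : ∀ a b d p, M.toRealization d p ∈ M.star a → M.toRealization d p ∈ M.star b →
      t a b (M.toRealization d p) = (k b d)⁻¹ * k a d := fun a b d p ha hb =>
    if_pos (⟨ha, hb⟩ : cond a b d p)
  obtain ⟨s, hs, hst⟩ := exists_coboundary
    (incl := ⟨fun x => (e x : EuclideanSpace ℝ (Fin 3)), continuous_subtype_val.comp e.continuous⟩)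
    (retr := (ContinuousMap.mk e.symm e.symm.continuous).comp r)
    (fun x => by simp [hr]) M.star M.isOpen_star idx hidx t
    (by
      intro a x ha
      obtain ⟨d, p, rfl⟩ := M.exists_toRealization x
      rw [ht a a d p ha ha, inv_mul_cancel])
    (by
      intro a b x hx
      have hopen : IsOpen {y | y ∈ M.star a ∩ M.star b ∧ t a b y = t a b x} := by
        refine M.isOpen_realization_iff.2 fun d => ?_
        have h1 : M.toRealization d ⁻¹' {y | y ∈ M.star a ∩ M.star b ∧ t a b y = t a b x} =
            M.toRealization d ⁻¹' (M.star a ∩ M.star b) ∩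
              {_p | (k b d)⁻¹ * k a d = t a b x} := by
          ext p
          refine and_congr_right fun hp => ?_
          have := ht a b d p hp.1 hp.2
          exact ⟨fun h => this.symm.trans h, fun h => this.trans h⟩
        rw [h1]
        exact (((M.isOpen_star a).inter (M.isOpen_star b)).preimage
          (M.continuous_toRealization d)).inter isOpen_const
      filter_upwards [hopen.mem_nhds ⟨hx, rfl⟩] with y hy using hy.2)
    (by
      intro a b b' x hx
      obtain ⟨d, p, rfl⟩ := M.exists_toRealization x
      rw [ht a b d p hx.1.1 hx.1.2, ht b b' d p hx.1.2 hx.2, ht a b' d p hx.1.1 hx.2]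
      group)
  have hind : ∀ a b d p, M.toRealization d p ∈ M.star a → M.toRealization d p ∈ M.star b →
      k a d * s a (M.toRealization d p) = k b d * s b (M.toRealization d p) := by
    intro a b d p ha hb
    rw [hst a b _ ⟨ha, hb⟩, ht a b d p ha hb]
    group
  -- The global section read on the tetrahedron of `d`. By `hind` the chosen chart does not matter,
  -- so `Φ d` is locally constant on a connected simplex and hence constant.
  let Φ : D → stdSimplex ℝ (Fin 4) → G := fun d p =>
    k (idx (M.toRealization d p)) d * s (idx (M.toRealization d p)) (M.toRealization d p)
  have hΦ : ∀ a d p, M.toRealization d p ∈ M.star a →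
      Φ d p = k a d * s a (M.toRealization d p) := fun a d p ha => hind _ _ d p (hidx _) ha
  have hconst : ∀ d, IsLocallyConstant (Φ d) := by
    intro d
    rw [IsLocallyConstant.iff_eventually_eq]
    intro p
    set a := idx (M.toRealization d p)
    have ha : M.toRealization d p ∈ M.star a := hidx _
    have h1 := (M.continuous_toRealization d).continuousAt.eventually (hs a _ ha)
    have h2 := (M.continuous_toRealization d).continuousAt.eventually
      ((M.isOpen_star a).mem_nhds ha)
    filter_upwards [h1, h2] with q hq1 hq2
    rw [hΦ a d q hq2, hΦ a d p ha, hq1]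
  have hK : ∀ d p q, Φ d p = Φ d q := fun d p q =>
    (hconst d).apply_eq_of_preconnectedSpace p q
  -- Flags `d` and `M.α j d` share the `i`-th vertex of their tetrahedra when `j ≠ i`. At this
  -- common point the constants are compared in a single chart.
  have key : ∀ d i j, j ≠ i → Φ (M.α j d) (simplexVertex i) =
      k (i, d) (M.α j d) * s (i, d) (M.toRealization d (simplexVertex i)) ∧
      Φ d (simplexVertex i) = k (i, d) d * s (i, d) (M.toRealization d (simplexVertex i)) := by
    intro d i j hj
    have hmem : M.toRealization d (simplexVertex i) ∈ M.star (i, d) :=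
      ⟨rfl, by simp only [simplexVertex_self]; exact one_pos⟩
    have h1 := M.toRealization_α d (simplexVertex_ne hj)
    refine ⟨?_, hΦ _ _ _ hmem⟩
    rw [hΦ (i, d) (M.α j d) _ (h1.symm ▸ hmem), h1]
  refine ⟨fun d => Φ d (simplexVertex 0), fun j d hj3 => ?_, fun d h3 => ?_⟩
  · obtain ⟨i, hi⟩ : ∃ i, j ≠ i := ⟨3, hj3⟩
    beta_reduce
    rw [hK _ _ (simplexVertex i), hK d _ (simplexVertex i), (key d i j hi).1, (key d i j hi).2,
      (hk (i, d) d rfl j hi).1 hj3]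
  · have h0 : (3 : Fin 4) ≠ 0 := by decide
    beta_reduce
    rw [(key d 0 3 h0).1, (key d 0 3 h0).2, (hk (0, d) d rfl 3 h0).2 rfl h3, mul_assoc]

end FlagComplex

/-! ### Counting cells -/

namespace FlagComplex

variable {D : Type*} (M : FlagComplex D)

/-- The flags of the end of a boundary edge which lie on the boundary. -/
theorem eq_or_eq_bdryTurn [Finite D] {d d' : D} (hd : M.α 3 d = d) (hd' : M.α 3 d' = d')
    (h : M.orbit {2, 3} d = M.orbit {2, 3} d') : d' = d ∨ d' = M.bdryTurn d := by
  obtain ⟨hs, hs3⟩ := M.steps_spec d hd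
  -- The edge end is a fan: its flags are the `M.turn^[j] d` with `j ≤ M.steps d` and their images
  -- under `α 3`. By minimality of `steps`, only the first and the last lie on the boundary.
  obtain ⟨j, hj, h1⟩ := orbit_ind
    (fun y => ∃ j ≤ M.steps d, y = M.turn^[j] d ∨ y = M.α 3 (M.turn^[j] d)) (by
      have h2 : ∀ j ≤ M.steps d, ∃ i ≤ M.steps d, M.α 2 (M.turn^[j] d) = M.turn^[i] d ∨
          M.α 2 (M.turn^[j] d) = M.α 3 (M.turn^[i] d) := by
        rintro (_ | j) hj
        · exact ⟨1, hs, .inl (by rw [Function.iterate_one, turn, hd]; rfl)⟩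
        · exact ⟨j, by omega, .inr (by rw [Function.iterate_succ_apply', turn, M.invol])⟩
      rintro _ (rfl | rfl) y ⟨j, hj, rfl | rfl⟩
      · exact h2 j hj
      · rcases hj.lt_or_eq with hj' | rfl
        · exact ⟨j + 1, hj', .inl (by rw [Function.iterate_succ_apply', turn])⟩
        · rw [hs3]
          exact h2 _ le_rfl
      · exact ⟨j, hj, .inr rfl⟩
      · exact ⟨j, hj, .inl (M.invol _ _)⟩) h ⟨0, Nat.zero_le _, .inl rfl⟩
  have h2 : d' = M.turn^[j] d := by
    rcases h1 with h1 | h1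
    · exact h1
    · rw [h1, M.invol] at hd'
      rw [h1, ← hd']
  rcases Nat.eq_zero_or_pos j with rfl | hj0
  · exact .inl h2
  rcases hj.lt_or_eq with hj' | rfl
  · exact absurd (h2 ▸ hd') (M.not_fixed_of_lt_steps hj0 hj')
  · exact .inr h2

theorem bdryTurn_ne [Finite D] {d : D} (hd : M.α 3 d = d) : M.bdryTurn d ≠ d := fun h =>
  units_ne_neg_self (M.sign d) (by rw [← M.sign_bdryTurn hd, h])

theorem bdryTurn_bdryTurn [Finite D] {d : D} (hd : M.α 3 d = d) :
    M.bdryTurn (M.bdryTurn d) = d := by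
  have h1 := M.α_bdryTurn hd
  rcases M.eq_or_eq_bdryTurn h1 hd (M.orbit_bdryTurn d) with h | h
  · exact absurd h.symm (M.bdryTurn_ne hd)
  · exact h.symm

theorem turn_α_zero (d : D) : M.turn (M.α 0 d) = M.α 0 (M.turn d) := by
  rw [turn, turn, ← M.comm03, ← M.comm02]

theorem α_three_α_zero_iff (d : D) : M.α 3 (M.α 0 d) = M.α 0 d ↔ M.α 3 d = d := by
  rw [← M.comm03]
  exact ⟨fun h => by simpa only [M.invol] using congrArg (M.α 0) h, fun h => by rw [h]⟩

theorem bdryTurn_α_zero (d : D) : M.bdryTurn (M.α 0 d) = M.α 0 (M.bdryTurn d) := by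
  have h1 : ∀ k, M.turn^[k] (M.α 0 d) = M.α 0 (M.turn^[k] d) := by
    intro k
    induction k with
    | zero => rfl
    | succ k ih => rw [Function.iterate_succ_apply', Function.iterate_succ_apply', ih, turn_α_zero]
  have h2 : M.steps (M.α 0 d) = M.steps d := by
    simp only [steps, h1, α_three_α_zero_iff]
  rw [bdryTurn, bdryTurn, h1, h2]

/-- The boundary flags of a boundary edge. -/
theorem bdry_flags_of_cell_one_eq [Finite D] {d d' : D} (hd : M.α 3 d = d) (hd' : M.α 3 d' = d')
    (h : M.cell 1 d = M.cell 1 d') :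
    d' = d ∨ d' = M.α 0 d ∨ d' = M.bdryTurn d ∨ d' = M.α 0 (M.bdryTurn d) := by
  rcases M.orbit_eq_or_of_cell_one_eq h with h1 | h1
  · rcases M.eq_or_eq_bdryTurn hd hd' h1.symm with h2 | h2
    · exact .inl h2
    · exact .inr (.inr (.inl h2))
  · rcases M.eq_or_eq_bdryTurn ((M.α_three_α_zero_iff d).2 hd) hd' h1.symm with h2 | h2
    · exact .inr (.inl h2)
    · exact .inr (.inr (.inr (by rw [h2, bdryTurn_α_zero])))

/-! ### The boundary as a closed surface -/

/-- The boundary surface, when the boundary graph is connected. -/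
noncomputable def bdrySurface [Finite D] {M : FlagComplex D} (o : M.Framing)
    (hΓ : o.ConnectedBoundaryGraph) :
    SurfaceMap {d // M.α 3 d = d} {v : M.Cell 0 // M.IsBdry 0 v} M.BdryEdge M.BdryFace where
  a d := ⟨M.α 0 d, by rw [← M.comm03, d.2]⟩
  b d := ⟨M.α 1 d, by rw [← M.comm13, d.2]⟩
  c d := ⟨M.bdryTurn d, M.α_bdryTurn d.2⟩
  v d := ⟨M.cell 0 d, d, rfl, d.2⟩
  e d := ⟨M.cell 1 d, d, rfl, d.2⟩
  f d := ⟨M.cell 2 d, d, rfl, d.2⟩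
  sign d := M.sign d
  a_invol _ := Subtype.ext (M.invol _ _)
  b_invol _ := Subtype.ext (M.invol _ _)
  c_invol d := Subtype.ext (M.bdryTurn_bdryTurn d.2)
  comm d := Subtype.ext (M.bdryTurn_α_zero d).symm
  sign_b _ := M.sign_α 1 _ (by decide)
  sign_c d _ := M.sign_bdryTurn d.2
  v_b _ := Subtype.ext (M.cell_α (by decide) _)
  v_c d := Subtype.ext (M.cell_zero_eq_of_orbit (M.orbit_bdryTurn d))
  v_surj := by
    rintro ⟨_, d, rfl, h⟩
    exact ⟨⟨d, h⟩, rfl⟩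
  e_c d := Subtype.ext (M.cell_one_eq_of_orbit (M.orbit_bdryTurn d))
  e_eq d d' h := by
    rcases M.bdry_flags_of_cell_one_eq d.2 d'.2 (congrArg Subtype.val h) with h | h | h | h
    · exact .inl (Subtype.ext h)
    · exact .inr (.inl (Subtype.ext h))
    · exact .inr (.inr (.inl (Subtype.ext h)))
    · exact .inr (.inr (.inr (Subtype.ext h)))
  f_a _ := Subtype.ext (M.cell_α (by decide) _)
  f_b _ := Subtype.ext (M.cell_α (by decide) _)
  f_surj := by
    rintro ⟨_, d, rfl, h⟩
    exact ⟨⟨d, h⟩, rfl⟩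
  connected X ha hb hc d d' hd := by
    have hf : ∀ y y' : {d // M.α 3 d = d}, M.cell 2 (y : D) = M.cell 2 (y' : D) → X y → X y' := by
      intro y y' h hy
      have h1 := M.orbit_eq_of_cell_two_eq y.2 h
      obtain ⟨_, h2⟩ := orbit_ind (M := M) (fun y => ∃ h : M.α 3 y = y, X ⟨y, h⟩) (by
        rintro _ (rfl | rfl) y ⟨h, hy⟩
        · exact ⟨_, ha _ hy⟩
        · exact ⟨_, hb _ hy⟩) h1.symm ⟨y.2, hy⟩
      exact h2
    -- A property closed under the moves fills each boundary face that it meets, and then spreads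
    -- from node to node along the links.
    let P : M.BdryFace → Prop := fun n => ∃ y : {d // M.α 3 d = d}, M.cell 2 (y : D) = n.1 ∧ X y
    have hP : ∀ n n' : M.BdryFace,
        Relation.EqvGen (fun a b => ∃ l, o.source l = a ∧ o.target l = b) n n' → (P n ↔ P n') := by
      intro n n' h
      induction h with
      | rel _ _ h =>
        obtain ⟨l, rfl, rfl⟩ := h
        let b : {d // M.α 3 d = d} := ⟨o.base l.1, o.base_bdry l.1 l.2⟩
        let b' : {d // M.α 3 d = d} := ⟨M.bdryTurn b, M.α_bdryTurn b.2⟩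
        constructor
        · rintro ⟨y, hy, hXy⟩
          exact ⟨b', rfl, hc b (hf y b hy hXy)⟩
        · rintro ⟨y, hy, hXy⟩
          refine ⟨b, rfl, ?_⟩
          have h1 := hc b' (hf y b' hy hXy)
          have h2 : (⟨M.bdryTurn b', M.α_bdryTurn b'.2⟩ : {d // M.α 3 d = d}) = b :=
            Subtype.ext (M.bdryTurn_bdryTurn b.2)
          rwa [h2] at h1
      | refl _ => exact Iff.rfl
      | symm _ _ _ ih => exact ih.symm
      | trans _ _ _ _ _ ih ih' => exact ih.trans ih'
    obtain ⟨y, hy, hXy⟩ := (hP ⟨M.cell 2 d, d, rfl, d.2⟩ ⟨M.cell 2 d', d', rfl, d'.2⟩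
      (hΓ _ _)).1 ⟨d, rfl, hd⟩
    exact hf y d' hy hXy

/-- The Euler characteristic of the boundary is at most two. -/
theorem card_bdry_le [Finite D] {M : FlagComplex D} (o : M.Framing)
    (hΓ : o.ConnectedBoundaryGraph) (hne : ∃ d, M.α 3 d = d) :
    Nat.card {v : M.Cell 0 // M.IsBdry 0 v} + Nat.card M.BdryFace ≤ Nat.card M.BdryEdge + 2 := by
  obtain ⟨d, hd⟩ := hne
  let S := bdrySurface o hΓ
  -- `bdryTurn` fixes no flag, so the surface is closed and any single vertex can serve as root set.
  have h1 := S.card_add_card_le {S.v ⟨d, hd⟩}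
    (fun y hy => absurd (congrArg Subtype.val hy) (M.bdryTurn_ne y.2)) ⟨_, rfl⟩
  have h2 := Set.ncard_le_card S.innerEdges
  have h3 := Set.ncard_add_ncard_compl {S.v ⟨d, hd⟩}
  rw [Set.ncard_singleton] at h3
  omega

/-! ### Euler characteristic of the bulk -/

theorem card_eq_add_card_not {X : Type*} [Finite X] (P : X → Prop) :
    Nat.card X = Nat.card {x // P x} + Nat.card {x // ¬ P x} := by
  classical
  rw [← Nat.card_sum]
  exact Nat.card_congr (Equiv.sumCompl P).symm

/-- Moves in `S` never change the `i`-cell, so each `S`-orbit lies in exactly one `i`-cell. -/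
theorem sum_numOrbitsIn [Finite D] {S : Set (Fin 4)} {i : Fin 4} (hS : S ⊆ {i}ᶜ)
    [Fintype (M.Cell i)] :
    ∑ x : M.Cell i, M.numOrbitsIn S x = Nat.card (M.Orbit S) := by
  simp only [numOrbitsIn_eq]
  rw [← Nat.cast_sum, ← Nat.card_sigma]
  congr 1
  refine Nat.card_congr (Equiv.ofBijective (fun o => o.2.1) ⟨?_, ?_⟩)
  · rintro ⟨x, o, d, hd, hdx⟩ ⟨x', o', d', hd', hdx'⟩ h
    dsimp only at h
    subst h hdx hdx'
    have := orbit_eq_of_subset hS (hd.trans hd'.symm)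
    have h2 : M.cell i d = M.cell i d' := this
    congr! 1
    congr! 2
    rw [h2]
  · intro o
    obtain ⟨d, rfl⟩ := M.orbit_surjective S o
    exact ⟨⟨M.cell i d, M.orbit S d, d, rfl, rfl⟩, rfl⟩

theorem sum_eq_mul_card_of_fiber {X Y : Type*} [Fintype X] [Fintype Y] [DecidableEq Y]
    (f : X → Y) (w : X → ℕ) (m : ℕ) (h : ∀ y, ∑ x with f x = y, w x = m) :
    ∑ x, w x = m * Nat.card Y := by
  rw [← Finset.sum_fiberwise Finset.univ f w, Finset.sum_congr rfl fun y _ => h y]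
  simp [mul_comm]

variable {M}

/-- Every orbit has four flags: signs exclude fixed points of `α 0` and `α 2`, and `α 0 d = α 2 d`
would fold an edge. -/
theorem IsCellular.card_orbit_zero_two [Finite D] (hM : M.IsCellular) :
    Nat.card D = 4 * Nat.card (M.Orbit {0, 2}) := by
  classical
  have := Fintype.ofFinite D
  have := Fintype.ofFinite (M.Orbit {0, 2})
  rw [← sum_eq_mul_card_of_fiber (M.orbit {0, 2}) (fun _ => 1)]
  · simp
  intro y
  obtain ⟨d, rfl⟩ := M.orbit_surjective _ y
  have h0 : ∀ d, M.α 0 d ≠ d := fun d h =>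
    units_ne_neg_self _ ((congrArg M.sign h).symm.trans (M.sign_α 0 d (by decide)))
  have h2 : ∀ d, M.α 2 d ≠ d := fun d h =>
    units_ne_neg_self _ ((congrArg M.sign h).symm.trans (M.sign_α 2 d (by decide)))
  have h02 : ∀ d, M.α 0 d ≠ M.α 2 d := fun d h => hM.ends_ne d (by rw [h, M.orbit_α (by simp)])
  have hfib : (Finset.univ.filter fun x => M.orbit {0, 2} x = M.orbit {0, 2} d) =
      {d, M.α 0 d, M.α 2 d, M.α 0 (M.α 2 d)} := by
    ext x
    simp only [Finset.mem_filter, Finset.mem_univ, true_and, Finset.mem_insert,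
      Finset.mem_singleton]
    refine ⟨fun h => M.orbit_pair_eq M.comm02 h.symm, ?_⟩
    rintro (rfl | rfl | rfl | rfl) <;> simp [M.orbit_α]
  rw [hfib, Finset.sum_const, smul_eq_mul, mul_one]
  have h3 : d ≠ M.α 0 (M.α 2 d) := fun h => h02 d (by
    nth_rw 1 [h]; rw [M.invol])
  have h4 : M.α 0 d ≠ M.α 0 (M.α 2 d) := fun h => h2 d (by
    simpa only [M.invol] using (congrArg (M.α 0) h).symm)
  rw [Finset.card_insert_of_notMem, Finset.card_insert_of_notMem, Finset.card_insert_of_notMem,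
    Finset.card_singleton]
  · simpa using (h0 _).symm
  · simpa using ⟨h02 d, h4⟩
  · simpa using ⟨(h0 d).symm, (h2 d).symm, h3⟩

/-- An orbit has four flags in the bulk but only two on the boundary, so boundary flags are counted
twice. -/
theorem IsCellular.card_orbit_one_three [Finite D] (hM : M.IsCellular) :
    Nat.card D + Nat.card {d // M.α 3 d = d} = 4 * Nat.card (M.Orbit {1, 3}) := by
  classical
  have := Fintype.ofFinite D
  have := Fintype.ofFinite (M.Orbit {1, 3})
  rw [← sum_eq_mul_card_of_fiber (M.orbit {1, 3}) (fun d => if M.α 3 d = d then 2 else 1)]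
  · have h : ∀ d, (if M.α 3 d = d then 2 else 1) = 1 + if M.α 3 d = d then 1 else 0 := by
      intro d
      split_ifs <;> rfl
    simp only [h, Finset.sum_add_distrib]
    simp [Fintype.card_subtype]
  intro y
  obtain ⟨d, rfl⟩ := M.orbit_surjective _ y
  have h1 : ∀ d, M.α 1 d ≠ d := fun d h =>
    units_ne_neg_self _ ((congrArg M.sign h).symm.trans (M.sign_α 1 d (by decide)))
  have hfib : (Finset.univ.filter fun x => M.orbit {1, 3} x = M.orbit {1, 3} d) =
      {d, M.α 1 d, M.α 3 d, M.α 1 (M.α 3 d)} := by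
    ext x
    simp only [Finset.mem_filter, Finset.mem_univ, true_and, Finset.mem_insert,
      Finset.mem_singleton]
    refine ⟨fun h => M.orbit_pair_eq M.comm13 h.symm, ?_⟩
    rintro (rfl | rfl | rfl | rfl) <;> simp [M.orbit_α]
  rw [hfib]
  have hα1 : ∀ d, M.α 3 (M.α 1 d) = M.α 1 d ↔ M.α 3 d = d := by
    intro d
    rw [← M.comm13]
    exact ⟨fun h => by simpa only [M.invol] using congrArg (M.α 1) h, fun h => by rw [h]⟩
  by_cases hd : M.α 3 d = d
  · rw [hd]
    have : ({d, M.α 1 d, d, M.α 1 d} : Finset D) = {d, M.α 1 d} := by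
      ext x
      simp
    rw [this, Finset.sum_pair (h1 d).symm, if_pos hd, if_pos ((hα1 d).2 hd)]
  · have h13 : ∀ d, M.α 3 d ≠ d → M.α 1 d ≠ M.α 3 d := fun d h3 h =>
      hM.sides_ne d h3 (by rw [← h, M.orbit_α (by simp)])
    have h3 : d ≠ M.α 1 (M.α 3 d) := fun h => h13 d hd (by
      nth_rw 1 [h]; rw [M.invol])
    have h4 : M.α 1 d ≠ M.α 1 (M.α 3 d) := fun h => hd (by
      simpa only [M.invol] using (congrArg (M.α 1) h).symm)
    have hd' : ¬ M.α 3 (M.α 3 d) = M.α 3 d := by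
      rw [M.invol]
      exact Ne.symm hd
    rw [Finset.sum_insert, Finset.sum_insert, Finset.sum_insert, Finset.sum_singleton,
      if_neg hd, if_neg (mt (hα1 d).1 hd), if_neg hd', if_neg (mt (hα1 _).1 hd')]
    · norm_num
    · simpa using (h1 _).symm
    · simpa using ⟨h13 d hd, h4⟩
    · simpa using ⟨(h1 d).symm, Ne.symm hd, h3⟩

/-- A boundary edge has two ends, and each end carries the first and the last flag of its fan. -/
theorem IsCellular.card_bdry_flags [Finite D] (hM : M.IsCellular) :
    Nat.card {d // M.α 3 d = d} = 4 * Nat.card M.BdryEdge := by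
  classical
  have := Fintype.ofFinite {d // M.α 3 d = d}
  have := Fintype.ofFinite M.BdryEdge
  let f : {d // M.α 3 d = d} → M.BdryEdge := fun d => ⟨M.cell 1 d, d, rfl, d.2⟩
  rw [← sum_eq_mul_card_of_fiber f (fun _ => 1)]
  · simp
  rintro ⟨_, d, rfl, hd⟩
  let b : {d // M.α 3 d = d} := ⟨d, hd⟩
  let a : {d // M.α 3 d = d} → {d // M.α 3 d = d} := fun y =>
    ⟨M.α 0 y, (M.α_three_α_zero_iff _).2 y.2⟩
  let t : {d // M.α 3 d = d} → {d // M.α 3 d = d} := fun y => ⟨M.bdryTurn y, M.α_bdryTurn y.2⟩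
  have hfa : ∀ y, f (a y) = f y := fun y => Subtype.ext (M.cell_α (by decide) _)
  have hft : ∀ y, f (t y) = f y := fun y =>
    Subtype.ext (M.cell_one_eq_of_orbit (M.orbit_bdryTurn y))
  have hfib : (Finset.univ.filter fun x => f x = f b) = {b, a b, t b, a (t b)} := by
    ext x
    simp only [Finset.mem_filter, Finset.mem_univ, true_and, Finset.mem_insert,
      Finset.mem_singleton]
    constructor
    · intro h
      rcases M.bdry_flags_of_cell_one_eq hd x.2 (congrArg Subtype.val h).symm with h | h | h | h
      · exact .inl (Subtype.ext h)
      · exact .inr (.inl (Subtype.ext h))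
      · exact .inr (.inr (.inl (Subtype.ext h)))
      · exact .inr (.inr (.inr (Subtype.ext h)))
    · rintro (rfl | rfl | rfl | rfl) <;> simp only [hfa, hft]
  have ha : ∀ y, a y ≠ y := fun y h => hM.ends_ne (y : D) (by
    rw [show M.α 0 (y : D) = y from congrArg Subtype.val h])
  have ht : ∀ y, t y ≠ y := fun y h => M.bdryTurn_ne y.2 (congrArg Subtype.val h)
  have hat : ∀ y, a y ≠ t y := fun y h => hM.ends_ne (y : D) (by
    rw [show M.α 0 (y : D) = M.bdryTurn y from congrArg Subtype.val h, M.orbit_bdryTurn])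
  have haa : ∀ y, a (a y) = y := fun y => Subtype.ext (M.invol _ _)
  have h3 : b ≠ a (t b) := fun h => hat b (by rw [congrArg a h, haa])
  have h4 : a b ≠ a (t b) := fun h => ht b (by
    simpa only [haa] using (congrArg a h).symm)
  change ∑ x with f x = f b, 1 = 4
  rw [hfib, Finset.sum_const, smul_eq_mul, mul_one]
  rw [Finset.card_insert_of_notMem, Finset.card_insert_of_notMem, Finset.card_insert_of_notMem,
    Finset.card_singleton]
  · simpa using (ha _).symm
  · simpa using ⟨hat b, h4⟩
  · simpa using ⟨(ha b).symm, (ht b).symm, h3⟩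

theorem IsCellular.card_orbit_two_three [Finite D] (hM : M.IsCellular) :
    Nat.card (M.Orbit {2, 3}) = 2 * Nat.card (M.Cell 1) := by
  classical
  have := Fintype.ofFinite (M.Orbit {2, 3})
  have := Fintype.ofFinite (M.Cell 1)
  choose r hr using M.orbit_surjective {2, 3}
  have hcell : ∀ d, M.cell 1 (r (M.orbit {2, 3} d)) = M.cell 1 d := fun d =>
    M.cell_one_eq_of_orbit (hr _)
  rw [← sum_eq_mul_card_of_fiber (fun x => M.cell 1 (r x)) (fun _ => 1)]
  · simp
  intro y
  obtain ⟨d, rfl⟩ := M.orbit_surjective _ y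
  have hfib : (Finset.univ.filter fun x => M.cell 1 (r x) = M.cell 1 d) =
      {M.orbit {2, 3} d, M.orbit {2, 3} (M.α 0 d)} := by
    ext x
    obtain ⟨d', rfl⟩ := M.orbit_surjective _ x
    simp only [Finset.mem_filter, Finset.mem_univ, true_and, Finset.mem_insert,
      Finset.mem_singleton, hcell]
    refine ⟨fun h => M.orbit_eq_or_of_cell_one_eq h.symm, ?_⟩
    rintro (h | h)
    · exact M.cell_one_eq_of_orbit h
    · rw [M.cell_one_eq_of_orbit h, M.cell_α (by decide)]
  change ∑ x with M.cell 1 (r x) = M.cell 1 d, 1 = 2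
  rw [hfib, Finset.sum_pair (hM.ends_ne d).symm]

theorem IsCellular.card_orbit_zero_one [Finite D] (hM : M.IsCellular) :
    Nat.card (M.Orbit {0, 1}) + Nat.card M.BdryFace = 2 * Nat.card (M.Cell 2) := by
  classical
  have := Fintype.ofFinite (M.Orbit {0, 1})
  have := Fintype.ofFinite (M.Cell 2)
  choose r hr using M.orbit_surjective {0, 1}
  have hcell : ∀ d, M.cell 2 (r (M.orbit {0, 1} d)) = M.cell 2 d := fun d =>
    M.cell_two_eq_of_orbit (hr _)
  have h1 : ∀ y : M.Cell 2, ∑ x with M.cell 2 (r x) = y, 1 = if M.IsBdry 2 y then 1 else 2 := by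
    intro y
    obtain ⟨d, rfl⟩ := M.orbit_surjective _ y
    have hfib : (Finset.univ.filter fun x => M.cell 2 (r x) = M.cell 2 d) =
        {M.orbit {0, 1} d, M.orbit {0, 1} (M.α 3 d)} := by
      ext x
      obtain ⟨d', rfl⟩ := M.orbit_surjective _ x
      simp only [Finset.mem_filter, Finset.mem_univ, true_and, Finset.mem_insert,
        Finset.mem_singleton, hcell]
      refine ⟨fun h => M.orbit_eq_or_of_cell_two_eq h.symm, ?_⟩
      rintro (h | h)
      · exact M.cell_two_eq_of_orbit h
      · rw [M.cell_two_eq_of_orbit h, M.cell_α (by decide)]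
    change ∑ x with M.cell 2 (r x) = M.cell 2 d, 1 = if M.IsBdry 2 (M.cell 2 d) then 1 else 2
    rw [hfib]
    by_cases hd : M.α 3 d = d
    · rw [if_pos (M.isBdry_two_iff.2 hd), hd]
      simp
    · rw [if_neg (mt M.isBdry_two_iff.1 hd), Finset.sum_pair (hM.sides_ne d hd).symm]
  have h2 : Nat.card (M.Orbit {0, 1}) = ∑ y : M.Cell 2, if M.IsBdry 2 y then 1 else 2 := by
    rw [← Finset.sum_congr rfl fun y _ => h1 y]
    have := Finset.sum_fiberwise Finset.univ (fun x => M.cell 2 (r x)) (fun _ => 1)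
    rw [this]
    simp
  have h3 : Nat.card M.BdryFace = ∑ y : M.Cell 2, if M.IsBdry 2 y then 1 else 0 := by
    rw [Nat.card_eq_fintype_card, Fintype.card_subtype, Finset.card_filter]
  rw [h2, h3, ← Finset.sum_add_distrib]
  rw [Finset.sum_congr rfl (g := fun _ => 2)]
  · simp [mul_comm]
  · intro y _
    split_ifs <;> rfl

/-- The Euler characteristics of the bulk and of the boundary. -/
theorem IsCellular.euler [Finite D] (hM : M.IsCellular) :
    2 * ((Nat.card (M.Cell 3) : ℤ) - Nat.card {f : M.Cell 2 // ¬ M.IsBdry 2 f} +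
      Nat.card M.BulkEdge - Nat.card {v : M.Cell 0 // ¬ M.IsBdry 0 v}) =
    Nat.card {v : M.Cell 0 // M.IsBdry 0 v} - Nat.card M.BdryEdge + Nat.card M.BdryFace := by
  classical
  have := Fintype.ofFinite (M.Cell 3)
  have := Fintype.ofFinite (M.Cell 0)
  -- The sphere relation summed over the 3-cells, to be compared with the bubble relations summed
  -- over the vertices. In the difference the `{1, 2}`-orbits cancel, and the remaining orbits are
  -- counted by edges, faces and boundary edges.
  have h3 : (Nat.card (M.Orbit {1, 2}) : ℤ) - Nat.card (M.Orbit {0, 2}) +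
      Nat.card (M.Orbit {0, 1}) = 2 * Nat.card (M.Cell 3) := by
    rw [← M.sum_numOrbitsIn (i := 3) (S := {1, 2}) (by rintro j (rfl | rfl) <;> simp),
      ← M.sum_numOrbitsIn (i := 3) (S := {0, 2}) (by rintro j (rfl | rfl) <;> simp),
      ← M.sum_numOrbitsIn (i := 3) (S := {0, 1}) (by rintro j (rfl | rfl) <;> simp),
      ← Finset.sum_sub_distrib, ← Finset.sum_add_distrib,
      Finset.sum_congr rfl fun x _ => hM.cell_sphere x]
    simp [mul_comm]
  have h0 : (Nat.card (M.Orbit {2, 3}) : ℤ) - Nat.card (M.Orbit {1, 3}) +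
      Nat.card (M.Orbit {1, 2}) + Nat.card {v : M.Cell 0 // M.IsBdry 0 v} =
      2 * Nat.card (M.Cell 0) := by
    rw [← M.sum_numOrbitsIn (i := 0) (S := {1, 2}) (by rintro j (rfl | rfl) <;> simp),
      ← M.sum_numOrbitsIn (i := 0) (S := {1, 3}) (by rintro j (rfl | rfl) <;> simp),
      ← M.sum_numOrbitsIn (i := 0) (S := {2, 3}) (by rintro j (rfl | rfl) <;> simp),
      ← Finset.sum_sub_distrib, ← Finset.sum_add_distrib]
    have h : (Nat.card {v : M.Cell 0 // M.IsBdry 0 v} : ℤ) =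
        ∑ v : M.Cell 0, if M.IsBdry 0 v then 1 else 0 := by
      rw [Nat.card_eq_fintype_card, Fintype.card_subtype, Finset.card_filter]
      push_cast
      rfl
    rw [h, ← Finset.sum_add_distrib, Finset.sum_congr rfl (g := fun _ => (2 : ℤ))]
    · simp [mul_comm]
    · intro v _
      by_cases hv : M.IsBdry 0 v
      · rw [if_pos hv, hM.bdry_bubble v hv]
        rfl
      · rw [if_neg hv, hM.bulk_bubble v hv]
        rfl
  have h4 := hM.card_orbit_zero_two
  have h5 := hM.card_orbit_one_three
  have h6 := hM.card_bdry_flags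
  have h7 := hM.card_orbit_two_three
  have h8 := hM.card_orbit_zero_one
  have h9 := card_eq_add_card_not (M.IsBdry 0)
  have h10 : Nat.card (M.Cell 1) = Nat.card M.BdryEdge + Nat.card M.BulkEdge :=
    card_eq_add_card_not (M.IsBdry 1)
  have h11 : Nat.card (M.Cell 2) = Nat.card M.BdryFace + Nat.card {f : M.Cell 2 // ¬ M.IsBdry 2 f} :=
    card_eq_add_card_not (M.IsBdry 2)
  omega

end FlagComplex

/-! ### Gauge fixing -/

namespace FlagComplex

variable {D : Type*} {M : FlagComplex D} {G H : Type*} [Group G] [Group H]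

namespace Framing

variable (o : M.Framing)

/-- The connection with transports `g` along the oriented dual edges. -/
def conn (g : M.Cell 2 → G) : M.Connection G where
  x d := if o.out d then g (M.cell 2 d) else (g (M.cell 2 d))⁻¹
  x_α0 d := by rw [o.out_α0, M.cell_α (by decide)]
  x_α1 d := by rw [o.out_α1, M.cell_α (by decide)]
  x_α3 d h := by
    rw [o.out_α3 d h, M.cell_α (by decide)]
    cases o.out d <;> simp

theorem cross_eq (g : M.Cell 2 → SU2) (d : D) : o.cross g d = (o.conn g).x d := rfl

theorem path_eq (g : M.Cell 2 → SU2) (d : D) (m : ℕ) : o.path g d m = (o.conn g).path d m := by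
  induction m with
  | zero => rfl
  | succ m ih => rw [path, ih, cross_eq, Connection.path]

/-- The holonomy of a connection around a bulk edge. -/
noncomputable def hol (c : M.Connection G) (e : M.BulkEdge) : G :=
  c.path (o.base e.1) (Function.minimalPeriod M.turn (o.base e.1))

theorem bulkHolonomy_eq (g : M.Cell 2 → SU2) (e : M.BulkEdge) :
    o.bulkHolonomy g e = o.hol (o.conn g) e := o.path_eq _ _ _

theorem conn_map (φ : G →* H) (g : M.Cell 2 → G) (d : D) :
    (o.conn fun f => φ (g f)).x d = φ ((o.conn g).x d) := by
  simp only [conn]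
  split_ifs
  · rfl
  · rw [map_inv]

theorem hol_map (φ : G →* H) (g : M.Cell 2 → G) (e : M.BulkEdge) :
    o.hol (o.conn fun f => φ (g f)) e = φ (o.hol (o.conn g) e) := by
  have h : ∀ d m, (o.conn fun f => φ (g f)).path d m = φ ((o.conn g).path d m) := by
    intro d m
    induction m with
    | zero => exact (map_one φ).symm
    | succ m ih => rw [Connection.path, ih, conn_map, Connection.path, map_mul]
  exact h _ _

theorem α_three_turn_base_ne {e : M.BulkEdge} (m : ℕ) :
    M.α 3 (M.turn^[m] (o.base e.1)) ≠ M.turn^[m] (o.base e.1) := fun h =>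
  e.2 ⟨_, (M.cell_one_eq_of_orbit (M.orbit_turn_iterate _ m)).trans (o.cell_base e.1), h⟩

theorem cell_three_turn (d : D) : M.cell 3 (M.turn d) = M.cell 3 (M.α 3 d) :=
  M.cell_α (by decide) _

/-- A connection on a ball which is flat off a maximal tree is trivial. -/
theorem exists_section [Finite D] (hM : M.IsBallDecomposition) {T : Set M.BulkEdge}
    (hT : M.IsMaximalTree T) (g : M.Cell 2 → G)
    (h : ∀ e : M.BulkEdge, e ∉ T → o.hol (o.conn g) e = 1) :
    ∃ K : D → G, (∀ i d, i ≠ 3 → K (M.α i d) = K d) ∧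
      ∀ d, M.α 3 d ≠ d → K (M.α 3 d) = (o.conn g).x d * K d := by
  refine hM.exists_section fun i d => Connection.hasSection_cell hM.toIsCellular hT ?_ i d
  intro d hd hdT
  have h1 := Connection.hasSection_of_path_eq_one (c := o.conn g) (o.base (M.cell 1 d))
    (by rwa [o.cell_base]) (h ⟨M.cell 1 d, hd⟩ hdT)
  exact h1.of_cell_one_eq (o.cell_base _)

end Framing

/-! ### Spanning trees of the dual graph and words in the remaining faces -/

variable (M) in
/-- A spanning tree of the dual graph: the dart of a 3-cell leads to its parent. -/
structure DualTree where
  root : M.Cell 3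
  dart : M.Cell 3 → D
  rank : M.Cell 3 → ℕ
  cell_dart : ∀ x, x ≠ root → M.cell 3 (dart x) = x
  rank_lt : ∀ x, x ≠ root → rank (M.cell 3 (M.α 3 (dart x))) < rank x

theorem IsBallDecomposition.nonempty_dualTree (hM : M.IsBallDecomposition) (d₀ : D) :
    Nonempty M.DualTree := by
  classical
  let r : M.Cell 3 → M.Cell 3 → Prop := fun x x' =>
    ∃ d, M.cell 3 d = x ∧ M.cell 3 (M.α 3 d) = x'
  obtain ⟨ρ, hρ⟩ := exists_rank r {M.cell 3 d₀} fun x => by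
    obtain ⟨d, rfl⟩ := M.orbit_surjective _ x
    refine ⟨_, rfl, ?_⟩
    refine hM.connected (fun d => Relation.ReflTransGen r (M.cell 3 d) (M.cell 3 d₀)) ?_
      (d := d₀) .refl
    intro i d h
    by_cases hi : i = 3
    · subst hi
      exact h.head ⟨M.α 3 d, rfl, by rw [M.invol]⟩
    · rwa [M.cell_α hi]
  have h2 : ∀ x, ∃ d, x ≠ M.cell 3 d₀ → M.cell 3 d = x ∧ ρ (M.cell 3 (M.α 3 d)) < ρ x := by
    intro x
    by_cases hx : x = M.cell 3 d₀
    · exact ⟨d₀, fun h => absurd hx h⟩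
    · obtain ⟨x', ⟨d, h1, h2⟩, hlt⟩ := hρ x hx
      exact ⟨d, fun _ => ⟨h1, h2 ▸ hlt⟩⟩
  choose q hq using h2
  exact ⟨⟨M.cell 3 d₀, q, ρ, fun x hx => (hq x hx).1, fun x hx => (hq x hx).2⟩⟩

namespace DualTree

variable (t : M.DualTree)

/-- The bulk faces which are not crossed by the tree. -/
abbrev Coface : Type _ :=
  {f : M.Cell 2 // ¬ M.IsBdry 2 f ∧ ∀ x, x ≠ t.root → M.cell 2 (t.dart x) ≠ f}

theorem α_dart_ne {x : M.Cell 3} (hx : x ≠ t.root) : M.α 3 (t.dart x) ≠ t.dart x := by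
  intro h
  have := t.rank_lt x hx
  rw [h, t.cell_dart x hx] at this
  exact lt_irrefl _ this

theorem cell_dart_injOn : Set.InjOn (fun x => M.cell 2 (t.dart x)) {t.root}ᶜ := by
  intro x hx x' hx' h
  have h1 := t.rank_lt x hx
  have h2 := t.rank_lt x' hx'
  have aux : M.orbit {0, 1} (t.dart x') = M.orbit {0, 1} (t.dart x) → x = x' := fun h => by
    rw [← t.cell_dart x hx, ← t.cell_dart x' hx', M.cell_three_eq_of_orbit h]
  rcases M.orbit_eq_or_of_cell_two_eq h with h3 | h3
  · exact aux h3
  · rcases M.orbit_eq_or_of_cell_two_eq h.symm with h4 | h4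
    · exact aux h4.symm
    · have h5 := M.cell_three_eq_of_orbit h3
      have h6 := M.cell_three_eq_of_orbit h4
      rw [t.cell_dart x' hx'] at h5
      rw [t.cell_dart x hx] at h6
      rw [← h5] at h1
      rw [← h6] at h2
      omega

/-- Each 3-cell other than the root removes one bulk face, namely the one towards its parent. -/
theorem card_coface [Finite D] :
    Nat.card t.Coface + Nat.card (M.Cell 3) = Nat.card {f : M.Cell 2 // ¬ M.IsBdry 2 f} + 1 := by
  classical
  have h1 : Nat.card t.Coface + (({t.root}ᶜ : Set (M.Cell 3))).ncard =
      Nat.card {f : M.Cell 2 // ¬ M.IsBdry 2 f} := by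
    rw [← t.cell_dart_injOn.ncard_image]
    change Nat.card {f : M.Cell 2 | ¬ M.IsBdry 2 f ∧ ∀ x, x ≠ t.root → M.cell 2 (t.dart x) ≠ f} +
      _ = Nat.card {f : M.Cell 2 | ¬ M.IsBdry 2 f}
    rw [Nat.card_coe_set_eq, Nat.card_coe_set_eq, ← Set.ncard_union_eq]
    · congr 1
      ext f
      simp only [Set.mem_union, Set.mem_image]
      constructor
      · rintro (h | ⟨x, hx, rfl⟩)
        · exact h.1
        · exact mt M.isBdry_two_iff.1 (t.α_dart_ne hx)
      · intro hf
        by_cases h : ∀ x, x ≠ t.root → M.cell 2 (t.dart x) ≠ f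
        · exact .inl ⟨hf, h⟩
        · push Not at h
          obtain ⟨x, hx, h⟩ := h
          exact .inr ⟨x, hx, h⟩
    · rw [Set.disjoint_left]
      rintro _ ⟨-, h⟩ ⟨x, hx, rfl⟩
      exact h x hx rfl
  have h2 := Set.ncard_add_ncard_compl {t.root}
  rw [Set.ncard_singleton] at h2
  omega

/-- Off a maximal tree there are no more edges than faces off a dual spanning tree. -/
theorem card_edges_le [Finite D] (o : M.Framing) (hM : M.IsCellular)
    (hΓ : o.ConnectedBoundaryGraph) (hne : ∃ d, M.α 3 d = d) {T : Set M.BulkEdge}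
    (hT : M.IsMaximalTree T) : Nat.card {e : M.BulkEdge // e ∉ T} ≤ Nat.card t.Coface := by
  -- The edges off `T` number bulk edges minus bulk vertices. By `euler` this is bulk faces minus
  -- 3-cells plus half the Euler characteristic of the boundary; the last term is at most one.
  have h1 := t.card_coface
  have h2 := hM.euler
  have h3 := card_bdry_le o hΓ hne
  have h4 := card_eq_add_card_not (fun e : M.BulkEdge => e ∈ T)
  have h5 := hT.card_eq
  have h6 : T.ncard = Nat.card {e : M.BulkEdge // e ∈ T} := rfl
  omega

open Classical in
/-- The face variables with prescribed values off the cofaces. -/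
noncomputable def ext (u : M.Cell 2 → G) (y : t.Coface → G) (f : M.Cell 2) : G :=
  if h : _ then y ⟨f, h⟩ else u f

theorem ext_coface {G : Type*} (u : M.Cell 2 → G) (y : t.Coface → G) (f : t.Coface) : t.ext u y f = y f :=
  dif_pos f.2

theorem ext_of_not {G : Type*} (u : M.Cell 2 → G) (y : t.Coface → G) {f : M.Cell 2}
    (h : ¬ (¬ M.IsBdry 2 f ∧ ∀ x, x ≠ t.root → M.cell 2 (t.dart x) ≠ f)) : t.ext u y f = u f :=
  dif_neg h

/-- The holonomy around a bulk edge as a word in the faces off the tree. -/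
noncomputable def word (o : M.Framing) (e : M.BulkEdge) : FreeGroup t.Coface :=
  o.hol (o.conn (t.ext 1 FreeGroup.of)) e

theorem lift_word (o : M.Framing) (e : M.BulkEdge) (y : t.Coface → G) :
    FreeGroup.lift y (t.word o e) = o.hol (o.conn (t.ext 1 y)) e := by
  rw [word, ← o.hol_map]
  congr 2
  ext f
  by_cases h : ¬ M.IsBdry 2 f ∧ ∀ x, x ≠ t.root → M.cell 2 (t.dart x) ≠ f
  · have h1 := t.ext_coface 1 FreeGroup.of ⟨f, h⟩
    have h2 := t.ext_coface 1 y ⟨f, h⟩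
    dsimp only at h1 h2
    rw [h1, h2, FreeGroup.lift_apply_of]
  · rw [t.ext_of_not _ _ h, t.ext_of_not _ _ h]
    exact map_one _

/-- The equations make the connection flat off `T`, hence trivial with a section `K`. The dual tree
carries transports `1` and reaches every 3-cell, so `K` is constant and every transport is `1`. The
group is arbitrary; both `SU(2)` and the groups `ℤ/p` are needed. -/
theorem eq_one_of_lift_word [Finite D] (o : M.Framing) (hM : M.IsBallDecomposition)
    {T : Set M.BulkEdge} (hT : M.IsMaximalTree T) (y : t.Coface → G)
    (h : ∀ e : M.BulkEdge, e ∉ T → FreeGroup.lift y (t.word o e) = 1) : y = 1 := by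
  obtain ⟨K, hK, hK3⟩ := o.exists_section hM hT (t.ext 1 y) fun e he => by
    rw [← t.lift_word, h e he]
  have hcell : ∀ d d', M.cell 3 d = M.cell 3 d' → K d = K d' := by
    intro d d' hd
    exact orbit_ind (fun z => K d = K z) (fun j hj z hz => by rw [hK j z hj, hz]) hd rfl
  have hx : ∀ x, x ≠ t.root → (o.conn (t.ext 1 y)).x (t.dart x) = 1 := by
    intro x hx
    simp only [Framing.conn]
    rw [t.ext_of_not]
    · simp
    · exact fun h => h.2 x hx rfl
  obtain ⟨d₀, hd₀⟩ := M.orbit_surjective _ t.root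
  have hconst : ∀ n d, t.rank (M.cell 3 d) = n → K d = K d₀ := by
    intro n
    induction n using Nat.strong_induction_on with
    | _ n ih =>
      rintro d rfl
      by_cases hd : M.cell 3 d = t.root
      · exact hcell _ _ (hd.trans hd₀.symm)
      · rw [hcell d _ (t.cell_dart _ hd).symm, ← ih _ (t.rank_lt _ hd) _ rfl,
          hK3 _ (t.α_dart_ne hd), hx _ hd, one_mul]
  ext1 f
  obtain ⟨d, hd⟩ := M.orbit_surjective _ f.1
  have hd3 : M.α 3 d ≠ d := fun h3 => f.2.1 ⟨d, hd, h3⟩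
  have h1 := hK3 d hd3
  rw [hconst _ (M.α 3 d) rfl, hconst _ d rfl, eq_comm, mul_eq_right] at h1
  have h2 : t.ext 1 y (M.cell 2 d) = y f := by
    rw [show M.cell 2 d = f.1 from hd, t.ext_coface]
  simp only [Framing.conn, h2] at h1
  split_ifs at h1
  · exact h1
  · exact inv_eq_one.1 h1

/-- Gauge fixing along the tree. -/
theorem exists_gauge (o : M.Framing) (u : M.Cell 2 → G) :
    ∃ (a b : t.Coface → G) (k : M.BulkEdge → G), ∀ (y : t.Coface → G) (e : M.BulkEdge),
      o.hol (o.conn (t.ext u y)) e =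
        k e * FreeGroup.lift (fun f => a f * y f * b f) (t.word o e) * (k e)⁻¹ := by
  classical
  -- `κ` is the gauge transformation on the 3-cells, built outwards from the root, which brings the
  -- transports along the dual tree to `1`.
  obtain ⟨κ, -, hκ⟩ := exists_eq_mul_of_rank t.rank {t.root}
    (fun x => M.cell 3 (M.α 3 (t.dart x))) t.rank_lt fun x => ((o.conn u).x (t.dart x))⁻¹
  have hflag : ∀ f : t.Coface, ∃ d, M.cell 2 d = f ∧ o.out d = true := by
    intro f
    obtain ⟨d, hd⟩ := M.orbit_surjective _ f.1
    by_cases h : o.out d = true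
    · exact ⟨d, hd, h⟩
    · refine ⟨M.α 3 d, (M.cell_α (by decide) d).trans hd, ?_⟩
      rw [o.out_α3 d fun h3 => f.2.1 ⟨d, hd, h3⟩]
      simpa using h
  choose df hdf hout using hflag
  refine ⟨fun f => (κ (M.cell 3 (M.α 3 (df f))))⁻¹, fun f => κ (M.cell 3 (df f)),
    fun e => κ (M.cell 3 (o.base e.1)), fun y e => ?_⟩
  set y' : t.Coface → G := fun f =>
    (κ (M.cell 3 (M.α 3 (df f))))⁻¹ * y f * κ (M.cell 3 (df f)) with hy'
  -- The transformation law has to be checked at one flag of each face only: on the other side both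
  -- transports are inverted.
  have hside : ∀ d d', M.cell 2 d = M.cell 2 d' → M.α 3 d ≠ d →
      (o.conn (t.ext 1 y')).x d =
        (κ (M.cell 3 (M.α 3 d)))⁻¹ * (o.conn (t.ext u y)).x d * κ (M.cell 3 d) →
      (o.conn (t.ext 1 y')).x d' =
        (κ (M.cell 3 (M.α 3 d')))⁻¹ * (o.conn (t.ext u y)).x d' * κ (M.cell 3 d') := by
    intro d d' hd h3 hx
    have h01 : ∀ (c : M.Connection G) z z', M.orbit {0, 1} z = M.orbit {0, 1} z' →
        c.x z = c.x z' := fun c z z' hz => orbit_ind (fun w => c.x z = c.x w) (by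
      rintro _ (rfl | rfl) w hw
      · rw [c.x_α0, hw]
      · rw [c.x_α1, hw]) hz rfl
    rcases M.orbit_eq_or_of_cell_two_eq hd with h | h
    · rw [h01 _ _ _ h, h01 _ _ _ h, M.cell_three_eq_of_orbit h,
        M.cell_three_eq_of_orbit (M.orbit_α_of_comm M.comm3 h), hx]
    · have h' := M.orbit_α_of_comm M.comm3 h
      rw [M.invol] at h'
      rw [h01 _ _ _ h, h01 _ _ _ h, M.cell_three_eq_of_orbit h, M.cell_three_eq_of_orbit h',
        eq_inv_of_mul_eq_one_left ((o.conn (t.ext 1 y')).x_α3 d h3),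
        eq_inv_of_mul_eq_one_left ((o.conn (t.ext u y)).x_α3 d h3), hx]
      group
  have hgauge : ∀ d, M.α 3 d ≠ d → (o.conn (t.ext 1 y')).x d =
      (κ (M.cell 3 (M.α 3 d)))⁻¹ * (o.conn (t.ext u y)).x d * κ (M.cell 3 d) := by
    intro d hd
    by_cases hf : ¬ M.IsBdry 2 (M.cell 2 d) ∧ ∀ x, x ≠ t.root → M.cell 2 (t.dart x) ≠ M.cell 2 d
    · set f : t.Coface := ⟨M.cell 2 d, hf⟩ with hfd
      refine hside (df f) d (hdf f) (fun h3 => f.2.1 ⟨_, hdf f, h3⟩) ?_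
      simp only [Framing.conn, hout, if_true, hdf, ext_coface, hy']
    · have : ∃ x, x ≠ t.root ∧ M.cell 2 (t.dart x) = M.cell 2 d := by
        by_contra hcon
        push Not at hcon
        exact hf ⟨mt M.isBdry_two_iff.1 hd, hcon⟩
      obtain ⟨x, hx, hxd⟩ := this
      refine hside _ d hxd (t.α_dart_ne hx) ?_
      have hnot : ¬ (¬ M.IsBdry 2 (M.cell 2 (t.dart x)) ∧
          ∀ x', x' ≠ t.root → M.cell 2 (t.dart x') ≠ M.cell 2 (t.dart x)) :=
        fun h => h.2 x hx rfl
      have h1 : (o.conn (t.ext u y)).x (t.dart x) = (o.conn u).x (t.dart x) := by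
        simp only [Framing.conn, t.ext_of_not u y hnot]
      have h2 : (o.conn (t.ext 1 y')).x (t.dart x) = 1 := by
        simp [Framing.conn, t.ext_of_not 1 y' hnot]
      rw [h1, h2, t.cell_dart x hx, hκ x hx]
      group
  rw [t.lift_word]
  have hpath : ∀ m, (o.conn (t.ext 1 y')).path (o.base e.1) m =
      (κ (M.cell 3 (M.turn^[m] (o.base e.1))))⁻¹ * (o.conn (t.ext u y)).path (o.base e.1) m *
        κ (M.cell 3 (o.base e.1)) := by
    intro m
    induction m with
    | zero => simp [Connection.path]
    | succ m ih =>
      rw [Connection.path, ih, hgauge _ (o.α_three_turn_base_ne m), Connection.path,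
        Function.iterate_succ_apply', Framing.cell_three_turn]
      group
  -- After a full turn both ends lie in the 3-cell of the base flag, so gauge fixing acts by
  -- conjugation.
  have := hpath (Function.minimalPeriod M.turn (o.base e.1))
  rw [Function.iterate_minimalPeriod] at this
  rw [Framing.hol, Framing.hol, this]
  group

end DualTree

end FlagComplex

/-! ### `SU(2)` as the group of unit quaternions -/

namespace SU2

open Quaternion

instance instSecondCountableTopology : SecondCountableTopology SU2 := by
  have : SecondCountableTopology (Matrix (Fin 2) (Fin 2) ℂ) :=
    inferInstanceAs (SecondCountableTopology (Fin 2 → Fin 2 → ℂ))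
  exact Topology.IsEmbedding.subtypeVal.secondCountableTopology

instance instIsProbabilityMeasureHaar : IsProbabilityMeasure haar :=
  ⟨Measure.haarMeasure_self (K₀ := ⊤)⟩

instance instIsHaarMeasureHaar : haar.IsHaarMeasure := by
  unfold haar
  infer_instance

/-- The complex matrix of a quaternion. -/
def ofQuaternion : ℍ[ℝ] →+* Matrix (Fin 2) (Fin 2) ℂ where
  toFun q := !![⟨q.re, q.imI⟩, ⟨q.imJ, q.imK⟩; ⟨-q.imJ, q.imK⟩, ⟨q.re, -q.imI⟩]
  map_one' := by
    ext i j
    fin_cases i <;> fin_cases j <;> simp [Complex.ext_iff]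
  map_zero' := by
    ext i j
    fin_cases i <;> fin_cases j <;> simp [Complex.ext_iff]
  map_add' x y := by
    ext i j
    fin_cases i <;> fin_cases j <;> simp [Complex.ext_iff] <;> ring
  map_mul' x y := by
    ext i j
    fin_cases i <;> fin_cases j <;>
      simp [Matrix.mul_apply, Fin.sum_univ_two, Complex.ext_iff] <;> constructor <;> ring

theorem ofQuaternion_injective : Function.Injective ofQuaternion := ofQuaternion.injective

theorem star_ofQuaternion (q : ℍ[ℝ]) : star (ofQuaternion q) = ofQuaternion (star q) := by
  ext i j
  fin_cases i <;> fin_cases j <;> simp [ofQuaternion, Complex.ext_iff]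

theorem continuous_ofQuaternion : Continuous ofQuaternion := by
  refine continuous_matrix fun i j => ?_
  have h : ∀ f g : ℍ[ℝ] → ℝ, Continuous f → Continuous g →
      Continuous fun q => (⟨f q, g q⟩ : ℂ) := fun f g hf hg =>
    Complex.equivRealProdCLM.symm.continuous.comp (hf.prodMk hg)
  fin_cases i <;> fin_cases j
  · exact h _ _ continuous_re continuous_imI
  · exact h _ _ continuous_imJ continuous_imK
  · exact h _ _ continuous_imJ.neg continuous_imK
  · exact h _ _ continuous_re continuous_imI.neg

theorem ofQuaternion_mem {q : ℍ[ℝ]} (hq : ‖q‖ = 1) :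
    ofQuaternion q ∈ Matrix.specialUnitaryGroup (Fin 2) ℂ := by
  have h1 : normSq q = 1 := by rw [normSq_eq_norm_mul_self, hq, mul_one]
  rw [Matrix.mem_specialUnitaryGroup_iff, Matrix.mem_unitaryGroup_iff]
  constructor
  · rw [star_ofQuaternion, ← map_mul, self_mul_star, h1]
    exact map_one _
  · rw [normSq_def'] at h1
    simp only [ofQuaternion, RingHom.coe_mk, MonoidHom.coe_mk, OneHom.coe_mk,
      Matrix.det_fin_two_of, Complex.ext_iff]
    constructor
    · simp
      linarith
    · simp
      ring

/-- The unit quaternion of an element of `SU(2)`. -/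
def toQuaternion (A : SU2) : ℍ[ℝ] := ⟨(A.1 0 0).re, (A.1 0 0).im, (A.1 0 1).re, (A.1 0 1).im⟩

theorem ofQuaternion_toQuaternion (A : SU2) : ofQuaternion (toQuaternion A) = A.1 := by
  obtain ⟨h1, h2⟩ := Matrix.mem_specialUnitaryGroup_iff.1 A.2
  rw [Matrix.mem_unitaryGroup_iff'] at h1
  have h3 : star A.1 = A.1.adjugate := by
    have h4 : A.1 * A.1.adjugate = 1 := by rw [Matrix.mul_adjugate, h2, one_smul]
    calc star A.1 = star A.1 * (A.1 * A.1.adjugate) := by rw [h4, mul_one]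
      _ = A.1.adjugate := by rw [← mul_assoc, h1, one_mul]
  rw [Matrix.adjugate_fin_two] at h3
  have h00 := congrFun (congrFun h3 0) 0
  have h01 := congrFun (congrFun h3 1) 0
  simp [Complex.ext_iff] at h00 h01
  ext i j
  fin_cases i <;> fin_cases j <;> simp [ofQuaternion, toQuaternion, Complex.ext_iff] <;>
    constructor <;> linarith

theorem norm_toQuaternion (A : SU2) : ‖toQuaternion A‖ = 1 := by
  have h1 := (Matrix.mem_specialUnitaryGroup_iff.1 A.2).1
  rw [Matrix.mem_unitaryGroup_iff, ← ofQuaternion_toQuaternion, star_ofQuaternion, ← map_mul,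
    self_mul_star] at h1
  have h2 := ofQuaternion_injective (h1.trans (map_one _).symm)
  have h3 : normSq (toQuaternion A) = 1 := Quaternion.coe_injective (h2.trans coe_one.symm)
  rw [normSq_eq_norm_mul_self] at h3
  nlinarith [norm_nonneg (toQuaternion A)]

theorem toQuaternion_ne_zero (A : SU2) : toQuaternion A ≠ 0 := fun h => by
  have := norm_toQuaternion A
  rw [h, norm_zero] at this
  exact zero_ne_one this

theorem toQuaternion_mul (A B : SU2) : toQuaternion (A * B) = toQuaternion A * toQuaternion B :=
  ofQuaternion_injective (by
    rw [map_mul, ofQuaternion_toQuaternion, ofQuaternion_toQuaternion, ofQuaternion_toQuaternion]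
    rfl)

theorem toQuaternion_one : toQuaternion 1 = 1 :=
  ofQuaternion_injective (by
    rw [map_one, ofQuaternion_toQuaternion]
    rfl)

theorem toQuaternion_inv (A : SU2) : toQuaternion A⁻¹ = (toQuaternion A)⁻¹ :=
  eq_inv_of_mul_eq_one_left (by rw [← toQuaternion_mul, inv_mul_cancel, toQuaternion_one])

theorem toQuaternion_injective : Function.Injective toQuaternion := fun A B h =>
  Subtype.ext (by rw [← ofQuaternion_toQuaternion, h, ofQuaternion_toQuaternion])

theorem continuous_toQuaternion : Continuous toQuaternion := by
  have h : Continuous fun A : SU2 => linearIsometryEquivTuple.symm (WithLp.toLp 2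
      ![(A.1 0 0).re, (A.1 0 0).im, (A.1 0 1).re, (A.1 0 1).im]) := by
    refine linearIsometryEquivTuple.symm.continuous.comp
      ((PiLp.continuous_toLp 2 _).comp (continuous_pi fun i => ?_))
    have h1 : ∀ i j, Continuous fun A : SU2 => A.1 i j := fun i j =>
      continuous_subtype_val.matrix_elem i j
    fin_cases i
    · exact Complex.continuous_re.comp (h1 0 0)
    · exact Complex.continuous_im.comp (h1 0 0)
    · exact Complex.continuous_re.comp (h1 0 1)
    · exact Complex.continuous_im.comp (h1 0 1)
  exact h

open Classical in
/-- The radial projection from the quaternions to `SU(2)`. -/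
noncomputable def proj (x : ℍ[ℝ]) : SU2 :=
  if h : x = 0 then 1 else ⟨ofQuaternion (‖x‖⁻¹ • x), ofQuaternion_mem (by
    rw [norm_smul, norm_inv, norm_norm, inv_mul_cancel₀ (norm_ne_zero_iff.2 h)])⟩

theorem toQuaternion_proj {x : ℍ[ℝ]} (hx : x ≠ 0) : toQuaternion (proj x) = ‖x‖⁻¹ • x :=
  ofQuaternion_injective (by rw [ofQuaternion_toQuaternion, proj, dif_neg hx])

theorem proj_eq_iff {x : ℍ[ℝ]} (hx : x ≠ 0) {A : SU2} :
    proj x = A ↔ ‖x‖⁻¹ • x = toQuaternion A := by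
  rw [← toQuaternion_proj hx]
  exact ⟨fun h => by rw [h], fun h => toQuaternion_injective h⟩

theorem proj_smul_toQuaternion {r : ℝ} (hr : 0 < r) (A : SU2) : proj (r • toQuaternion A) = A := by
  rw [proj_eq_iff (smul_ne_zero hr.ne' (toQuaternion_ne_zero A)), norm_smul, norm_toQuaternion,
    mul_one, Real.norm_of_nonneg hr.le, smul_smul, inv_mul_cancel₀ hr.ne', one_smul]

theorem proj_toQuaternion_mul (A : SU2) {x : ℍ[ℝ]} (hx : x ≠ 0) :
    proj (toQuaternion A * x) = A * proj x := by
  rw [proj_eq_iff (mul_ne_zero (toQuaternion_ne_zero A) hx), toQuaternion_mul,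
    toQuaternion_proj hx, norm_mul, norm_toQuaternion, one_mul, mul_smul_comm]

theorem continuousOn_proj : ContinuousOn proj {0}ᶜ := by
  rw [continuousOn_iff_continuous_domRestrict]
  refine Continuous.congr (f := fun x : ({0}ᶜ : Set ℍ[ℝ]) =>
    (⟨ofQuaternion (‖x.1‖⁻¹ • x.1), ofQuaternion_mem (by
      rw [norm_smul, norm_inv, norm_norm, inv_mul_cancel₀ (norm_ne_zero_iff.2 x.2)])⟩ : SU2)) ?_
    fun x => ?_
  · refine Continuous.subtype_mk (continuous_ofQuaternion.comp ?_) _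
    exact (continuous_subtype_val.norm.inv₀ fun x => norm_ne_zero_iff.2 x.2).smul
      continuous_subtype_val
  · have hx : x.1 ≠ 0 := x.2
    simp only [Set.domRestrict_apply, proj, hx, dite_false]

theorem proj_one : proj 1 = 1 := by
  have := proj_smul_toQuaternion one_pos 1
  rwa [one_smul, toQuaternion_one] at this

/-! ### The Haar measure as a radial projection of the Lebesgue measure -/

noncomputable instance instMeasurableSpaceQuaternion : MeasurableSpace ℍ[ℝ] := borel _

instance instBorelSpaceQuaternion : BorelSpace ℍ[ℝ] := ⟨rfl⟩

theorem measurable_proj : Measurable proj :=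
  measurable_of_continuousOn_compl_singleton 0 continuousOn_proj

/-- A spherical shell. -/
def shell (r : ℝ) : Set ℍ[ℝ] := {x | 1 - r < ‖x‖ ∧ ‖x‖ < 1 + r}

theorem isOpen_shell (r : ℝ) : IsOpen (shell r) :=
  (isOpen_lt continuous_const continuous_norm).inter (isOpen_lt continuous_norm continuous_const)

theorem ne_zero_of_mem_shell {r : ℝ} (hr : r < 1) {x : ℍ[ℝ]} (hx : x ∈ shell r) : x ≠ 0 :=
  norm_pos_iff.1 (by linarith [hx.1])

theorem volume_shell_ne_zero {r : ℝ} (hr : 0 < r) : volume (shell r) ≠ 0 :=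
  ((isOpen_shell r).measure_pos _ ⟨1, by
    constructor <;> rw [norm_one] <;> linarith⟩).ne'

theorem volume_shell_ne_top (r : ℝ) : volume (shell r) ≠ ⊤ := by
  refine ((measure_mono ?_).trans_lt (measure_ball_lt_top (x := (0 : ℍ[ℝ])) (r := 1 + r))).ne
  intro x hx
  rw [mem_ball_zero_iff]
  exact hx.2

/-- Left multiplication by a unit quaternion is a linear isometry that preserves the shell, so the
push-forward of Lebesgue measure under `proj` is left invariant; uniqueness of the Haar measure does
the rest. -/
theorem volume_inter_proj {r : ℝ} (hr1 : r < 1) {B : Set SU2} (hB : MeasurableSet B) :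
    volume (shell r ∩ proj ⁻¹' B) = volume (shell r) * haar B := by
  let ν : Measure SU2 := (volume.restrict (shell r)).map proj
  have hν : ∀ {B : Set SU2}, MeasurableSet B → ν B = volume (shell r ∩ proj ⁻¹' B) := by
    intro B hB
    rw [Measure.map_apply measurable_proj hB, Measure.restrict_apply (measurable_proj hB),
      Set.inter_comm]
  have hfin : IsFiniteMeasure ν := ⟨by
    rw [hν MeasurableSet.univ, Set.preimage_univ, Set.inter_univ]
    exact (volume_shell_ne_top r).lt_top⟩
  have hinv : ν.IsMulLeftInvariant := by
    refine ⟨fun g => ?_⟩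
    ext B hB
    rw [Measure.map_apply (measurable_const_mul g) hB, hν hB, hν (measurable_const_mul g hB)]
    let L : ℍ[ℝ] →ₗᵢ[ℝ] ℍ[ℝ] :=
      ⟨LinearMap.mulLeft ℝ (toQuaternion g), fun x => by
        rw [LinearMap.mulLeft_apply, norm_mul, norm_toQuaternion, one_mul]⟩
    have hL := (L.toLinearIsometryEquiv rfl).measurePreserving
    have hLx : ∀ x, (L.toLinearIsometryEquiv rfl) x = toQuaternion g * x := fun x => rfl
    rw [← hL.measure_preimage
      (((isOpen_shell r).measurableSet.inter (measurable_proj hB)).nullMeasurableSet)]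
    congr 1
    ext x
    have hmem : (toQuaternion g * x) ∈ shell r ↔ x ∈ shell r := by
      simp only [shell, Set.mem_ofPred_eq, norm_mul, norm_toQuaternion, one_mul]
    simp only [Set.mem_inter_iff, Set.mem_preimage, hLx, hmem]
    refine and_congr_right fun hx => ?_
    rw [proj_toQuaternion_mul g (ne_zero_of_mem_shell hr1 hx)]
  have h1 := Measure.haarMeasure_unique ν ⊤
  rw [← hν hB, h1, Measure.smul_apply, smul_eq_mul, hν (by exact MeasurableSet.univ)]
  congr 2
  simp

/-- The product version. -/
theorem volume_pi_inter_proj {Y : Type*} [Fintype Y] {r : ℝ} (hr : 0 < r) (hr1 : r < 1)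
    {B : Set (Y → SU2)} (hB : MeasurableSet B) :
    volume {x : Y → ℍ[ℝ] | (∀ i, x i ∈ shell r) ∧ (fun i => proj (x i)) ∈ B} =
      volume (shell r) ^ Fintype.card Y * Measure.pi (fun _ => haar) B := by
  have hP : Measurable fun (x : Y → ℍ[ℝ]) i => proj (x i) :=
    measurable_pi_lambda _ fun i => measurable_proj.comp (measurable_pi_apply i)
  have hS : MeasurableSet (Set.univ.pi fun _ : Y => shell r) :=
    MeasurableSet.univ_pi fun _ => (isOpen_shell r).measurableSet
  let κ := volume (shell r) ^ Fintype.card Y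
  have hκ0 : κ ≠ 0 := pow_ne_zero _ (volume_shell_ne_zero hr)
  have hκ : κ ≠ ⊤ := ENNReal.pow_ne_top (volume_shell_ne_top r)
  have hpi : Measure.pi (fun _ : Y => haar) =
      κ⁻¹ • (volume.restrict (Set.univ.pi fun _ : Y => shell r)).map fun x i => proj (x i) := by
    refine Measure.pi_eq fun s hs => ?_
    rw [Measure.smul_apply, Measure.map_apply hP (MeasurableSet.univ_pi hs),
      Measure.restrict_apply (hP (MeasurableSet.univ_pi hs))]
    have h1 : (fun (x : Y → ℍ[ℝ]) i => proj (x i)) ⁻¹' Set.univ.pi s ∩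
        (Set.univ.pi fun _ : Y => shell r) = Set.univ.pi fun i => shell r ∩ proj ⁻¹' s i := by
      ext x
      simp only [Set.mem_inter_iff, Set.mem_preimage, Set.mem_univ_pi]
      exact ⟨fun h i => ⟨h.2 i, h.1 i⟩, fun h => ⟨fun i => (h i).2, fun i => (h i).1⟩⟩
    rw [h1, volume_pi_pi, Finset.prod_congr rfl fun i _ => volume_inter_proj hr1 (hs i),
      Finset.prod_mul_distrib, Finset.prod_const, Finset.card_univ, smul_eq_mul, ← mul_assoc,
      ENNReal.inv_mul_cancel hκ0 hκ, one_mul]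
  rw [hpi, Measure.smul_apply, smul_eq_mul, ← mul_assoc, ENNReal.mul_inv_cancel hκ0 hκ, one_mul,
    Measure.map_apply hP hB, Measure.restrict_apply (hP hB)]
  congr 1
  ext x
  simp only [Set.mem_inter_iff, Set.mem_preimage, Set.mem_univ_pi]
  exact and_comm

end SU2

/-! ### Words in the free group -/

namespace FreeGroup

section Exponents

variable {Y : Type*} [DecidableEq Y]

/-- The exponent sums of a word. -/
def exponents (w : FreeGroup Y) : Y → ℤ :=
  Multiplicative.toAdd (lift (fun f => Multiplicative.ofAdd (Pi.single f (1 : ℤ))) w)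

theorem exponents_mul (w w' : FreeGroup Y) :
    exponents (w * w') = exponents w + exponents w' := by
  simp [exponents]

theorem exponents_inv (w : FreeGroup Y) : exponents w⁻¹ = -exponents w := by
  simp [exponents]

theorem exponents_one : exponents (1 : FreeGroup Y) = 0 := by
  simp [exponents]

theorem exponents_of (f : Y) : exponents (of f) = Pi.single f 1 := by
  simp [exponents]

theorem lift_ofAdd [Fintype Y] {A : Type*} [AddCommGroup A] (z : Y → A) (w : FreeGroup Y) :
    lift (fun f => Multiplicative.ofAdd (z f)) w =
      Multiplicative.ofAdd (∑ f, exponents w f • z f) := by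
  induction w using FreeGroup.induction_on with
  | C1 => simp [exponents_one]
  | of f =>
    change lift (fun f => Multiplicative.ofAdd (z f)) (of f) =
      Multiplicative.ofAdd (∑ f', exponents (of f) f' • z f')
    simp [exponents_of, Pi.single_apply]
  | inv_of f ih =>
    rw [_root_.map_inv, ih, exponents_inv, ← ofAdd_neg, ← Finset.sum_neg_distrib]
    congr 1
    exact Finset.sum_congr rfl fun i _ => (neg_smul _ _).symm
  | mul x y hx hy =>
    rw [_root_.map_mul, hx, hy, exponents_mul, ← ofAdd_add, ← Finset.sum_add_distrib]
    simp [add_smul]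

/-- The matrix of exponent sums of a family of words which, in every abelian group, has only the
trivial solution, is unimodular. -/
theorem natAbs_det_exponents [Fintype Y] (w : Y → FreeGroup Y)
    (h : ∀ p : ℕ, p.Prime → ∀ y : Y → Multiplicative (ZMod p), (∀ r, lift y (w r) = 1) → y = 1) :
    (Matrix.of fun r => exponents (w r)).det.natAbs = 1 := by
  by_contra hne
  obtain ⟨p, hp, hdvd⟩ := Nat.exists_prime_and_dvd hne
  have : Fact p.Prime := ⟨hp⟩
  -- If a prime `p` divided the determinant, a kernel vector modulo `p` would be a nontrivial
  -- solution in `ℤ/p`.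
  have h1 : ((Matrix.of fun r => exponents (w r)).map (Int.castRingHom (ZMod p))).det = 0 := by
    rw [← RingHom.mapMatrix_apply, ← RingHom.map_det, eq_intCast,
      ZMod.intCast_zmod_eq_zero_iff_dvd]
    exact Int.natCast_dvd.2 hdvd
  obtain ⟨z, hz, hz0⟩ := Matrix.exists_mulVec_eq_zero_iff.2 h1
  refine hz (funext fun f => ?_)
  have h2 := h p hp (fun f => Multiplicative.ofAdd (z f)) fun r => by
    rw [lift_ofAdd, ← ofAdd_zero, ← show _ = (0 : ZMod p) from congrFun hz0 r]
    simp [Matrix.mulVec, dotProduct]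
  exact congrFun h2 f

end Exponents

/-- If a family of words has only the trivial solution in every abelian group, then there are at
least as many words as unknowns. -/
theorem card_le_of_words {Y R : Type*} [Fintype Y] [Fintype R] (w : R → FreeGroup Y)
    (h : ∀ p : ℕ, p.Prime → ∀ y : Y → Multiplicative (ZMod p), (∀ r, lift y (w r) = 1) → y = 1) :
    Fintype.card Y ≤ Fintype.card R := by
  classical
  have : Fact (Nat.Prime 2) := ⟨Nat.prime_two⟩
  let A : Matrix R Y (ZMod 2) :=
    (Matrix.of fun r => exponents (w r)).map (Int.castRingHom (ZMod 2))
  have hinj : Function.Injective A.toLin' := by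
    refine (injective_iff_map_eq_zero _).2 fun z hz => funext fun f => ?_
    have h2 := h 2 Nat.prime_two (fun f => Multiplicative.ofAdd (z f)) fun r => by
      rw [lift_ofAdd, ← ofAdd_zero, ← show _ = (0 : ZMod 2) from congrFun hz r]
      simp [A, Matrix.mulVec, dotProduct]
    exact congrFun h2 f
  simpa using LinearMap.finrank_le_finrank_of_injective hinj

end FreeGroup

/-! ### Word maps on quaternions and their derivative at the identity -/

namespace SU2

open Quaternion

variable {Y : Type*} [Fintype Y]

/-- The projections of families of quaternions. -/
noncomputable abbrev coord (i : Y) : (Y → ℍ[ℝ]) →L[ℝ] ℍ[ℝ] := ContinuousLinearMap.proj i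

theorem lift_one_word {Y G : Type*} [Group G] (w : FreeGroup Y) :
    FreeGroup.lift (1 : Y → G) w = 1 := by
  have : FreeGroup.lift (1 : Y → G) = 1 := FreeGroup.ext_hom _ _ fun f => by simp
  rw [this, MonoidHom.one_apply]

theorem apply_one_of_extends_word {Y : Type*} {w : FreeGroup Y} {φ : (Y → ℍ[ℝ]) → ℍ[ℝ]}
    (hφ : ∀ g : Y → SU2, φ (fun i => toQuaternion (g i)) = toQuaternion (FreeGroup.lift g w)) :
    φ 1 = 1 := by
  have h1 := hφ 1
  rw [lift_one_word, toQuaternion_one] at h1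
  rw [← h1]
  congr 1

/-- A word in `SU(2)` extends to a function of quaternions which is strictly differentiable at the
identity. -/
theorem exists_hasStrictFDerivAt_word [DecidableEq Y] (w : FreeGroup Y) :
    ∃ φ : (Y → ℍ[ℝ]) → ℍ[ℝ],
      (∀ g : Y → SU2, φ (fun i => toQuaternion (g i)) = toQuaternion (FreeGroup.lift g w)) ∧
      HasStrictFDerivAt φ (∑ f, (FreeGroup.exponents w f : ℝ) •
        (ContinuousLinearMap.proj f : (Y → ℍ[ℝ]) →L[ℝ] ℍ[ℝ])) 1 := by
  -- All factors equal `1` at the base point, so products add derivatives, inverses negate them, and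
  -- only the exponent sums survive.
  induction w using FreeGroup.induction_on with
  | C1 =>
    refine ⟨fun _ => 1, fun g => by rw [map_one, toQuaternion_one], ?_⟩
    refine (hasStrictFDerivAt_const _ _).congr_fderiv ?_
    ext1 v
    simp [FreeGroup.exponents_one]
  | of f =>
    refine ⟨fun x => x f, fun g => by
      rw [FreeGroup.lift_apply_of], ?_⟩
    refine (coord f).hasStrictFDerivAt.congr_fderiv ?_
    ext1 v
    change v f = (∑ f', (FreeGroup.exponents (FreeGroup.of f) f' : ℝ) • coord f') v
    rw [sum_apply, Finset.sum_eq_single f]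
    · simp [FreeGroup.exponents_of]
    · intro f' _ hf'
      simp [FreeGroup.exponents_of, hf']
    · simp
  | inv_of f ih =>
    obtain ⟨φ, h1, h2⟩ := ih
    refine ⟨fun x => (φ x)⁻¹, fun g => by
      beta_reduce
      rw [h1, map_inv, toQuaternion_inv], ?_⟩
    have h3 := (hasStrictFDerivAt_inv' (𝕜 := ℝ) (x := φ 1)
      (by rw [apply_one_of_extends_word h1]; exact one_ne_zero)).comp 1 h2
    refine h3.congr_fderiv ?_
    rw [apply_one_of_extends_word h1, FreeGroup.exponents_inv]
    ext1 v
    simp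
  | mul x y hx hy =>
    obtain ⟨φ, h1, h2⟩ := hx
    obtain ⟨φ', h1', h2'⟩ := hy
    refine ⟨φ * φ', fun g => by rw [Pi.mul_apply, h1, h1', map_mul, toQuaternion_mul], ?_⟩
    refine (h2.mul' h2').congr_fderiv ?_
    rw [apply_one_of_extends_word h1, apply_one_of_extends_word h1', FreeGroup.exponents_mul]
    ext1 v
    simp [add_smul, Finset.sum_add_distrib, add_comm]

/-- The real part as a continuous linear map. -/
noncomputable def reL : ℍ[ℝ] →L[ℝ] ℝ := innerSL ℝ (1 : ℍ[ℝ])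

theorem reL_apply (q : ℍ[ℝ]) : reL q = q.re := by
  simp [reL, Quaternion.inner_def]

theorem hasStrictFDerivAt_norm_one : HasStrictFDerivAt (fun x : ℍ[ℝ] => ‖x‖) reL 1 := by
  have h := (hasStrictFDerivAt_norm_sq (1 : ℍ[ℝ])).sqrt (by simp)
  have h2 : (fun x : ℍ[ℝ] => √(‖x‖ ^ 2)) = fun x => ‖x‖ := by
    ext x
    exact Real.sqrt_sq (norm_nonneg x)
  rw [h2] at h
  refine h.congr_fderiv ?_
  ext1 v
  simp [reL]

/-- The linear map which is the identity on real parts and the matrix `A` on imaginary parts. -/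
noncomputable def imMatrix (A : Matrix Y Y ℝ) : (Y → ℍ[ℝ]) →L[ℝ] (Y → ℍ[ℝ]) :=
  ContinuousLinearMap.pi fun i => (reL.comp (coord i)).smulRight 1 +
    ∑ f, A i f • (coord f - (reL.comp (coord f)).smulRight (1 : ℍ[ℝ]))

theorem imMatrix_apply (A : Matrix Y Y ℝ) (v : Y → ℍ[ℝ]) (i : Y) :
    imMatrix A v i = (v i).re • (1 : ℍ[ℝ]) + ∑ f, A i f • (v f - (v f).re • (1 : ℍ[ℝ])) := by
  simp [imMatrix, reL_apply]

/-- Families of quaternions in coordinates. -/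
def coords : (Y → ℍ[ℝ]) ≃ₗ[ℝ] (Fin 4 → Y → ℝ) where
  toFun x c i := ![(x i).re, (x i).imI, (x i).imJ, (x i).imK] c
  invFun z i := ⟨z 0 i, z 1 i, z 2 i, z 3 i⟩
  map_add' x y := by
    ext c i
    fin_cases c <;> simp
  map_smul' r x := by
    ext c i
    fin_cases c <;> simp
  left_inv x := rfl
  right_inv z := by
    ext c i
    fin_cases c <;> rfl

/-- In coordinates the map is block diagonal: the identity on real parts and one copy of `A` for
each of the three imaginary units. -/
theorem det_imMatrix [DecidableEq Y] (A : Matrix Y Y ℝ) : (imMatrix A).det = A.det ^ 3 := by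
  rw [ContinuousLinearMap.det, ← LinearMap.det_conj _ coords]
  have h : (coords (Y := Y) : _ →ₗ[ℝ] _) ∘ₗ (imMatrix A : (Y → ℍ[ℝ]) →ₗ[ℝ] (Y → ℍ[ℝ])) ∘ₗ
      ((coords (Y := Y)).symm : _ →ₗ[ℝ] (Y → ℍ[ℝ])) = LinearMap.pi fun c =>
        (![LinearMap.id, A.toLin', A.toLin', A.toLin'] c) ∘ₗ LinearMap.proj c := by
    refine LinearMap.ext fun z => ?_
    obtain ⟨x, rfl⟩ := coords.surjective z
    ext c i
    simp only [LinearMap.comp_apply, LinearEquiv.coe_coe, LinearEquiv.symm_apply_apply,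
      ContinuousLinearMap.coe_coe, LinearMap.pi_apply, LinearMap.proj_apply]
    have hre : (∑ f, A i f • (x f - (x f).re • (1 : ℍ[ℝ]))).re = 0 := by
      rw [← reL_apply, map_sum]
      simp [reL_apply]
    have hproj : ∀ p : ℍ[ℝ] →ₗ[ℝ] ℝ, p 1 = 0 →
        p (imMatrix A x i) = ∑ f, A i f * p (x f) := by
      intro p hp
      rw [imMatrix_apply, map_add, map_smul, hp, map_sum]
      simp [hp]
    fin_cases c
    · change (imMatrix A x i).re = (x i).re
      rw [imMatrix_apply, Quaternion.re_add, hre]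
      simp
    · exact hproj ⟨⟨fun q => q.imI, fun _ _ => rfl⟩, fun _ _ => by simp⟩ rfl
    · exact hproj ⟨⟨fun q => q.imJ, fun _ _ => rfl⟩, fun _ _ => by simp⟩ rfl
    · exact hproj ⟨⟨fun q => q.imK, fun _ _ => rfl⟩, fun _ _ => by simp⟩ rfl
  rw [h, LinearMap.det_pi, Fin.prod_univ_four]
  simp [pow_succ]

/-- The extension to quaternions of a map given by words, which preserves the norms. -/
theorem exists_radial_extension [DecidableEq Y] (w : Y → FreeGroup Y) :
    ∃ Ψ : (Y → ℍ[ℝ]) → (Y → ℍ[ℝ]), Ψ 1 = 1 ∧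
      (∀ x : Y → ℍ[ℝ], (∀ i, x i ≠ 0) → ∀ i, Ψ x i =
        ‖x i‖ • toQuaternion (FreeGroup.lift (fun i => proj (x i)) (w i))) ∧
      HasStrictFDerivAt Ψ (imMatrix ((Matrix.of fun r => FreeGroup.exponents (w r)).map
        (Int.castRingHom ℝ))) 1 := by
  choose φ hφ hφ' using fun i => exists_hasStrictFDerivAt_word (w i)
  have hval : ∀ x : Y → ℍ[ℝ], (∀ i, x i ≠ 0) → ∀ i,
      ‖x i‖ • φ i (fun f => ‖x f‖⁻¹ • x f) =
        ‖x i‖ • toQuaternion (FreeGroup.lift (fun i => proj (x i)) (w i)) := by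
    intro x hx i
    rw [← hφ]
    congr 3
    ext1 f
    rw [toQuaternion_proj (hx f)]
  have hone : (fun f : Y => ‖(1 : Y → ℍ[ℝ]) f‖⁻¹ • (1 : Y → ℍ[ℝ]) f) = 1 := by
    ext1 f
    simp
  have hφ1 : ∀ i, φ i 1 = 1 := fun i => apply_one_of_extends_word (hφ i)
  refine ⟨fun x i => ‖x i‖ • φ i (fun f => ‖x f‖⁻¹ • x f), ?_, hval, ?_⟩
  · ext1 i
    beta_reduce
    rw [hone, hφ1]
    simp
  · rw [hasStrictFDerivAt_pi']
    intro i
    have hn : ∀ f : Y, HasStrictFDerivAt (fun x : Y → ℍ[ℝ] => ‖x f‖)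
        (reL.comp (coord f)) 1 := fun f =>
      HasStrictFDerivAt.comp (g := fun q : ℍ[ℝ] => ‖q‖) (f := fun x : Y → ℍ[ℝ] => x f) 1
        hasStrictFDerivAt_norm_one
        (coord f).hasStrictFDerivAt
    -- Normalisation has derivative at `1` the projection onto imaginary parts; real parts are
    -- restored by the factor `‖x i‖`.
    have hq : HasStrictFDerivAt (fun (x : Y → ℍ[ℝ]) f => ‖x f‖⁻¹ • x f)
        (ContinuousLinearMap.pi fun f => coord f -
          (reL.comp (coord f)).smulRight (1 : ℍ[ℝ])) 1 := by
      rw [hasStrictFDerivAt_pi']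
      intro f
      have h1 : HasStrictFDerivAt (fun x : Y → ℍ[ℝ] => ‖x f‖⁻¹) _ 1 :=
        HasStrictFDerivAt.comp (g := fun r : ℝ => r⁻¹) (f := fun x : Y → ℍ[ℝ] => ‖x f‖) 1
          (hasStrictFDerivAt_inv' (𝕜 := ℝ) (by simp)) (hn f)
      refine (h1.smul
        (coord f).hasStrictFDerivAt).congr_fderiv ?_
      ext1 v
      simp [sub_eq_add_neg]
    have h2 := hφ' i
    rw [← hone] at h2
    have h3 := HasStrictFDerivAt.comp (g := φ i) (1 : Y → ℍ[ℝ]) h2 hq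
    refine ((hn i).smul h3).congr_fderiv ?_
    ext1 v
    simp only [hone, hφ1]
    simp [imMatrix_apply, reL_apply, add_comm]

end SU2

/-! ### Products of regularised `δ`-functions of words -/

namespace SU2

open Quaternion

section Square

theorem continuous_lift_word {Y : Type*} (w : FreeGroup Y) :
    Continuous fun y : Y → SU2 => FreeGroup.lift y w := by
  induction w using FreeGroup.induction_on with
  | C1 => simpa using continuous_const
  | of f => simpa using continuous_apply f
  | inv_of f ih =>
    simp only [_root_.map_inv]
    exact ih.inv
  | mul x y hx hy =>
    simp only [_root_.map_mul]
    exact hx.mul hy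

/-- A continuous map on a compact space which takes the value `b` only at `a` takes values near `b`
only near `a`. -/
theorem exists_nhds_preimage_subset {X Z : Type*} [TopologicalSpace X] [CompactSpace X]
    [TopologicalSpace Z] [T2Space Z] {W : X → Z} (hW : Continuous W) {b : Z} {O : Set X}
    (hO : IsOpen O) (h : ∀ x, W x = b → x ∈ O) : ∃ U ∈ 𝓝 b, W ⁻¹' U ⊆ O := by
  have hc : IsClosed (W '' Oᶜ) := (hO.isClosed_compl.isCompact.image hW).isClosed
  refine ⟨(W '' Oᶜ)ᶜ, hc.isOpen_compl.mem_nhds ?_, fun x hx => ?_⟩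
  · rintro ⟨x, hx, hxb⟩
    exact hx (h x hxb)
  · by_contra hxO
    exact hx ⟨x, hxO, rfl⟩

variable {Y : Type*} [Fintype Y] [DecidableEq Y]

/-- A family of words with unimodular matrix of exponents and only the trivial solution almost
preserves the Haar measure of sets near the identity. -/
theorem exists_nhds_measure_preimage_word (w : Y → FreeGroup Y)
    (hdet : (Matrix.of fun r => FreeGroup.exponents (w r)).det.natAbs = 1)
    (hinj : ∀ y : Y → SU2, (∀ i, FreeGroup.lift y (w i) = 1) → y = 1) {c : NNReal} (hc : 1 < c) :
    ∃ U ∈ 𝓝 (1 : Y → SU2), ∀ B ⊆ U, MeasurableSet B →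
      Measure.pi (fun _ : Y => haar) ((fun y i => FreeGroup.lift y (w i)) ⁻¹' B) ≤
          c * Measure.pi (fun _ : Y => haar) B ∧
        Measure.pi (fun _ : Y => haar) B ≤
          c * Measure.pi (fun _ : Y => haar) ((fun y i => FreeGroup.lift y (w i)) ⁻¹' B) := by
  set W : (Y → SU2) → (Y → SU2) := fun y i => FreeGroup.lift y (w i) with hWdef
  have hWc : Continuous W := continuous_pi fun i => continuous_lift_word (w i)
  obtain ⟨Ψ, hΨ1, hΨ, hΨ'⟩ := exists_radial_extension w
  set L := imMatrix ((Matrix.of fun r => FreeGroup.exponents (w r)).map (Int.castRingHom ℝ))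
  have hLdet : |L.det| = 1 := by
    rw [det_imMatrix, ← RingHom.mapMatrix_apply, ← RingHom.map_det, abs_pow, eq_intCast,
      ← Int.cast_abs, Int.abs_eq_natAbs, hdet]
    simp
  have hsurj : L.range = ⊤ := by
    have hu : IsUnit (LinearMap.det (L : (Y → ℍ[ℝ]) →ₗ[ℝ] (Y → ℍ[ℝ]))) :=
      isUnit_iff_ne_zero.2 fun h0 => by
        rw [ContinuousLinearMap.det, h0, abs_zero] at hLdet
        exact zero_ne_one hLdet
    exact LinearEquiv.range (LinearEquiv.ofIsUnitDet
      (f := (L : (Y → ℍ[ℝ]) →ₗ[ℝ] (Y → ℍ[ℝ]))) (v := Module.finBasis ℝ _)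
      (v' := Module.finBasis ℝ _) (by rwa [LinearMap.det_toMatrix]))
  have hc0 : c ≠ 0 := (zero_lt_one.trans hc).ne'
  -- As `|L.det| = 1`, a map that is close enough to `L` distorts volumes by a factor between `c⁻¹`
  -- and `c`; strict differentiability makes `Ψ` such a map near `1`.
  obtain ⟨η, ⟨hη1, hη2⟩, hη⟩ := (((addHaar_image_le_mul_of_det_lt volume L (m := c) (by
      rw [hLdet, ENNReal.ofReal_one]; exact_mod_cast hc)).and
    (mul_le_addHaar_image_of_lt_det volume L (m := c⁻¹) (by
      rw [hLdet, ENNReal.ofReal_one]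
      exact_mod_cast inv_lt_one_of_one_lt₀ hc))).and self_mem_nhdsWithin).exists
  obtain ⟨s, hs, happ⟩ := hΨ'.approximates_deriv_on_nhds (Or.inr hη)
  -- a thin polar neighbourhood of `1` inside `s`
  have hpolar : ContinuousAt (fun p : (Y → ℝ) × (Y → SU2) => fun i => p.1 i • toQuaternion (p.2 i))
      (1, 1) := by
    refine Continuous.continuousAt (continuous_pi fun i => ?_)
    exact ((continuous_apply i).comp continuous_fst).smul
      (continuous_toQuaternion.comp ((continuous_apply i).comp continuous_snd))
  have hpolar1 : (fun p : (Y → ℝ) × (Y → SU2) => fun i => p.1 i • toQuaternion (p.2 i)) (1, 1) =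
      1 := by
    ext1 i
    simp [toQuaternion_one]
  have hs' := hpolar (show s ∈ 𝓝 _ by rw [hpolar1]; exact hs)
  rw [mem_map, nhds_prod_eq] at hs'
  obtain ⟨A, hA, O', hO', hAO⟩ := mem_prod_iff.1 hs'
  obtain ⟨r₀, hr₀, hrA⟩ := Metric.mem_nhds_iff.1 hA
  obtain ⟨O, hOO', hO, hO1⟩ := mem_nhds_iff.1 hO'
  obtain ⟨r, hr, hr'⟩ := exists_between (lt_min hr₀ one_pos)
  have hr1 : r < 1 := hr'.trans_le (min_le_right _ _)
  let S : Set (Y → SU2) → Set (Y → ℍ[ℝ]) := fun B =>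
    {x | (∀ i, x i ∈ shell r) ∧ (fun i => proj (x i)) ∈ B}
  have hSs : S O ⊆ s := by
    rintro x ⟨hx, hxO⟩
    have h1 : (fun i => ‖x i‖) ∈ A := by
      refine hrA (Metric.mem_ball.2 (lt_of_le_of_lt ?_ (hr'.trans_le (min_le_left _ _))))
      refine (dist_pi_le_iff hr.le).2 fun i => ?_
      rw [Real.dist_eq, abs_le]
      have := hx i
      simp only [shell, Set.mem_ofPred_eq] at this
      simp only [Pi.one_apply]
      constructor <;> linarith
    have h2 := hAO (Set.mk_mem_prod h1 (hOO' hxO))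
    have h3 : (fun i => ‖x i‖ • toQuaternion (proj (x i))) = x := by
      ext1 i
      have h0 := ne_zero_of_mem_shell hr1 (hx i)
      rw [toQuaternion_proj h0, smul_smul, mul_inv_cancel₀ (norm_ne_zero_iff.2 h0), one_smul]
    simpa only [Set.mem_preimage, h3] using h2
  -- images of polar sets
  have himage : ∀ B, W ⁻¹' B ⊆ O → B ⊆ W '' O → Ψ '' S (W ⁻¹' B) = S B := by
    intro B hB hBO
    ext z
    constructor
    · rintro ⟨x, ⟨hx, hxB⟩, rfl⟩
      have h0 : ∀ i, x i ≠ 0 := fun i => ne_zero_of_mem_shell hr1 (hx i)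
      refine ⟨fun i => ?_, ?_⟩
      · rw [hΨ x h0 i]
        have := hx i
        simp only [shell, Set.mem_ofPred_eq] at this ⊢
        rwa [norm_smul, norm_toQuaternion, mul_one, norm_norm]
      · have h1 : (fun i => proj (Ψ x i)) = W fun i => proj (x i) := by
          ext1 i
          rw [hΨ x h0 i, proj_smul_toQuaternion (norm_pos_iff.2 (h0 i))]
        rw [h1]
        exact hxB
    · rintro ⟨hz, hzB⟩
      obtain ⟨y, -, hy⟩ := hBO hzB
      have h0 : ∀ i, z i ≠ 0 := fun i => ne_zero_of_mem_shell hr1 (hz i)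
      have hnorm : ∀ i, ‖‖z i‖ • toQuaternion (y i)‖ = ‖z i‖ := fun i => by
        rw [norm_smul, norm_toQuaternion, mul_one, norm_norm]
      have hproj : (fun i => proj (‖z i‖ • toQuaternion (y i))) = y := by
        ext1 i
        rw [proj_smul_toQuaternion (norm_pos_iff.2 (h0 i))]
      refine ⟨fun i => ‖z i‖ • toQuaternion (y i), ⟨fun i => ?_, ?_⟩, ?_⟩
      · have := hz i
        simp only [shell, Set.mem_ofPred_eq] at this ⊢
        rwa [hnorm]
      · rw [hproj, Set.mem_preimage, hy]
        exact hzB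
      · ext1 i
        rw [hΨ _ (fun i => by rw [← norm_ne_zero_iff, hnorm]; exact norm_ne_zero_iff.2 (h0 i)) i,
          hnorm, hproj, show FreeGroup.lift y (w i) = proj (z i) from congrFun hy i,
          toQuaternion_proj (h0 i), smul_smul, mul_inv_cancel₀ (norm_ne_zero_iff.2 (h0 i)),
          one_smul]
  -- the image of `O` is a neighbourhood of `1`
  have hWO : W '' O ∈ 𝓝 1 := by
    have hN : {x : Y → ℍ[ℝ] | (∀ i, x i ≠ 0) ∧ (fun i => proj (x i)) ∈ O} ∈ 𝓝 1 := by
      refine inter_mem (eventually_all.2 fun i => ?_) ?_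
      · exact (continuous_apply i).continuousAt.eventually_ne one_ne_zero
      · have : ContinuousAt (fun (x : Y → ℍ[ℝ]) i => proj (x i)) 1 := by
          refine continuousAt_pi.2 fun i => ContinuousAt.comp (g := proj) ?_
            (continuous_apply i).continuousAt
          exact continuousOn_proj.continuousAt (isOpen_compl_singleton.mem_nhds one_ne_zero)
        refine this (hO.mem_nhds ?_)
        convert hO1 using 1
        ext1 i
        exact proj_one
    have hN' := image_mem_map (m := Ψ) hN
    rw [hΨ'.map_nhds_eq_of_surj hsurj, hΨ1] at hN'
    have hq : ContinuousAt (fun (y : Y → SU2) i => toQuaternion (y i)) 1 :=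
      (continuous_pi fun i => continuous_toQuaternion.comp (continuous_apply i)).continuousAt
    have hq1 : (fun (y : Y → SU2) i => toQuaternion (y i)) 1 = 1 := by
      ext1 i
      simp [toQuaternion_one]
    refine mem_of_superset (hq (hq1 ▸ hN' : _ ∈ 𝓝 _)) ?_
    rintro y ⟨x, ⟨hx, hxO⟩, hxy⟩
    refine ⟨_, hxO, funext fun i => ?_⟩
    have h1 := congrFun hxy i
    rw [hΨ x hx i] at h1
    rw [← proj_smul_toQuaternion (norm_pos_iff.2 (hx i)) (W _ i)]
    change proj (‖x i‖ • toQuaternion (FreeGroup.lift _ (w i))) = _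
    rw [h1]
    simpa using proj_smul_toQuaternion one_pos (y i)
  -- The only global input: `1` has no preimage but `1`, so by compactness preimages of small sets
  -- stay inside `O`.
  obtain ⟨U, hU, hUO⟩ := exists_nhds_preimage_subset hWc hO (b := (1 : Y → SU2)) fun y hy => by
    rw [hinj y fun i => congrFun hy i]
    exact hO1
  refine ⟨U ∩ W '' O, inter_mem hU hWO, fun B hB hBm => ?_⟩
  have hBO : W ⁻¹' B ⊆ O := fun y hy => hUO (hB hy).1
  have hvol0 : (volume (shell r)) ^ Fintype.card Y ≠ 0 := pow_ne_zero _ (volume_shell_ne_zero hr)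
  have hvolt : (volume (shell r)) ^ Fintype.card Y ≠ ⊤ := ENNReal.pow_ne_top (volume_shell_ne_top r)
  have hSB : S (W ⁻¹' B) ⊆ S O := fun x hx => ⟨hx.1, hBO hx.2⟩
  have happ' : ApproximatesLinearOn Ψ L (S (W ⁻¹' B)) η := happ.mono_set (hSB.trans hSs)
  -- `Ψ` carries the polar set over `W ⁻¹' B` onto the one over `B`, and the common factor from the
  -- shells cancels.
  have h1 := hη1 _ _ happ'
  have h2 := hη2 _ _ happ'
  rw [himage B hBO fun y hy => (hB hy).2, volume_pi_inter_proj hr hr1 hBm,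
    volume_pi_inter_proj hr hr1 (hWc.measurable hBm)] at h1 h2
  constructor
  · rw [ENNReal.coe_inv hc0, ← ENNReal.div_eq_inv_mul,
      ENNReal.div_le_iff_le_mul (Or.inl (by simpa using hc0)) (Or.inl ENNReal.coe_ne_top),
      mul_assoc, ENNReal.mul_le_mul_iff_right hvol0 hvolt, mul_comm] at h2
    exact h2
  · rw [mul_left_comm, ENNReal.mul_le_mul_iff_right hvol0 hvolt] at h1
    exact h1

/-- The integral of a function supported near the identity is almost preserved by a family of words
with unimodular matrix of exponents and only the trivial solution. -/
theorem exists_nhds_abs_integral_word_sub_one_le (w : Y → FreeGroup Y)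
    (hdet : (Matrix.of fun r => FreeGroup.exponents (w r)).det.natAbs = 1)
    (hinj : ∀ y : Y → SU2, (∀ i, FreeGroup.lift y (w i) = 1) → y = 1) {ε : ℝ} (hε : 0 < ε) :
    ∃ U ∈ 𝓝 (1 : Y → SU2), ∀ F : (Y → SU2) → ℝ, Continuous F → (∀ y, 0 ≤ F y) →
      Function.support F ⊆ U → ∫ y, F y ∂(Measure.pi fun _ => haar) = 1 →
      |∫ y, F (fun i => FreeGroup.lift y (w i)) ∂(Measure.pi fun _ => haar) - 1| ≤ ε := by
  let c : NNReal := 1 + ⟨ε, hε.le⟩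
  have hcε : (c : ℝ) = 1 + ε := rfl
  have hc : 1 < c := by
    rw [← NNReal.coe_lt_coe, hcε]
    simpa using hε
  obtain ⟨U', hU', h⟩ := exists_nhds_measure_preimage_word w hdet hinj hc
  obtain ⟨U, hUU', hU, hU1⟩ := mem_nhds_iff.1 hU'
  refine ⟨U, hU.mem_nhds hU1, fun F hF hF0 hFU hF1 => ?_⟩
  set μ : Measure (Y → SU2) := Measure.pi fun _ => haar
  set W : (Y → SU2) → (Y → SU2) := fun y i => FreeGroup.lift y (w i)
  have hWc : Continuous W := continuous_pi fun i => continuous_lift_word (w i)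
  have hint : ∀ ν : Measure (Y → SU2), IsFiniteMeasure ν → Integrable F ν := fun ν _ =>
    (BoundedContinuousFunction.mkOfCompact ⟨F, hF⟩).integrable ν
  have hμ : IsFiniteMeasure (μ.map W) := Measure.isFiniteMeasure_map _ _
  have hzero : ∀ y, y ∉ U → F y = 0 := fun y hy => by
    by_contra h0
    exact hy (hFU h0)
  have h1 : (μ.map W).restrict U ≤ c • μ.restrict U := by
    refine Measure.le_iff.2 fun B hB => ?_
    rw [Measure.smul_apply, Measure.restrict_apply hB, Measure.restrict_apply hB,
      Measure.map_apply hWc.measurable (hB.inter hU.measurableSet)]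
    exact (h _ (Set.inter_subset_right.trans hUU') (hB.inter hU.measurableSet)).1
  have h2 : μ.restrict U ≤ c • (μ.map W).restrict U := by
    refine Measure.le_iff.2 fun B hB => ?_
    rw [Measure.smul_apply, Measure.restrict_apply hB, Measure.restrict_apply hB,
      Measure.map_apply hWc.measurable (hB.inter hU.measurableSet)]
    exact (h _ (Set.inter_subset_right.trans hUU') (hB.inter hU.measurableSet)).2
  have h3 : ∫ y, F y ∂(μ.map W) ≤ c • ∫ y, F y ∂μ := by
    rw [← setIntegral_eq_integral_of_forall_compl_eq_zero hzero,
      ← setIntegral_eq_integral_of_forall_compl_eq_zero (μ := μ) hzero,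
      ← integral_smul_nnreal_measure]
    exact integral_mono_measure h1 (ae_of_all _ hF0) (hint _ inferInstance)
  have h4 : ∫ y, F y ∂μ ≤ c • ∫ y, F y ∂(μ.map W) := by
    rw [← setIntegral_eq_integral_of_forall_compl_eq_zero hzero,
      ← setIntegral_eq_integral_of_forall_compl_eq_zero (μ := μ.map W) hzero,
      ← integral_smul_nnreal_measure]
    exact integral_mono_measure h2 (ae_of_all _ hF0) (hint _ inferInstance)
  rw [integral_map hWc.measurable.aemeasurable hF.aestronglyMeasurable, hF1, NNReal.smul_def, hcε,
    smul_eq_mul] at h3 h4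
  rw [abs_le]
  constructor <;> nlinarith

end Square

/-- If a family of words, at most as many as unknowns, has only the trivial solution in `SU(2)` and
in all cyclic groups of prime order, then the integral of a product of regularised `δ`-functions of
these words is close to one. -/
theorem exists_nhds_abs_integral_prod_word_sub_one_le {Y R : Type*} [Fintype Y] [Fintype R]
    (w : R → FreeGroup Y) (hcard : Fintype.card R ≤ Fintype.card Y)
    (hinj : ∀ y : Y → SU2, (∀ r, FreeGroup.lift y (w r) = 1) → y = 1)
    (hp : ∀ p : ℕ, p.Prime → ∀ y : Y → Multiplicative (ZMod p),
      (∀ r, FreeGroup.lift y (w r) = 1) → y = 1) {ε : ℝ} (hε : 0 < ε) :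
    ∃ U ∈ 𝓝 (1 : SU2), ∀ δ : R → SU2 → ℝ, (∀ r, Continuous (δ r)) → (∀ r g, 0 ≤ δ r g) →
      (∀ r, ∫ g, δ r g ∂haar = 1) → (∀ r, Function.support (δ r) ⊆ U) →
      |∫ y, ∏ r, δ r (FreeGroup.lift y (w r)) ∂(Measure.pi fun _ : Y => haar) - 1| ≤ ε := by
  classical
  -- The reverse inequality comes from solvability over `ℤ/2`; the system is square.
  obtain ⟨e⟩ := Fintype.card_eq.1 (hcard.antisymm (FreeGroup.card_le_of_words w hp))
  have hall : ∀ {G : Type} [Group G] (y : Y → G),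
      (∀ i, FreeGroup.lift y (w (e.symm i)) = 1) → ∀ r, FreeGroup.lift y (w r) = 1 :=
    fun y hy r => by simpa using hy (e r)
  obtain ⟨U', hU', h⟩ := exists_nhds_abs_integral_word_sub_one_le (fun i => w (e.symm i))
    (FreeGroup.natAbs_det_exponents _ fun p hp' y hy => hp p hp' y (hall y hy))
    (fun y hy => hinj y (hall y hy)) hε
  rw [nhds_pi, mem_pi'] at hU'
  obtain ⟨I, t, ht, hIt⟩ := hU'
  refine ⟨⋂ i, t i, iInter_mem.2 ht, fun δ hδ hδ0 hδ1 hδU => ?_⟩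
  have key := h (fun y => ∏ i, δ (e.symm i) (y i))
    (continuous_finsetProd _ fun i _ => (hδ _).comp (continuous_apply i))
    (fun y => Finset.prod_nonneg fun i _ => hδ0 _ _)
    (fun y hy => hIt fun i _ => Set.mem_iInter.1
      (hδU (e.symm i) (Finset.prod_ne_zero_iff.1 hy i (Finset.mem_univ i))) i)
    (by rw [integral_fintype_prod_eq_prod (fun i => δ (e.symm i))]; simp [hδ1])
  have hprod : ∀ y : Y → SU2, ∏ i, δ (e.symm i) (FreeGroup.lift y (w (e.symm i))) =
      ∏ r, δ r (FreeGroup.lift y (w r)) := fun y =>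
    Equiv.prod_comp e.symm fun r => δ r (FreeGroup.lift y (w r))
  simpa only [hprod] using key

end SU2

/-! ### Invariance of the Haar measure and conjugation -/

namespace SU2

instance instIsMulRightInvariantHaar : haar.IsMulRightInvariant where
  map_mul_right_eq_self g := by
    have : IsProbabilityMeasure (haar.map (· * g)) :=
      Measure.isProbabilityMeasure_map (measurable_mul_const g).aemeasurable
    exact Measure.isHaarMeasure_eq_of_isProbabilityMeasure _ _

instance instIsInvInvariantHaar : haar.IsInvInvariant where
  inv_eq_self := by
    have : IsProbabilityMeasure haar.inv :=
      Measure.isProbabilityMeasure_map measurable_inv.aemeasurable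
    have : haar.inv.IsHaarMeasure :=
      { lt_top_of_isCompact := fun K _ => measure_lt_top _ K
        open_pos := fun U hU hne => by
          rw [Measure.inv_apply]
          exact (hU.inv.measure_pos haar hne.inv).ne' }
    exact Measure.isHaarMeasure_eq_of_isProbabilityMeasure _ _

/-- Uniform in `k` by compactness of the group. The conjugations left over from gauge fixing depend
on the frozen variables, so a neighbourhood good for all of them is required. -/
theorem exists_nhds_conj (U : Set SU2) (hU : U ∈ 𝓝 1) :
    ∃ U₀ ∈ 𝓝 (1 : SU2), ∀ k x : SU2, k * x * k⁻¹ ∈ U₀ → x ∈ U := by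
  obtain ⟨V, hVU, hV, hV1⟩ := mem_nhds_iff.1 hU
  obtain ⟨U₀, hU₀, h⟩ := exists_nhds_preimage_subset (W := fun p : SU2 × SU2 => p.1 * p.2 * p.1⁻¹)
    (b := 1) (O := Prod.snd ⁻¹' V) (by fun_prop) (hV.preimage continuous_snd) fun p hp => by
      have h1 : p.2 = 1 := conj_eq_one_iff.1 hp
      rw [Set.mem_preimage, h1]
      exact hV1
  exact ⟨U₀, hU₀, fun k x hx => hVU (h (a := (k, x)) hx)⟩

theorem exists_nhds_forall_mem {ι : Type*} [Finite ι] {U : Set (ι → SU2)} (hU : U ∈ 𝓝 1) :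
    ∃ V ∈ 𝓝 (1 : SU2), ∀ y : ι → SU2, (∀ i, y i ∈ V) → y ∈ U := by
  rw [nhds_pi, mem_pi'] at hU
  obtain ⟨I, t, ht, hIt⟩ := hU
  exact ⟨⋂ i, t i, iInter_mem.2 ht, fun y hy => hIt fun i _ => Set.mem_iInter.1 (hy i) i⟩

/-- A continuous function on a compact space is integrable. -/
theorem integrable_of_continuous {X E : Type*} [TopologicalSpace X] [CompactSpace X]
    [MeasurableSpace X] [OpensMeasurableSpace X] [NormedAddCommGroup E]
    [SecondCountableTopologyEither X E] {μ : Measure X} [IsFiniteMeasure μ] {F : X → E} (hF : Continuous F) :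
    Integrable F μ := by
  obtain ⟨C, hC⟩ := (isCompact_range hF.norm).bddAbove
  exact Integrable.of_bound hF.aestronglyMeasurable C
    (ae_of_all _ fun x => hC ⟨x, rfl⟩)

end SU2

/-! ### Continuity of holonomies and flat connections -/

namespace FlagComplex.Framing

open SU2

variable {D : Type*} {M : FlagComplex D} (o : M.Framing)

theorem continuous_cross (d : D) : Continuous fun g : M.Cell 2 → SU2 => o.cross g d := by
  simp only [cross]
  split_ifs
  · exact continuous_apply _
  · exact (continuous_apply _).inv

theorem continuous_path (d : D) (m : ℕ) : Continuous fun g : M.Cell 2 → SU2 => o.path g d m := by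
  induction m with
  | zero => exact continuous_const
  | succ m ih => exact (o.continuous_cross _).mul ih

theorem continuous_bulkHolonomy (e : M.BulkEdge) :
    Continuous fun g : M.Cell 2 → SU2 => o.bulkHolonomy g e := o.continuous_path _ _

theorem continuous_bdryTransport (l : M.BdryEdge) :
    Continuous fun g : M.Cell 2 → SU2 => o.bdryTransport g l :=
  (o.continuous_path _ _).mul (o.continuous_cross _).inv

variable [Finite D]

/-- A connection on a ball which is flat off a maximal tree induces a trivial connection on the
boundary graph. -/
theorem exists_bdryTransport_eq (hM : M.IsBallDecomposition) {T : Set M.BulkEdge}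
    (hT : M.IsMaximalTree T) (g : M.Cell 2 → SU2)
    (h : ∀ e : M.BulkEdge, e ∉ T → o.bulkHolonomy g e = 1) :
    ∃ k : M.BdryFace → SU2, ∀ l, o.bdryTransport g l = k (o.target l) * (k (o.source l))⁻¹ := by
  obtain ⟨K, hK, hK3⟩ := o.exists_section hM hT g fun e he => by
    rw [← o.bulkHolonomy_eq, h e he]
  choose q hq using M.orbit_surjective {2}ᶜ
  have hval : ∀ d (hd : M.α 3 d = d),
      o.cross g (q (M.cell 2 d)) * K (q (M.cell 2 d)) = o.cross g d * K d := by
    intro d hd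
    refine orbit_ind (fun z => o.cross g z * K z = o.cross g d * K d) ?_
      (M.orbit_eq_of_cell_two_eq hd (hq (M.cell 2 d)).symm).symm rfl
    rintro j (rfl | rfl) z hz
    · rw [o.cross_eq, (o.conn g).x_α0, hK 0 z (by decide), ← hz, o.cross_eq]
    · rw [o.cross_eq, (o.conn g).x_α1, hK 1 z (by decide), ← hz, o.cross_eq]
  -- The section `K` lives in the 3-cells; one more transport takes it to the boundary node. By
  -- `hval` the flag chosen on the face is irrelevant.
  refine ⟨fun f => o.cross g (q f.1) * K (q f.1), fun l => ?_⟩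
  set b := o.base l.1 with hb
  have hb3 : M.α 3 b = b := o.base_bdry l.1 l.2
  obtain ⟨hs, hs3⟩ := M.steps_spec b hb3
  obtain ⟨n, hn⟩ := Nat.exists_eq_succ_of_ne_zero hs.ne'
  have hpath : ∀ m ≤ n, o.path g (M.turn b) m = K (M.turn^[m + 1] b) * (K b)⁻¹ := by
    intro m
    induction m with
    | zero =>
      intro _
      change 1 = K (M.α 2 (M.α 3 b)) * (K b)⁻¹
      rw [hb3, hK 2 b (by decide), mul_inv_cancel]
    | succ m ih =>
      intro hm
      rw [path, ih (by omega), ← mul_assoc, ← Function.iterate_succ_apply, o.cross_eq,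
        ← hK3 _ (M.not_fixed_of_lt_steps (by omega) (by omega)),
        Function.iterate_succ_apply' _ (m + 1), turn, hK 2 _ (by decide)]
  change o.path g (M.turn b) (M.steps b) * (o.cross g b)⁻¹ =
    (o.cross g (q (M.cell 2 (M.turn^[M.steps b] b))) * K (q (M.cell 2 (M.turn^[M.steps b] b)))) *
      (o.cross g (q (M.cell 2 b)) * K (q (M.cell 2 b)))⁻¹
  rw [hval _ hs3, hval _ hb3, hn, path, hpath n le_rfl, ← Function.iterate_succ_apply, mul_inv_rev]
  simp only [Nat.succ_eq_add_one, mul_assoc]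

/-- Where the regularised `δ`-functions do not vanish, a gauge-invariant boundary state is close to
its value at the trivial connection. -/
theorem exists_nhds_dist_lt (hM : M.IsBallDecomposition) {T : Set M.BulkEdge}
    (hT : M.IsMaximalTree T) {ψ : (M.BdryEdge → SU2) → ℂ} (hinv : o.GaugeInvariant ψ)
    (hcont : ContinuousAt ψ fun _ => 1) {ε : ℝ} (hε : 0 < ε) :
    ∃ U ∈ 𝓝 (1 : SU2), ∀ (h : M.BdryEdge → SU2) (g : M.Cell 2 → SU2),
      (∀ l, (h l)⁻¹ * o.bdryTransport g l ∈ U) →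
      (∀ e : M.BulkEdge, e ∉ T → o.bulkHolonomy g e ∈ U) → dist (ψ h) (ψ fun _ => 1) < ε := by
  obtain ⟨V, hV, hVo, hV1⟩ := mem_nhds_iff.1 (hcont (Metric.ball_mem_nhds _ hε))
  let γ : (M.BdryFace → SU2) → (M.BdryEdge → SU2) → M.BdryEdge → SU2 :=
    fun k h l => k (o.target l) * h l * (k (o.source l))⁻¹
  have hγ : ∀ k, Continuous (γ k) := fun k =>
    continuous_pi fun l => (continuous_const.mul (continuous_apply l)).mul continuous_const
  let Θ : (M.BdryEdge → SU2) × (M.Cell 2 → SU2) →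
      M.BdryEdge ⊕ {e : M.BulkEdge // e ∉ T} → SU2 := fun p =>
    Sum.elim (fun l => (p.1 l)⁻¹ * o.bdryTransport p.2 l) fun e => o.bulkHolonomy p.2 e.1
  have hΘ : Continuous Θ := by
    refine continuous_pi fun i => ?_
    rcases i with l | e
    · exact ((continuous_apply l).comp continuous_fst).inv.mul
        ((o.continuous_bdryTransport l).comp continuous_snd)
    · exact (o.continuous_bulkHolonomy e.1).comp continuous_snd
  have hO : IsOpen (Prod.fst ⁻¹' (⋃ k, γ k ⁻¹' V) :
      Set ((M.BdryEdge → SU2) × (M.Cell 2 → SU2))) :=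
    (isOpen_iUnion fun k => hVo.preimage (hγ k)).preimage continuous_fst
  -- Where all arguments of the `δ`-functions equal `1`, `h` is gauge equivalent to the trivial
  -- connection, so a gauge transformation moves it into `V`. Compactness extends this to arguments
  -- near `1`.
  obtain ⟨U', hU', hUO⟩ := exists_nhds_preimage_subset hΘ hO (b := 1) fun p hp => by
    obtain ⟨k, hk⟩ := o.exists_bdryTransport_eq hM hT p.2 fun e he => congrFun hp (.inr ⟨e, he⟩)
    refine Set.mem_iUnion.2 ⟨fun f => (k f)⁻¹, ?_⟩
    have h1 : γ (fun f => (k f)⁻¹) p.1 = fun _ => 1 := by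
      ext1 l
      have h2 : p.1 l = o.bdryTransport p.2 l := inv_mul_eq_one.1 (congrFun hp (.inl l))
      change (k (o.target l))⁻¹ * p.1 l * (k (o.source l))⁻¹⁻¹ = 1
      rw [h2, hk]
      group
    rw [Set.mem_preimage, h1]
    exact hV1
  obtain ⟨U, hU, hUU'⟩ := exists_nhds_forall_mem hU'
  refine ⟨U, hU, fun h g hh hg => ?_⟩
  have h1 : (h, g) ∈ Θ ⁻¹' U' := hUU' _ fun i => by
    rcases i with l | e
    · exact hh l
    · exact hg e.1 e.2
  obtain ⟨k, hk⟩ := Set.mem_iUnion.1 (hUO h1)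
  rw [← hinv k h]
  exact hV hk

end FlagComplex.Framing

/-! ### The total mass of the regularised `δ`-functions -/

namespace FlagComplex.Framing

open SU2

attribute [local instance] FlagComplex.Framing.instFintypeOfFinite

variable {D : Type*} [Finite D] {M : FlagComplex D} (o : M.Framing)

theorem abs_integral_sub_one_le {X : Type*} [MeasurableSpace X] {ν : Measure X}
    [IsProbabilityMeasure ν] {F : X → ℝ} (hF : Integrable F ν) {ε : ℝ}
    (h : ∀ x, |F x - 1| ≤ ε) : |∫ x, F x ∂ν - 1| ≤ ε := by
  have h1 : ∫ x, F x ∂ν - 1 = ∫ x, (F x - 1) ∂ν := by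
    rw [integral_sub hF (integrable_const _)]
    simp
  rw [h1, ← Real.norm_eq_abs]
  refine (norm_integral_le_of_norm_le_const (ae_of_all _ h)).trans ?_
  simp

/-- For each value of the face variables on the tree, the integral over the other face variables of
the regularised `δ`-functions is close to one. -/
theorem exists_nhds_abs_integral_coface_sub_one_le (hM : M.IsBallDecomposition)
    (hΓ : o.ConnectedBoundaryGraph) (hne : ∃ d, M.α 3 d = d) {T : Set M.BulkEdge}
    (hT : M.IsMaximalTree T) (t : M.DualTree) [Fintype t.Coface] {ε : ℝ} (hε : 0 < ε) :
    ∃ U ∈ 𝓝 (1 : SU2), ∀ δ : M.Cell 1 → SU2 → ℝ, (∀ e, Continuous (δ e)) →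
      (∀ e g, 0 ≤ δ e g) → (∀ e, ∫ g, δ e g ∂haar = 1) → (∀ e, Function.support (δ e) ⊆ U) →
      ∀ u : M.Cell 2 → SU2, |∫ y, ∏ e : {e : M.BulkEdge // e ∉ T},
        δ e.1.1 (o.bulkHolonomy (t.ext u y) e.1) ∂(Measure.pi fun _ : t.Coface => haar) - 1| ≤
          ε := by
  obtain ⟨U, hU, h⟩ := exists_nhds_abs_integral_prod_word_sub_one_le
    (fun e : {e : M.BulkEdge // e ∉ T} => t.word o e.1)
    (by
      rw [← Nat.card_eq_fintype_card, ← Nat.card_eq_fintype_card]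
      exact t.card_edges_le o hM.toIsCellular hΓ hne hT)
    (fun y hy => t.eq_one_of_lift_word o hM hT y fun e he => hy ⟨e, he⟩)
    (fun p _ y hy => t.eq_one_of_lift_word o hM hT y fun e he => hy ⟨e, he⟩) hε
  obtain ⟨U₀, hU₀, hconj⟩ := exists_nhds_conj U hU
  refine ⟨U₀, hU₀, fun δ hδ hδ0 hδ1 hδU u => ?_⟩
  obtain ⟨a, b, k, hk⟩ := t.exists_gauge o u
  -- Conjugation is absorbed into the `δ`-functions, which keep integral one; the factors `a` and
  -- `b` disappear by invariance of the Haar measure.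
  have key := h (fun e g => δ e.1.1 (k e.1 * g * (k e.1)⁻¹)) (fun e => (hδ _).comp (by fun_prop))
    (fun e g => hδ0 _ _)
    (fun e => by
      rw [integral_mul_left_eq_self (fun g => δ e.1.1 (g * (k e.1)⁻¹)),
        integral_mul_right_eq_self, hδ1])
    (fun e g hg => hconj _ _ (hδU _ hg))
  have hpres : MeasurePreserving (fun (y : t.Coface → SU2) f => a f * y f * b f)
      (Measure.pi fun _ => haar) (Measure.pi fun _ => haar) :=
    measurePreserving_pi (fun _ => haar) (fun _ => haar) (f := fun f x => a f * x * b f) fun f =>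
      (measurePreserving_mul_right haar (b f)).comp (measurePreserving_mul_left haar (a f))
  have hcont : Continuous fun y : t.Coface → SU2 => ∏ e : {e : M.BulkEdge // e ∉ T},
      δ e.1.1 (k e.1 * FreeGroup.lift y (t.word o e.1) * (k e.1)⁻¹) :=
    continuous_finsetProd _ fun e _ => (hδ _).comp
      ((continuous_const.mul (continuous_lift_word _)).mul continuous_const)
  rw [← hpres.map_eq, integral_map hpres.measurable.aemeasurable
    hcont.aestronglyMeasurable] at key
  simpa only [bulkHolonomy_eq, hk] using key

/-- The integral over the face variables of the regularised `δ`-functions of the bulk edges off a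
maximal tree is close to one. -/
theorem exists_nhds_abs_integral_bulk_sub_one_le (hM : M.IsBallDecomposition)
    (hΓ : o.ConnectedBoundaryGraph) (hne : ∃ d, M.α 3 d = d) {T : Set M.BulkEdge}
    (hT : M.IsMaximalTree T) {ε : ℝ} (hε : 0 < ε) :
    ∃ U ∈ 𝓝 (1 : SU2), ∀ δ : M.Cell 1 → SU2 → ℝ, (∀ e, Continuous (δ e)) →
      (∀ e g, 0 ≤ δ e g) → (∀ e, ∫ g, δ e g ∂haar = 1) → (∀ e, Function.support (δ e) ⊆ U) →
      |∫ g, ∏ e : {e : M.BulkEdge // e ∉ T}, δ e.1.1 (o.bulkHolonomy g e.1) ∂(faceMeasure M) - 1| ≤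
          ε := by
  obtain ⟨t⟩ := hM.nonempty_dualTree hne.choose
  let p : M.Cell 2 → Prop := fun f => ¬ M.IsBdry 2 f ∧ ∀ x, x ≠ t.root → M.cell 2 (t.dart x) ≠ f
  have : DecidablePred p := Classical.decPred p
  let : Fintype t.Coface := Subtype.fintype p
  obtain ⟨U, hU, h⟩ := o.exists_nhds_abs_integral_coface_sub_one_le hM hΓ hne hT t hε
  refine ⟨U, hU, fun δ hδ hδ0 hδ1 hδU => ?_⟩
  have hF : Continuous fun g : M.Cell 2 → SU2 =>
      ∏ e : {e : M.BulkEdge // e ∉ T}, δ e.1.1 (o.bulkHolonomy g e.1) :=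
    continuous_finsetProd _ fun e _ => (hδ _).comp (o.continuous_bulkHolonomy _)
  set F := fun g : M.Cell 2 → SU2 =>
      ∏ e : {e : M.BulkEdge // e ∉ T}, δ e.1.1 (o.bulkHolonomy g e.1)
  have hpres := (measurePreserving_piEquivPiSubtypeProd (fun _ : M.Cell 2 => haar) p).symm
  have hext : ∀ y z, (MeasurableEquiv.piEquivPiSubtypeProd (fun _ : M.Cell 2 => SU2) p).symm
      (y, z) = t.ext (fun f => if hf : p f then 1 else z ⟨f, hf⟩) y := by
    intro y z
    ext1 f
    by_cases hf : p f
    · rw [t.ext_coface _ _ ⟨f, hf⟩]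
      exact dif_pos hf
    · rw [t.ext_of_not _ _ hf, dif_neg hf]
      exact dif_neg hf
  have hint := (hpres.integrable_comp_emb (MeasurableEquiv.measurableEmbedding _)).2
    (integrable_of_continuous hF)
  have h1 : ∫ g, F g ∂(faceMeasure M) = _ :=
    (hpres.integral_comp' F).symm.trans (integral_prod_symm _ hint)
  change |∫ g, F g ∂(faceMeasure M) - 1| ≤ ε
  rw [h1]
  -- The bound holds for every frozen `z`, hence for the average over the probability measure.
  refine abs_integral_sub_one_le hint.integral_prod_right fun z => ?_
  simp only [Function.comp_def, hext]
  exact h δ hδ hδ0 hδ1 hδU _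

/-- The product of the regularised `δ`-functions. -/
noncomputable def density (T : Set M.BulkEdge) (δ : M.Cell 1 → SU2 → ℝ)
    (p : (M.BdryEdge → SU2) × (M.Cell 2 → SU2)) : ℝ :=
  (∏ l : M.BdryEdge, δ l.1 ((p.1 l)⁻¹ * o.bdryTransport p.2 l)) *
    ∏ e : {e : M.BulkEdge // e ∉ T}, δ e.1.1 (o.bulkHolonomy p.2 e.1)

theorem integrand_eq (T : Set M.BulkEdge) (ψ : (M.BdryEdge → SU2) → ℂ) (δ : M.Cell 1 → SU2 → ℝ)
    (p : (M.BdryEdge → SU2) × (M.Cell 2 → SU2)) :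
    o.integrand T ψ δ p = ψ p.1 * (o.density T δ p : ℂ) := by
  rw [integrand, density, Complex.ofReal_mul, mul_assoc]

theorem continuous_density (T : Set M.BulkEdge) {δ : M.Cell 1 → SU2 → ℝ}
    (hδ : ∀ e, Continuous (δ e)) : Continuous (o.density T δ) := by
  refine (continuous_finsetProd _ fun l _ => (hδ _).comp ?_).mul
    (continuous_finsetProd _ fun e _ => (hδ _).comp ?_)
  · exact ((continuous_apply l).comp continuous_fst).inv.mul
      ((o.continuous_bdryTransport l).comp continuous_snd)
  · exact (o.continuous_bulkHolonomy e.1).comp continuous_snd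

theorem density_nonneg (T : Set M.BulkEdge) {δ : M.Cell 1 → SU2 → ℝ} (hδ : ∀ e g, 0 ≤ δ e g)
    (p : (M.BdryEdge → SU2) × (M.Cell 2 → SU2)) : 0 ≤ o.density T δ p :=
  mul_nonneg (Finset.prod_nonneg fun _ _ => hδ _ _) (Finset.prod_nonneg fun _ _ => hδ _ _)

theorem ne_zero_of_density_ne_zero {T : Set M.BulkEdge} {δ : M.Cell 1 → SU2 → ℝ}
    {p : (M.BdryEdge → SU2) × (M.Cell 2 → SU2)} (hp : o.density T δ p ≠ 0) :
    (∀ l : M.BdryEdge, δ l.1 ((p.1 l)⁻¹ * o.bdryTransport p.2 l) ≠ 0) ∧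
      ∀ e : M.BulkEdge, e ∉ T → δ e.1 (o.bulkHolonomy p.2 e) ≠ 0 := by
  obtain ⟨h1, h2⟩ := mul_ne_zero_iff.1 hp
  exact ⟨fun l => Finset.prod_ne_zero_iff.1 h1 l (Finset.mem_univ l),
    fun e he => Finset.prod_ne_zero_iff.1 h2 ⟨e, he⟩ (Finset.mem_univ _)⟩

/-- Each `h_l` occurs in its own `δ`-function only, and inversion and translation of the Haar
measure make that integral one for fixed `g`. -/
theorem integral_density (T : Set M.BulkEdge) {δ : M.Cell 1 → SU2 → ℝ}
    (hδ : ∀ e, Continuous (δ e)) (hδ1 : ∀ e, ∫ g, δ e g ∂haar = 1) :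
    ∫ p, o.density T δ p ∂((bdryMeasure M).prod (faceMeasure M)) =
      ∫ g, ∏ e : {e : M.BulkEdge // e ∉ T}, δ e.1.1 (o.bulkHolonomy g e.1) ∂(faceMeasure M) := by
  have : IsFiniteMeasure (bdryMeasure M) := by unfold bdryMeasure; infer_instance
  have : IsFiniteMeasure (faceMeasure M) := by unfold faceMeasure; infer_instance
  rw [integral_prod_symm _ (integrable_of_continuous (o.continuous_density T hδ))]
  refine integral_congr_ae (ae_of_all _ fun g => ?_)
  simp only [density]
  rw [integral_mul_const, bdryMeasure,
    integral_fintype_prod_eq_prod (fun (l : M.BdryEdge) x => δ l.1 (x⁻¹ * o.bdryTransport g l)),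
    Finset.prod_eq_one, one_mul]
  intro l _
  rw [integral_inv_eq_self (fun x => δ l.1 (x * o.bdryTransport g l)), integral_mul_right_eq_self,
    hδ1]

end FlagComplex.Framing

/-! ### The limit of the regularised amplitudes -/

/-- On the 3-ball, the Ponzano–Regge amplitude of a gauge-invariant boundary state is its value at
the trivial connection. -/
theorem mainTheorem6 {D : Type*} [Finite D] (M : FlagComplex D) (hM : M.IsBallDecomposition)
    (o : M.Framing) (hΓ : o.ConnectedBoundaryGraph)
    (T : Set M.BulkEdge) (hT : M.IsMaximalTree T)
    (ψ : (M.BdryEdge → SU2) → ℂ) (hψ : MeasureTheory.MemLp ψ 2 (FlagComplex.Framing.bdryMeasure M))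
    (hinv : o.GaugeInvariant ψ) (hcont : ContinuousAt ψ fun _ => 1) :
    o.HasAmplitude T ψ (ψ fun _ => 1) := by
  intro δ hδ
  have : IsProbabilityMeasure (FlagComplex.Framing.bdryMeasure M) := by
    unfold FlagComplex.Framing.bdryMeasure
    infer_instance
  have : IsProbabilityMeasure (FlagComplex.Framing.faceMeasure M) := by
    unfold FlagComplex.Framing.faceMeasure
    infer_instance
  set μ := (FlagComplex.Framing.bdryMeasure M).prod (FlagComplex.Framing.faceMeasure M)
  have hne : ∃ d, M.α 3 d = d := by
    obtain ⟨φ⟩ := hM.homeo_ball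
    obtain ⟨⟨d, -⟩, -⟩ := Quot.exists_rep
      (φ.symm ⟨0, Metric.mem_closedBall_self zero_le_one⟩)
    obtain ⟨w, ⟨d', -, h⟩, -⟩ := hT.connects (M.cell 0 d)
    exact ⟨d', h⟩
  have hK : ∀ n, Continuous (o.density T (δ n)) := fun n =>
    o.continuous_density T fun e => (hδ e).continuous n
  have hK0 : ∀ n p, 0 ≤ o.density T (δ n) p := fun n p =>
    o.density_nonneg T (fun e => (hδ e).nonneg n) p
  -- On a probability space `L²` is contained in `L¹`, and the density is bounded by compactness.
  have hψ' : Integrable (fun p => ψ p.1) μ := (hψ.integrable one_le_two).comp_fst _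
  have hint : ∀ n, Integrable (o.integrand T ψ (δ n)) μ := by
    intro n
    obtain ⟨C, hC⟩ := (isCompact_range (hK n).norm).bddAbove
    have h1 := hψ'.mul_bdd (g := fun p => (o.density T (δ n) p : ℂ)) (c := C)
      (Complex.continuous_ofReal.comp (hK n)).aestronglyMeasurable
      (ae_of_all _ fun p => by
        rw [Complex.norm_real]
        exact hC ⟨p, rfl⟩)
    exact h1.congr (ae_of_all _ fun p => (o.integrand_eq T ψ (δ n) p).symm)
  refine ⟨hint, ?_⟩
  rw [Metric.tendsto_nhds]
  intro ε hε
  set z := ψ fun _ => 1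
  obtain ⟨η, hη, hη'⟩ : ∃ η > 0, η * (1 + η) + ‖z‖ * η < ε := by
    have h1 : Tendsto (fun η : ℝ => η * (1 + η) + ‖z‖ * η) (𝓝[>] 0) (𝓝 0) := by
      have : Continuous fun η : ℝ => η * (1 + η) + ‖z‖ * η := by fun_prop
      simpa using (this.tendsto 0).mono_left nhdsWithin_le_nhds
    obtain ⟨η, h2, h3⟩ := ((h1.eventually_lt_const hε).and self_mem_nhdsWithin).exists
    exact ⟨η, h3, h2⟩
  obtain ⟨U, hU, hUψ⟩ := o.exists_nhds_dist_lt hM hT hinv hcont hη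
  obtain ⟨U', hU', hmass⟩ := o.exists_nhds_abs_integral_bulk_sub_one_le hM hΓ hne hT hη
  filter_upwards [eventually_all.2 fun e => (hδ e).support_subset _ (inter_mem hU hU')] with n hn
  have hm := hmass (δ n) (fun e => (hδ e).continuous n) (fun e => (hδ e).nonneg n)
    (fun e => (hδ e).integral_eq_one n) fun e => (hn e).trans Set.inter_subset_right
  rw [← o.integral_density T (fun e => (hδ e).continuous n)
    fun e => (hδ e).integral_eq_one n] at hm
  have hKint : Integrable (o.density T (δ n)) μ := SU2.integrable_of_continuous (hK n)
  have hclose : ∀ p, ‖(ψ p.1 - z) * (o.density T (δ n) p : ℂ)‖ ≤ η * o.density T (δ n) p := by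
    intro p
    rw [norm_mul, Complex.norm_real, Real.norm_of_nonneg (hK0 n p)]
    by_cases h0 : o.density T (δ n) p = 0
    · simp [h0]
    refine mul_le_mul_of_nonneg_right ?_ (hK0 n p)
    obtain ⟨h1, h2⟩ := o.ne_zero_of_density_ne_zero h0
    rw [← dist_eq_norm]
    exact (hUψ p.1 p.2 (fun l => (hn _ (h1 l)).1) fun e he => (hn _ (h2 e he)).1).le
  set m := ∫ p, o.density T (δ n) p ∂μ
  -- The first term is at most `η * m`, because `ψ` is within `η` of `z` wherever the density is
  -- nonzero; the second is at most `‖z‖ * η`, because the mass `m` is within `η` of one.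
  have hsplit : ∫ p, o.integrand T ψ (δ n) p ∂μ - z =
      ∫ p, (ψ p.1 - z) * (o.density T (δ n) p : ℂ) ∂μ + z * ((m : ℂ) - 1) := by
    have h1 : ∀ p, (ψ p.1 - z) * (o.density T (δ n) p : ℂ) =
        o.integrand T ψ (δ n) p - z * (o.density T (δ n) p : ℂ) := fun p => by
      rw [o.integrand_eq, sub_mul]
    have h2 : Integrable (fun p => z * (o.density T (δ n) p : ℂ)) μ := hKint.ofReal.const_mul z
    simp only [h1]
    rw [integral_sub (hint n) h2, integral_const_mul, integral_complex_ofReal]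
    ring
  rw [dist_eq_norm, hsplit]
  have h1 : ‖∫ p, (ψ p.1 - z) * (o.density T (δ n) p : ℂ) ∂μ‖ ≤ η * m :=
    (norm_integral_le_of_norm_le (hKint.const_mul η) (ae_of_all _ hclose)).trans_eq
      (integral_const_mul _ _)
  have h2 : ‖z * ((m : ℂ) - 1)‖ ≤ ‖z‖ * η := by
    rw [norm_mul, ← Complex.ofReal_one, ← Complex.ofReal_sub, Complex.norm_real]
    exact mul_le_mul_of_nonneg_left hm (norm_nonneg z)
  have h3 : m ≤ 1 + η := by linarith [(abs_le.1 hm).2]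
  calc _ ≤ η * m + ‖z‖ * η := (norm_add_le _ _).trans (add_le_add h1 h2)
    _ ≤ η * (1 + η) + ‖z‖ * η := by gcongr
    _ < ε := hη'
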